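/- \textbf{Conventions.} The Lagrange spectrum $L$ is the set of finite values of $\limsup_{|q|\to\infty}\frac{1}{|q(q\alpha-p)|}$ ($p,q\in\mathbb Z$) for $\alpha\in\mathbb R\setminus\mathbb Q$. The Markov spectrum $M$ is the set of finite values of $\sqrt{b^2-4ac}\,/\inf_{(x,y)\in\mathbb Z^2\setminus\{0\}}|ax^2+bxy+cy^2|$ for real $a,b,c$ with $b^2-4ac>0$. For a bi-infinite sequence $S=(a_n)_{n\in\mathbb Z}$ of positive integers put $$\lambda_0(S)=[a_0;a_1,a_2,\dots]+[0;a_{-1},a_{-2},\dots].$$ An asterisk stands immediately to the right of the letter in position $0$; $\overline w$ is the infinite repetition of the finite word $w$ (to the left, to the right, or in both directions, according to its place); $w^T$ is $w$ written backwards. Let $\omega_2=123332112$ and $\omega_2^*=12333^*2112$, and let $$j_0=\lambda_0(\overline{12333^*2112}),\qquad j=\lambda_0(\overline{21}\,1112\,\omega_2\,\omega_2^*\,\overline{\omega_2}),$$ $$j'=\lambda_0(\overline{21}\,12332121\,12333212\,\omega_2\,\omega_2^*\,\overline{\omega_2}),\qquad J=\lambda_0(\overline{12}\,\omega_2\,\omega_2\,\omega_2^*\,\omega_2\,11\,\overline{12}).$$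 Let $$F=\{13,\ 232,\ 322,\ 323,\ 1\omega_2 12,\ 22\omega_2 12,\ 32\omega_2 12,\ \omega_2 121,\ \omega_2 122,\ 2112\omega_2 12\},\qquad \tilde F=F\cup F^T .$$ \textbf{Theorem.} One has $j_0<j<j'<J$, $M\cap(j_0,j)=\emptyset$ and $L\cap(j_0,J)=\emptyset$. Moreover $$(M\setminus L)\cap(j_0,J)=C\cup D\cup X,$$ where - $C$ is the set of all $\lambda_0(S\,t\,12\,\omega_2\,\omega_2^*\,\overline{\omega_2})$, where $S$ is a left-infinite sequence over $\{1,2,3\}$ and $t\in\{2,11\}$ are such that the left-infinite sequence $S\,t\,12\,\omega_2\,\omega_2\,1$ contains no word of $\tilde F$; - $D$ is the set of all $\lambda_0(\overline{\omega_2^T}\,21\,s\,12\,\omega_2\,\omega_2^*\,\overline{\omega_2})$, where $s$ is a nonempty finite word over $\{1,2,3\}$ that begins with $11$ or with $2$, ends with $11$ or with $2$, satisfies $[0;s^T]\le[0;s]$, and is such that $1\,\omega_2^T\,\omega_2^T\,21\,s\,12\,\omega_2\,\omega_2\,1$ contains no word of $\tilde F$; - $X=\{\lambda_0(\overline{\omega_2^T}\,2\,\omega_2\,\omega_2^*\,\overline{\omega_2}),\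 \lambda_0(\overline{\omega_2^T}\,212\,\omega_2\,\omega_2^*\,\overline{\omega_2}),\ \lambda_0(\overline{\omega_2^T}\,21112\,\omega_2\,\omega_2^*\,\overline{\omega_2})\}$. The set $C$ contains a translate of a Gauss--Cantor set, that is, of a set $\{[0;c,\gamma_1,\gamma_2,\dots]:\gamma_i\in B\}$ with $c$ a finite word and $B$ a finite set of at least two nonempty finite words of positive integers, none of which is a prefix of another. Every point of $D$ is an isolated point of $M\setminus L$. -/

import Mathlib

open Filter Topology

namespace MarkovLagrange

/-! ### The two spectra -/

/-- The Lagrange spectrum: the finite values of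
`limsup 1 / |q (q α - p)|`, over integers `p`, `q` with `|q| → ∞`, for irrational `α`. -/
def lagrangeSpectrum : Set ℝ :=
  {x | ∃ α : ℝ, Irrational α ∧
    limsup (fun v : ℤ × ℤ => ((1 / |(v.2 : ℝ) * ((v.2 : ℝ) * α - (v.1 : ℝ))| : ℝ) : EReal))
      (comap (fun v : ℤ × ℤ => |v.2|) atTop) = (x : EReal)}

/-- The infimum of `|a x² + b x y + c y²|` over the nonzero integer vectors `(x, y)`. -/
noncomputable def formInf (a b c : ℝ) : ℝ :=
  ⨅ v : {v : ℤ × ℤ // v ≠ 0},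
    |a * (v.1.1 : ℝ) ^ 2 + b * (v.1.1 : ℝ) * (v.1.2 : ℝ) + c * (v.1.2 : ℝ) ^ 2|

/-- The Markov spectrum: the finite values of `√Δ(q) / inf |q|` for indefinite real binary
quadratic forms `q`. -/
def markovSpectrum : Set ℝ :=
  {x | ∃ a b c : ℝ, 0 < b ^ 2 - 4 * a * c ∧ 0 < formInf a b c ∧
    x = √(b ^ 2 - 4 * a * c) / formInf a b c}

/-! ### Continued fractions -/

/-- The finite continued fraction `[0; a₁, …, aₙ]`. -/
noncomputable def cfFin : List ℕ → ℝ
  | [] => 0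
  | a :: l => 1 / ((a : ℝ) + cfFin l)

/-- The infinite continued fraction `[0; u 0, u 1, …]`, the limit of its convergents
(see `tendsto_cfInf`). -/
noncomputable def cfInf (u : ℕ → ℕ) : ℝ :=
  limUnder atTop (fun n : ℕ => cfFin ((List.range n).map u))

/-- `λ₀(S) = [S 0; S 1, S 2, …] + [0; S (-1), S (-2), …]`. -/
noncomputable def lambda0 (S : ℤ → ℕ) : ℝ :=
  ((S 0 : ℝ) + cfInf (fun n => S ((n : ℤ) + 1))) + cfInf (fun n => S (-((n : ℤ) + 1)))

theorem cfFin_nonneg (l : List ℕ) : 0 ≤ cfFin l := by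
  induction l with
  | nil => simp [cfFin]
  | cons a l ih => simp only [cfFin]; positivity

theorem cfFin_le_one (l : List ℕ) (h : ∀ a ∈ l, 1 ≤ a) : cfFin l ≤ 1 := by
  cases l with
  | nil => simp [cfFin]
  | cons a l =>
    have ha : (1 : ℝ) ≤ a := by exact_mod_cast h a (by simp)
    have := cfFin_nonneg l
    simp only [cfFin]
    rw [div_le_one (by linarith)]
    linarith

theorem map_range_succ (u : ℕ → ℕ) (n : ℕ) :
    (List.range (n + 1)).map u = u 0 :: (List.range n).map (fun i => u (i + 1)) := by
  rw [List.range_succ_eq_map, List.map_cons, List.map_map]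
  rfl

theorem abs_cfFin_sub_le (N : ℕ) : ∀ (u : ℕ → ℕ), (∀ i, 1 ≤ u i) → ∀ m n : ℕ,
    2 * N ≤ m → 2 * N ≤ n →
    |cfFin ((List.range m).map u) - cfFin ((List.range n).map u)| ≤ (1 / 4 : ℝ) ^ N := by
  induction N with
  | zero =>
    intro u hu m n _ _
    have h (k : ℕ) : ∀ a ∈ (List.range k).map u, 1 ≤ a := by
      intro a ha
      obtain ⟨i, _, rfl⟩ := List.mem_map.1 ha
      exact hu i
    have h1 := cfFin_nonneg ((List.range m).map u)
    have h2 := cfFin_nonneg ((List.range n).map u)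
    have h3 := cfFin_le_one _ (h m)
    have h4 := cfFin_le_one _ (h n)
    rw [pow_zero, abs_le]
    constructor <;> linarith
  | succ N ih =>
    intro u hu m n hm hn
    obtain ⟨m, rfl⟩ := Nat.exists_eq_add_of_le' (show 2 ≤ m by omega)
    obtain ⟨n, rfl⟩ := Nat.exists_eq_add_of_le' (show 2 ≤ n by omega)
    have key := ih (fun i => u (i + 1 + 1)) (fun i => hu _) m n (by omega) (by omega)
    have ha : (1 : ℝ) ≤ u 0 := by exact_mod_cast hu 0
    have hb : (1 : ℝ) ≤ u (0 + 1) := by exact_mod_cast hu (0 + 1)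
    rw [map_range_succ u (m + 1), map_range_succ _ m, map_range_succ u (n + 1),
      map_range_succ _ n]
    simp only [cfFin]
    have hx := cfFin_nonneg ((List.range m).map (fun i => u (i + 1 + 1)))
    have hy := cfFin_nonneg ((List.range n).map (fun i => u (i + 1 + 1)))
    set x := cfFin ((List.range m).map (fun i => u (i + 1 + 1)))
    set y := cfFin ((List.range n).map (fun i => u (i + 1 + 1)))
    set a : ℝ := ((u 0 : ℕ) : ℝ)
    set b : ℝ := ((u (0 + 1) : ℕ) : ℝ)
    have hP : 2 ≤ a * (b + x) + 1 := by nlinarith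
    have hQ : 2 ≤ a * (b + y) + 1 := by nlinarith
    have e : 1 / (a + 1 / (b + x)) - 1 / (a + 1 / (b + y))
        = (x - y) / ((a * (b + x) + 1) * (a * (b + y) + 1)) := by
      have h1 : b + x ≠ 0 := by positivity
      have h2 : b + y ≠ 0 := by positivity
      have h3 : a * (b + x) + 1 ≠ 0 := by positivity
      have h4 : a * (b + y) + 1 ≠ 0 := by positivity
      field_simp
      ring
    have hPQ : 4 ≤ (a * (b + x) + 1) * (a * (b + y) + 1) := by nlinarith
    rw [e, abs_div, abs_of_pos (show 0 < (a * (b + x) + 1) * (a * (b + y) + 1) by linarith),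
      div_le_iff₀ (by linarith), pow_succ]
    have hp : 0 ≤ (1 / 4 : ℝ) ^ N := by positivity
    nlinarith

/-- The convergents of an infinite continued fraction with positive partial quotients converge
to its value. -/
theorem tendsto_cfInf (u : ℕ → ℕ) (hu : ∀ i, 1 ≤ u i) :
    Tendsto (fun n : ℕ => cfFin ((List.range n).map u)) atTop (𝓝 (cfInf u)) := by
  have hc : CauchySeq (fun n : ℕ => cfFin ((List.range n).map u)) := by
    rw [Metric.cauchySeq_iff]
    intro ε hε
    obtain ⟨N, hN⟩ := exists_pow_lt_of_lt_one hε (show (1 / 4 : ℝ) < 1 by norm_num)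
    refine ⟨2 * N, fun m hm n hn => ?_⟩
    rw [Real.dist_eq]
    exact lt_of_le_of_lt (abs_cfFin_sub_le N u hu m n hm hn) hN
  exact tendsto_nhds_limUnder (cauchySeq_tendsto_of_complete hc)

/-! ### Words and bi-infinite sequences

Right-infinite sequences are functions `r : ℕ → ℕ` read from left to right.  Left-infinite
sequences are functions `l : ℕ → ℕ` read from right to left: `l 0` is the last letter. -/

/-- The right-infinite sequence `u r`. -/
def prepend (u : List ℕ) (r : ℕ → ℕ) : ℕ → ℕ :=
  fun n => if n < u.length then u.getD n 0 else r (n - u.length)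

/-- The right-infinite periodic sequence `w w w …` (for a nonempty word `w`). -/
def periodicRight (w : List ℕ) : ℕ → ℕ :=
  fun n => w.getD (n % w.length) 0

/-- The left-infinite periodic sequence `… w w w` (for a nonempty word `w`). -/
def periodicLeft (w : List ℕ) : ℕ → ℕ :=
  periodicRight w.reverse

/-- The word `ω₂ = 123332112`. -/
def omega : List ℕ := [1, 2, 3, 3, 3, 2, 1, 1, 2]

/-- The transpose `ω₂ᵀ = 211233321`. -/
def omegaT : List ℕ := omega.reverse

/-- The bi-infinite sequence `l u ω₂* v r`, where `ω₂* = 12333*2112`: the third `3` of the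
displayed copy of `ω₂` is at position `0`. -/
def starSeq (l : ℕ → ℕ) (u v : List ℕ) (r : ℕ → ℕ) : ℤ → ℕ
  | Int.ofNat n => prepend ([3, 2, 1, 1, 2] ++ v) r n
  | Int.negSucc n => prepend (u ++ [1, 2, 3, 3]).reverse l n

/-! ### The four constants -/

/-- `j₀ = λ₀(\overline{12333^*2112})`. -/
noncomputable def jZero : ℝ :=
  lambda0 (starSeq (periodicLeft omega) [] [] (periodicRight omega))

/-- `j = λ₀(\overline{21} 1112 ω₂ ω₂* \overline{ω₂})`. -/
noncomputable def jMin : ℝ :=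
  lambda0 (starSeq (periodicLeft [2, 1]) ([1, 1, 1, 2] ++ omega) [] (periodicRight omega))

/-- `j' = λ₀(\overline{21} 12332121 12333212 ω₂ ω₂* \overline{ω₂})`. -/
noncomputable def jPrime : ℝ :=
  lambda0 (starSeq (periodicLeft [2, 1])
    ([1, 2, 3, 3, 2, 1, 2, 1] ++ [1, 2, 3, 3, 3, 2, 1, 2] ++ omega) [] (periodicRight omega))

/-- `J = λ₀(\overline{12} ω₂ ω₂ ω₂* ω₂ 11 \overline{12})`. -/
noncomputable def jMax : ℝ :=
  lambda0 (starSeq (periodicLeft [1, 2]) (omega ++ omega) (omega ++ [1, 1])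
    (periodicRight [1, 2]))

/-! ### The sets `C`, `D`, `X` -/

/-- The set `F` of forbidden words. -/
def forbiddenWords : List (List ℕ) :=
  [[1, 3], [2, 3, 2], [3, 2, 2], [3, 2, 3],
    [1] ++ omega ++ [1, 2],
    [2, 2] ++ omega ++ [1, 2],
    [3, 2] ++ omega ++ [1, 2],
    omega ++ [1, 2, 1],
    omega ++ [1, 2, 2],
    [2, 1, 1, 2] ++ omega ++ [1, 2]]

/-- The finite word `u` contains, as a block of consecutive letters, no word of
`F ∪ Fᵀ`. -/
def Avoids (u : List ℕ) : Prop :=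
  ∀ f ∈ forbiddenWords, ¬ f <:+: u ∧ ¬ f.reverse <:+: u

/-- The left-infinite sequence `l u` contains no word of `F ∪ Fᵀ`. -/
def LeftAvoids (l : ℕ → ℕ) (u : List ℕ) : Prop :=
  ∀ m : ℕ, Avoids (((List.range m).map l).reverse ++ u)

/-- The values `λ₀(S t 12 ω₂ ω₂* \overline{ω₂})`, with `S` a left-infinite sequence over
`{1, 2, 3}` and `t ∈ {2, 11}` such that `S t 12 ω₂ ω₂ 1` contains no word of `F ∪ Fᵀ`. -/
def setC : Set ℝ :=
  {x | ∃ (S : ℕ → ℕ) (t : List ℕ), (∀ n, S n = 1 ∨ S n = 2 ∨ S n = 3) ∧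
    (t = [2] ∨ t = [1, 1]) ∧
    LeftAvoids S (t ++ [1, 2] ++ omega ++ omega ++ [1]) ∧
    x = lambda0 (starSeq S (t ++ [1, 2] ++ omega) [] (periodicRight omega))}

/-- The values `λ₀(\overline{ω₂ᵀ} 21 s 12 ω₂ ω₂* \overline{ω₂})`, with `s` a finite word over
`{1, 2, 3}` that begins with `11` or `2`, ends with `11` or `2`, satisfies
`[0; sᵀ] ≤ [0; s]`, and is such that `1 ω₂ᵀ ω₂ᵀ 21 s 12 ω₂ ω₂ 1` contains no word of
`F ∪ Fᵀ`. -/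
def setD : Set ℝ :=
  {x | ∃ s : List ℕ, (∀ a ∈ s, a = 1 ∨ a = 2 ∨ a = 3) ∧
    ([1, 1] <+: s ∨ [2] <+: s) ∧ ([1, 1] <:+ s ∨ [2] <:+ s) ∧
    cfFin s.reverse ≤ cfFin s ∧
    Avoids ([1] ++ omegaT ++ omegaT ++ [2, 1] ++ s ++ [1, 2] ++ omega ++ omega ++ [1]) ∧
    x = lambda0 (starSeq (periodicLeft omegaT) ([2, 1] ++ s ++ [1, 2] ++ omega) []
      (periodicRight omega))}

/-- The three values `λ₀(\overline{ω₂ᵀ} u ω₂ ω₂* \overline{ω₂})` with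
`u = 2`, `u = 212`, `u = 21112`. -/
def setX : Set ℝ :=
  {lambda0 (starSeq (periodicLeft omegaT) ([2] ++ omega) [] (periodicRight omega)),
    lambda0 (starSeq (periodicLeft omegaT) ([2, 1, 2] ++ omega) [] (periodicRight omega)),
    lambda0 (starSeq (periodicLeft omegaT) ([2, 1, 1, 1, 2] ++ omega) [] (periodicRight omega))}

/-! ### Gauss-Cantor sets -/

/-- `K` is a Gauss-Cantor set: for some finite set `B` of at least two nonempty words over the
positive integers, none of which begins with another one, and some finite word `c` over the
positive integers, `K` is the set of all `[0; c, γ₁, γ₂, …]` with `γᵢ ∈ B`. A sequence `u` is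
such a concatenation when it is `c γ₁ … γₙ` followed by something, for every `n`. -/
def IsGaussCantor (K : Set ℝ) : Prop :=
  ∃ (B : Finset (List ℕ)) (c : List ℕ), 2 ≤ B.card ∧
    (∀ β ∈ B, β ≠ [] ∧ ∀ a ∈ β, 1 ≤ a) ∧
    (∀ β ∈ B, ∀ β' ∈ B, β <+: β' → β = β') ∧
    (∀ a ∈ c, 1 ≤ a) ∧
    K = {x | ∃ (γ : ℕ → List ℕ) (u : ℕ → ℕ), (∀ i, γ i ∈ B) ∧
      (∀ n, ∃ r : ℕ → ℕ, u = prepend (c ++ ((List.range n).map γ).flatten) r) ∧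
      x = cfInf u}

end MarkovLagrange

namespace MarkovLagrange

/-! ### Continued fractions with a tail -/

/-! The proof translates both spectra into symbolic dynamics. A value of the Markov spectrum above 2
is the maximum of `lam` along a bi-infinite sequence of positive integers
(`exists_seq_of_mem_markovSpectrum`, with converse `mem_markovSpectrum`); a value of the Lagrange
spectrum above 3 is the upper limit of `lam` to the right along such a sequence
(`exists_seq_of_mem_lagrangeSpectrum`). In both directions the values of a form at integer vectors
are compared with the values of `lam` by the Euclidean algorithm and concavity.

If `lam` stays below J = `jMax`, the letters are 1, 2, 3, and finite searches with exact rational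
bounds exclude the words of `baseWords` and their transposes (`avoidOn_sideWords`). The remaining
word 2112 ω 12 marks a star. A star forces the word to its left, and it forces another star nine
places to the right unless its context is one critical pattern. In that pattern `lam` is at least J,
because J is the minimum of `lam` there (`IsStar.left`, `Tame.jMax_le`, `IsStar.right`). A further
search shows that `lam` can reach j₀ = `jZero` only at a star or at a star of the reversed sequence
(`isStar_or_of_le_lam`).

A star therefore replicates to the right forever, and the sequence is periodic with period ω from
there on. For a Markov value in (j₀, J) the maximum is attained, up to reversal, at a star. If all
preceding blocks were stars too, `lam` would equal j₀; a star with a star before it has a smaller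
`lam` than the first star of its run. So the maximum sits at the first star: the sequence is `Sharp`
(`exists_sharp`). Its right half is fixed, and `lam` depends on the left half alone. The left half
either contains no transposed star, which gives C, or contains one, and then it is periodic further
to the left, which gives D or X (`Sharp.mem_union`). Conversely the sequences that define C, D and X
are sharp, since they avoid all the relevant words (`Clean`, `sharp_of_reg`).

Along a sequence with a Lagrange value in (j₀, J), values of `lam` beyond some number above j₀ recur
arbitrarily far to the right. They occur at stars or transposed stars, and such places lie deep
inside long runs of stars, where `lam` is close to j₀: a contradiction (`not_frequently_of_tame`).
Hence L misses (j₀, J) and every Markov value there is outside L. A point of D is isolated because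
close values of `lam` share a long word to the left, and this word contains a transposed star, which
determines everything beyond it (`setD_isolated`). -/

/-- The continued fraction `[0; a₁, …, aₙ + z]`. -/
noncomputable def cfT : List ℕ → ℝ → ℝ
  | [], z => z
  | a :: l, z => 1 / ((a : ℝ) + cfT l z)

theorem cfT_zero (l : List ℕ) : cfT l 0 = cfFin l := by
  induction l with
  | nil => rfl
  | cons a l ih => simp only [cfT, cfFin, ih]

theorem cfT_append (l m : List ℕ) (z : ℝ) : cfT (l ++ m) z = cfT l (cfT m z) := by
  induction l with
  | nil => rfl
  | cons a l ih => simp only [List.cons_append, cfT, ih]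

theorem cfT_nonneg (l : List ℕ) {z : ℝ} (hz : 0 ≤ z) : 0 ≤ cfT l z := by
  induction l with
  | nil => exact hz
  | cons a l ih => simp only [cfT]; positivity

theorem cfT_le_one (l : List ℕ) (hl : ∀ a ∈ l, 1 ≤ a) {z : ℝ} (hz : 0 ≤ z) (hz1 : z ≤ 1) :
    cfT l z ≤ 1 := by
  cases l with
  | nil => exact hz1
  | cons a l =>
    have ha : (1 : ℝ) ≤ a := by exact_mod_cast hl a (by simp)
    have := cfT_nonneg l hz
    simp only [cfT]
    rw [div_le_one (by linarith)]
    linarith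

/-- Each letter contributes the decreasing map z ↦ 1 / (a + z), so the parity of the length decides
the direction. All comparisons of `lam` through a common word rest on this. -/
theorem cfT_lt_iff (l : List ℕ) (hl : ∀ a ∈ l, 1 ≤ a) {z w : ℝ} (hz : 0 ≤ z) (hw : 0 ≤ w) :
    cfT l z < cfT l w ↔ if Even l.length then z < w else w < z := by
  induction l generalizing z w with
  | nil => simp [cfT]
  | cons a l ih =>
    have ha : (1 : ℝ) ≤ a := by exact_mod_cast hl a (by simp)
    have h1 := cfT_nonneg l hz
    have h2 := cfT_nonneg l hw
    have h3 := ih (fun b hb => hl b (by simp [hb])) hw hz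
    simp only [cfT]
    rw [one_div_lt_one_div (by linarith) (by linarith), add_lt_add_iff_left, h3]
    simp only [List.length_cons, Nat.even_add_one]
    by_cases h : Even l.length <;> simp [h]

theorem cfT_le_iff (l : List ℕ) (hl : ∀ a ∈ l, 1 ≤ a) {z w : ℝ} (hz : 0 ≤ z) (hw : 0 ≤ w) :
    cfT l z ≤ cfT l w ↔ if Even l.length then z ≤ w else w ≤ z := by
  rw [← not_lt, cfT_lt_iff l hl hw hz]
  by_cases h : Even l.length <;> simp [h]

/-- The difference equals (x - y) / (P Q) with P = a (b + x) + 1 and Q = a (b + y) + 1, both at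
least 2. This is why powers of 1/4 count pairs of letters in all later estimates. -/
theorem abs_cfT_pair_sub_le {a b x y : ℝ} (ha : 1 ≤ a) (hb : 1 ≤ b) (hx : 0 ≤ x) (hy : 0 ≤ y) :
    |1 / (a + 1 / (b + x)) - 1 / (a + 1 / (b + y))| ≤ |x - y| / 4 := by
  have hP : 2 ≤ a * (b + x) + 1 := by nlinarith
  have hQ : 2 ≤ a * (b + y) + 1 := by nlinarith
  have e : 1 / (a + 1 / (b + x)) - 1 / (a + 1 / (b + y))
      = (x - y) / ((a * (b + x) + 1) * (a * (b + y) + 1)) := by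
    have h1 : b + x ≠ 0 := by positivity
    have h2 : b + y ≠ 0 := by positivity
    have h3 : a * (b + x) + 1 ≠ 0 := by positivity
    have h4 : a * (b + y) + 1 ≠ 0 := by positivity
    field_simp
    ring
  have hPQ : 4 ≤ (a * (b + x) + 1) * (a * (b + y) + 1) := by nlinarith
  rw [e, abs_div, abs_of_pos (show 0 < (a * (b + x) + 1) * (a * (b + y) + 1) by linarith)]
  exact div_le_div_of_nonneg_left (abs_nonneg _) (by norm_num) hPQ

theorem abs_cfT_sub_le (N : ℕ) : ∀ (l : List ℕ), (∀ a ∈ l, 1 ≤ a) → 2 * N ≤ l.length →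
    ∀ z w : ℝ, 0 ≤ z → z ≤ 1 → 0 ≤ w → w ≤ 1 → |cfT l z - cfT l w| ≤ (1 / 4 : ℝ) ^ N := by
  induction N with
  | zero =>
    intro l hl _ z w hz hz1 hw hw1
    have h1 := cfT_nonneg l hz
    have h2 := cfT_nonneg l hw
    have h3 := cfT_le_one l hl hz hz1
    have h4 := cfT_le_one l hl hw hw1
    rw [pow_zero, abs_le]
    constructor <;> linarith
  | succ N ih =>
    intro l hl hN z w hz hz1 hw hw1
    match l, hl, hN with
    | a :: b :: l, hl, hN =>
      have ha : (1 : ℝ) ≤ a := by exact_mod_cast hl a (by simp)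
      have hb : (1 : ℝ) ≤ b := by exact_mod_cast hl b (by simp)
      have key := ih l (fun c hc => hl c (by simp [hc]))
        (by simp only [List.length_cons] at hN; omega) z w hz hz1 hw hw1
      have := abs_cfT_pair_sub_le ha hb (cfT_nonneg l hz) (cfT_nonneg l hw)
      simp only [cfT]
      rw [pow_succ]
      linarith
    | [a], _, hN => simp at hN; omega
    | [], _, hN => simp at hN

/-! ### Prepending words to sequences -/

@[simp] theorem prepend_nil (r : ℕ → ℕ) : prepend [] r = r := by
  funext n; simp [prepend]

@[simp] theorem prepend_cons_zero (a : ℕ) (l : List ℕ) (r : ℕ → ℕ) : prepend (a :: l) r 0 = a := by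
  simp [prepend]

@[simp] theorem prepend_cons_succ (a : ℕ) (l : List ℕ) (r : ℕ → ℕ) (n : ℕ) :
    prepend (a :: l) r (n + 1) = prepend l r n := by
  simp [prepend]

theorem prepend_append (u v : List ℕ) (r : ℕ → ℕ) :
    prepend (u ++ v) r = prepend u (prepend v r) := by
  induction u with
  | nil => simp
  | cons a u ih =>
    funext n
    cases n with
    | zero => simp
    | succ n => simp [ih]

theorem prepend_add_length (u : List ℕ) (r : ℕ → ℕ) (n : ℕ) :
    prepend u r (u.length + n) = r n := by
  simp [prepend]

theorem prepend_of_lt (u : List ℕ) (r : ℕ → ℕ) {n : ℕ} (h : n < u.length) :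
    prepend u r n = u.getD n 0 := by
  simp [prepend, h]

theorem prepend_map_range (u : ℕ → ℕ) (n : ℕ) :
    prepend ((List.range n).map u) (fun k => u (n + k)) = u := by
  funext k
  by_cases h : k < n
  · rw [prepend_of_lt _ _ (by simpa using h)]
    simp [h]
  · obtain ⟨m, rfl⟩ := Nat.exists_eq_add_of_le (not_lt.1 h)
    have := prepend_add_length ((List.range n).map u) (fun k => u (n + k)) m
    simpa using this

theorem prepend_forall {p : ℕ → Prop} {u : List ℕ} {r : ℕ → ℕ} (hu : ∀ a ∈ u, p a)
    (hr : ∀ n, p (r n)) (n : ℕ) : p (prepend u r n) := by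
  by_cases h : n < u.length
  · rw [prepend_of_lt _ _ h]
    simp only [List.getD_eq_getElem?_getD, List.getElem?_eq_getElem h, Option.getD_some]
    exact hu _ (List.getElem_mem h)
  · obtain ⟨m, rfl⟩ := Nat.exists_eq_add_of_le (not_lt.1 h)
    rw [prepend_add_length]
    exact hr m

/-! ### Infinite continued fractions -/

theorem cfInf_nonneg (u : ℕ → ℕ) (hu : ∀ i, 1 ≤ u i) : 0 ≤ cfInf u :=
  ge_of_tendsto' (tendsto_cfInf u hu) (fun _ => cfFin_nonneg _)

theorem cfInf_succ (u : ℕ → ℕ) (hu : ∀ i, 1 ≤ u i) :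
    cfInf u = 1 / ((u 0 : ℝ) + cfInf (fun n => u (n + 1))) := by
  have h0 : (1 : ℝ) ≤ u 0 := by exact_mod_cast hu 0
  have h1 := (tendsto_cfInf u hu).comp (tendsto_add_atTop_nat 1)
  have h2 := tendsto_cfInf (fun n => u (n + 1)) (fun i => hu _)
  have h3 := cfInf_nonneg (fun n => u (n + 1)) (fun i => hu _)
  have h4 : Tendsto (fun n : ℕ => 1 / ((u 0 : ℝ) + cfFin ((List.range n).map fun n => u (n + 1))))
      atTop (𝓝 (1 / ((u 0 : ℝ) + cfInf (fun n => u (n + 1))))) :=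
    tendsto_const_nhds.div (tendsto_const_nhds.add h2) (by positivity)
  refine tendsto_nhds_unique h1 (h4.congr fun n => ?_)
  simp only [Function.comp, map_range_succ, cfFin]

theorem cfInf_pos (u : ℕ → ℕ) (hu : ∀ i, 1 ≤ u i) : 0 < cfInf u := by
  have h0 : (1 : ℝ) ≤ u 0 := by exact_mod_cast hu 0
  have h3 := cfInf_nonneg (fun n => u (n + 1)) (fun i => hu _)
  rw [cfInf_succ u hu]
  positivity

theorem cfInf_lt_one (u : ℕ → ℕ) (hu : ∀ i, 1 ≤ u i) : cfInf u < 1 := by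
  have h0 : (1 : ℝ) ≤ u 0 := by exact_mod_cast hu 0
  have h3 := cfInf_pos (fun n => u (n + 1)) (fun i => hu _)
  rw [cfInf_succ u hu, div_lt_one (by positivity)]
  linarith

theorem cfInf_prepend (l : List ℕ) (u : ℕ → ℕ) (hl : ∀ a ∈ l, 1 ≤ a) (hu : ∀ i, 1 ≤ u i) :
    cfInf (prepend l u) = cfT l (cfInf u) := by
  induction l with
  | nil => simp [cfT]
  | cons a l ih =>
    rw [cfInf_succ _ (prepend_forall hl hu)]
    simp only [prepend_cons_zero, prepend_cons_succ, cfT]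
    rw [← ih (fun b hb => hl b (by simp [hb]))]

theorem cfInf_eq_cfT (u : ℕ → ℕ) (hu : ∀ i, 1 ≤ u i) (n : ℕ) :
    cfInf u = cfT ((List.range n).map u) (cfInf fun k => u (n + k)) := by
  rw [← cfInf_prepend _ _ (by simpa using fun a _ => hu a) (fun i => hu _), prepend_map_range]

/-- A continued fraction is determined by its complete quotients. -/
theorem cfInf_of_complete_quotients (u : ℕ → ℕ) (c : ℕ → ℝ) (hu : ∀ n, 1 ≤ u n)
    (hc : ∀ n, 1 < c n) (h : ∀ n, c n = u n + 1 / c (n + 1)) :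
    cfInf u = 1 / c 0 := by
  have hpos (n : ℕ) : ∀ a ∈ (List.range n).map u, 1 ≤ a := by simpa using fun a _ => hu a
  have key (n : ℕ) : 1 / c 0 = cfT ((List.range n).map u) (1 / c n) := by
    induction n with
    | zero => simp [cfT]
    | succ n ih =>
      rw [ih, List.range_succ, List.map_append, cfT_append]
      simp only [List.map_cons, List.map_nil, cfT]
      rw [← h n]
  -- Both numbers start with the same 2N letters and have tails in [0, 1].
  have hb (N : ℕ) : |cfInf u - 1 / c 0| ≤ (1 / 4 : ℝ) ^ N := by
    rw [key (2 * N), cfInf_eq_cfT u hu (2 * N)]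
    have h1 := hc (2 * N)
    refine abs_cfT_sub_le N _ (hpos _) (by simp) _ _ (cfInf_nonneg _ fun i => hu _)
      (cfInf_lt_one _ fun i => hu _).le (by positivity) ?_
    rw [div_le_one (by linarith)]
    exact h1.le
  have hl : Tendsto (fun N : ℕ => (1 / 4 : ℝ) ^ N) atTop (𝓝 0) :=
    tendsto_pow_atTop_nhds_zero_of_lt_one (by norm_num) (by norm_num)
  have := ge_of_tendsto' hl hb
  have h0 : |cfInf u - 1 / c 0| = 0 := le_antisymm this (abs_nonneg _)
  linarith [abs_eq_zero.1 h0]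

theorem abs_cfInf_sub_le (u v : ℕ → ℕ) (hu : ∀ i, 1 ≤ u i) (hv : ∀ i, 1 ≤ v i) (N : ℕ)
    (h : ∀ i < 2 * N, u i = v i) : |cfInf u - cfInf v| ≤ (1 / 4 : ℝ) ^ N := by
  have e : (List.range (2 * N)).map u = (List.range (2 * N)).map v := by
    apply List.map_congr_left
    intro i hi
    exact h i (List.mem_range.1 hi)
  rw [cfInf_eq_cfT u hu (2 * N), cfInf_eq_cfT v hv (2 * N), ← e]
  exact abs_cfT_sub_le N _ (by simpa using fun a _ => hu a) (by simp) _ _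
    (cfInf_nonneg _ fun i => hu _) (cfInf_lt_one _ fun i => hu _).le
    (cfInf_nonneg _ fun i => hv _) (cfInf_lt_one _ fun i => hv _).le

/-- Sequences over `{1, 2, 3}` that differ at an early place have continued fractions that are
bounded away from each other. -/
theorem le_abs_cfInf_sub (n : ℕ) : ∀ (u v : ℕ → ℕ), (∀ i, 1 ≤ u i ∧ u i ≤ 3) →
    (∀ i, 1 ≤ v i ∧ v i ≤ 3) → u n ≠ v n →
    (1 / 64 : ℝ) * (1 / 16) ^ n ≤ |cfInf u - cfInf v| := by
  -- All values lie in [1/4, 4/5], so complete quotients with different first letters differ by at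
  -- least 1 - (4/5 - 1/4) = 9/20. Inversion on [1, 4] shrinks distances by a factor of at most 16,
  -- and 9/320 ≥ 1/64.
  have rng (u : ℕ → ℕ) (hu : ∀ i, 1 ≤ u i ∧ u i ≤ 3) : 1 / 4 ≤ cfInf u ∧ cfInf u ≤ 4 / 5 := by
    have lo (w : ℕ → ℕ) (hw : ∀ i, 1 ≤ w i ∧ w i ≤ 3) : 1 / 4 ≤ cfInf w := by
      have h1 : (w 0 : ℝ) ≤ 3 := by exact_mod_cast (hw 0).2
      have h2 := cfInf_lt_one (fun n => w (n + 1)) fun i => (hw _).1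
      have h3 := cfInf_nonneg (fun n => w (n + 1)) fun i => (hw _).1
      have h4 : (1 : ℝ) ≤ w 0 := by exact_mod_cast (hw 0).1
      rw [cfInf_succ w fun i => (hw _).1]
      exact one_div_le_one_div_of_le (by linarith) (by linarith)
    refine ⟨lo u hu, ?_⟩
    have h1 := lo (fun n => u (n + 1)) fun i => hu _
    have h4 : (1 : ℝ) ≤ u 0 := by exact_mod_cast (hu 0).1
    rw [cfInf_succ u fun i => (hu _).1, div_le_iff₀ (by linarith)]
    linarith
  have inv (A B : ℝ) (hA : 1 ≤ A) (hB : 1 ≤ B) (hA4 : A ≤ 4) (hB4 : B ≤ 4) :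
      |A - B| / 16 ≤ |1 / A - 1 / B| := by
    have e : 1 / A - 1 / B = (B - A) / (A * B) := by
      have : A ≠ 0 := by positivity
      have : B ≠ 0 := by positivity
      field_simp
    rw [e, abs_div, abs_sub_comm B A, abs_of_pos (show 0 < A * B by positivity)]
    exact div_le_div_of_nonneg_left (abs_nonneg _) (by positivity) (by nlinarith)
  have base (u v : ℕ → ℕ) (hu : ∀ i, 1 ≤ u i ∧ u i ≤ 3) (hv : ∀ i, 1 ≤ v i ∧ v i ≤ 3)
      (h : u 0 < v 0) : (1 / 64 : ℝ) ≤ |cfInf u - cfInf v| := by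
    have h' : (u 0 : ℝ) + 1 ≤ v 0 := by exact_mod_cast h
    obtain ⟨a1, a2⟩ := rng (fun n => u (n + 1)) fun i => hu _
    obtain ⟨b1, b2⟩ := rng (fun n => v (n + 1)) fun i => hv _
    have u1 : (1 : ℝ) ≤ u 0 := by exact_mod_cast (hu 0).1
    have v1 : (1 : ℝ) ≤ v 0 := by exact_mod_cast (hv 0).1
    have u3 : (u 0 : ℝ) ≤ 3 := by exact_mod_cast (hu 0).2
    have v3 : (v 0 : ℝ) ≤ 3 := by exact_mod_cast (hv 0).2
    rw [cfInf_succ u fun i => (hu _).1, cfInf_succ v fun i => (hv _).1]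
    refine le_trans ?_ (inv _ _ (by linarith) (by linarith) (by linarith) (by linarith))
    rw [abs_sub_comm, abs_of_pos (by linarith)]
    linarith
  induction n with
  | zero =>
    intro u v hu hv h
    rw [pow_zero, mul_one]
    rcases lt_or_gt_of_ne h with h | h
    · exact base u v hu hv h
    · rw [abs_sub_comm]; exact base v u hv hu h
  | succ n ih =>
    intro u v hu hv h
    by_cases h0 : u 0 = v 0
    · have key := ih (fun n => u (n + 1)) (fun n => v (n + 1)) (fun i => hu _) (fun i => hv _) h
      obtain ⟨a1, a2⟩ := rng (fun n => u (n + 1)) fun i => hu _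
      obtain ⟨b1, b2⟩ := rng (fun n => v (n + 1)) fun i => hv _
      have v1 : (1 : ℝ) ≤ v 0 := by exact_mod_cast (hv 0).1
      have v3 : (v 0 : ℝ) ≤ 3 := by exact_mod_cast (hv 0).2
      rw [cfInf_succ u fun i => (hu _).1, cfInf_succ v fun i => (hv _).1, h0]
      refine le_trans ?_ (inv _ _ (by linarith) (by linarith) (by linarith) (by linarith))
      rw [add_sub_add_left_eq_sub, pow_succ]
      linarith
    · have hb : (1 / 64 : ℝ) ≤ |cfInf u - cfInf v| := by
        rcases lt_or_gt_of_ne h0 with h | h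
        · exact base u v hu hv h
        · rw [abs_sub_comm]; exact base v u hv hu h
      have : (1 / 16 : ℝ) ^ (n + 1) ≤ 1 := pow_le_one₀ (by norm_num) (by norm_num)
      linarith

/-- For words of equal length, the order of the continued fractions does not depend on the
common tail. -/
theorem cfT_lt_cfT_iff_of_length_eq (l m : List ℕ) (h : l.length = m.length)
    (hl : ∀ a ∈ l, 1 ≤ a) (hm : ∀ a ∈ m, 1 ≤ a) {z w : ℝ} (hz : 0 ≤ z) (hz1 : z < 1)
    (hw : 0 ≤ w) (hw1 : w < 1) : cfT l z < cfT m z ↔ cfT l w < cfT m w := by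
  -- A difference of one between two letters outweighs the difference of the tails behind them, so
  -- the first differing letter decides the order whatever the common tail is.
  have gap (l m : List ℕ) (h : l.length = m.length) (hl : ∀ a ∈ l, 1 ≤ a) (hm : ∀ a ∈ m, 1 ≤ a)
      {z : ℝ} (hz : 0 ≤ z) (hz1 : z < 1) : cfT l z < 1 + cfT m z := by
    cases m with
    | nil =>
      have : l = [] := List.eq_nil_of_length_eq_zero (by simpa using h)
      subst this
      linarith
    | cons b m =>
      have h1 := cfT_le_one l hl hz hz1.le
      have h2 := cfT_nonneg m hz
      have hb : (1 : ℝ) ≤ b := by exact_mod_cast hm b (by simp)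
      have : 0 < cfT (b :: m) z := by simp only [cfT]; positivity
      linarith
  obtain ⟨n, hn⟩ : ∃ n, l.length = n := ⟨_, rfl⟩
  induction n generalizing l m with
  | zero =>
    have h1 : l = [] := List.eq_nil_of_length_eq_zero hn
    have h2 : m = [] := List.eq_nil_of_length_eq_zero (h ▸ hn)
    subst h1 h2
    simp [cfT]
  | succ n ih =>
    match l, m, h, hn with
    | a :: l, b :: m, h, hn =>
      have h' : l.length = m.length := by simpa using h
      have hn' : l.length = n := by simpa using hn
      have ha : (1 : ℝ) ≤ a := by exact_mod_cast hl a (by simp)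
      have hb : (1 : ℝ) ≤ b := by exact_mod_cast hm b (by simp)
      have hl' : ∀ a ∈ l, 1 ≤ a := fun c hc => hl c (by simp [hc])
      have hm' : ∀ a ∈ m, 1 ≤ a := fun c hc => hm c (by simp [hc])
      have e (x : ℝ) (hx : 0 ≤ x) : cfT (a :: l) x < cfT (b :: m) x ↔
          (b : ℝ) + cfT m x < a + cfT l x := by
        have := cfT_nonneg l hx
        have := cfT_nonneg m hx
        simp only [cfT]
        rw [one_div_lt_one_div (by linarith) (by linarith)]
      rw [e z hz, e w hw]
      rcases lt_trichotomy a b with hab | hab | hab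
      · have hab' : (a : ℝ) + 1 ≤ b := by exact_mod_cast hab
        have g1 := gap l m h' hl' hm' hz hz1
        have g2 := gap l m h' hl' hm' hw hw1
        constructor <;> intro <;> linarith
      · subst hab
        rw [add_lt_add_iff_left, add_lt_add_iff_left]
        exact ih m l h'.symm hm' hl' (h' ▸ hn')
      · have hab' : (b : ℝ) + 1 ≤ a := by exact_mod_cast hab
        have g1 := gap m l h'.symm hm' hl' hz hz1
        have g2 := gap m l h'.symm hm' hl' hw hw1
        constructor <;> intro <;> linarith

/-! ### Occurrences of words in bi-infinite sequences -/

/-- The word `u` occurs in `S`, read to the right, from the position `i`. -/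
def Occ (S : ℤ → ℕ) : ℤ → List ℕ → Prop
  | _, [] => True
  | i, a :: u => S i = a ∧ Occ S (i + 1) u

/-- The word `u` occurs in `S`, read to the left, from the position `i`. -/
def OccL (S : ℤ → ℕ) : ℤ → List ℕ → Prop
  | _, [] => True
  | i, a :: u => S i = a ∧ OccL S (i - 1) u

/-- The sequence `S` read backwards. -/
def rev (S : ℤ → ℕ) : ℤ → ℕ := fun i => S (-i)

/-- The value of `λ` at the position `i`. -/
noncomputable def lam (S : ℤ → ℕ) (i : ℤ) : ℝ := lambda0 (fun n => S (i + n))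

theorem lam_eq (S : ℤ → ℕ) (i : ℤ) :
    lam S i = S i + cfInf (fun n => S (i + 1 + n)) + cfInf (fun n => S (i - 1 - n)) := by
  simp only [lam, lambda0, add_zero]
  congr 3
  · funext n; congr 1; ring
  · funext n; congr 1; ring

theorem lam_zero (S : ℤ → ℕ) : lam S 0 = lambda0 S := by
  simp [lam]

theorem rev_rev (S : ℤ → ℕ) : rev (rev S) = S := by
  funext i; simp [rev]

theorem lam_rev (S : ℤ → ℕ) (i : ℤ) : lam (rev S) i = lam S (-i) := by
  rw [lam_eq, lam_eq, add_right_comm]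
  simp only [rev]
  congr 3
  · funext n; congr 1; ring
  · funext n; congr 1; ring

theorem occ_append {S : ℤ → ℕ} {u v : List ℕ} {i : ℤ} :
    Occ S i (u ++ v) ↔ Occ S i u ∧ Occ S (i + u.length) v := by
  induction u generalizing i with
  | nil => simp [Occ]
  | cons a u ih =>
    simp only [List.cons_append, Occ, ih, List.length_cons, and_assoc]
    rw [show i + 1 + (u.length : ℤ) = i + ((u.length + 1 : ℕ) : ℤ) by push_cast; ring]

theorem occL_append {S : ℤ → ℕ} {u v : List ℕ} {i : ℤ} :
    OccL S i (u ++ v) ↔ OccL S i u ∧ OccL S (i - u.length) v := by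
  induction u generalizing i with
  | nil => simp [OccL]
  | cons a u ih =>
    simp only [List.cons_append, OccL, ih, List.length_cons, and_assoc]
    rw [show i - 1 - (u.length : ℤ) = i - ((u.length + 1 : ℕ) : ℤ) by push_cast; ring]

theorem occL_iff {S : ℤ → ℕ} {u : List ℕ} {i : ℤ} :
    OccL S i u ↔ Occ S (i - u.length + 1) u.reverse := by
  induction u generalizing i with
  | nil => simp [OccL, Occ]
  | cons a u ih =>
    simp only [OccL, ih, List.length_cons, List.reverse_cons, occ_append, Occ, List.length_reverse,
      and_true]
    rw [show i - ((u.length + 1 : ℕ) : ℤ) + 1 = i - 1 - u.length + 1 by push_cast; ring,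
      show i - 1 - (u.length : ℤ) + 1 + u.length = i by ring, and_comm]

theorem occ_rev {S : ℤ → ℕ} {u : List ℕ} {i : ℤ} : Occ (rev S) i u ↔ OccL S (-i) u := by
  induction u generalizing i with
  | nil => simp [OccL, Occ]
  | cons a u ih =>
    simp only [OccL, Occ, ih, rev]
    rw [show -(i + 1) = -i - 1 by ring]

theorem occL_rev {S : ℤ → ℕ} {u : List ℕ} {i : ℤ} : OccL (rev S) i u ↔ Occ S (-i) u := by
  rw [show OccL (rev S) i u ↔ OccL (rev S) (-(-i)) u by rw [neg_neg], ← occ_rev, rev_rev]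

theorem occ_zipper {S : ℤ → ℕ} {l r : List ℕ} {i : ℤ} (hl : OccL S (i - 1) l) (hr : Occ S i r) :
    Occ S (i - l.length) (l.reverse ++ r) := by
  rw [occ_append]
  rw [occL_iff] at hl
  refine ⟨by convert hl using 1; ring, ?_⟩
  rwa [List.length_reverse, sub_add_cancel]

theorem Occ.apply {S : ℤ → ℕ} {u : List ℕ} {i : ℤ} (h : Occ S i u) {n : ℕ} (hn : n < u.length) :
    S (i + n) = u[n] := by
  induction u generalizing i n with
  | nil => simp at hn
  | cons a u ih =>
    cases n with
    | zero => simpa using h.1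
    | succ n =>
      have := ih h.2 (n := n) (by simpa using hn)
      simp only [List.getElem_cons_succ]
      rw [← this]
      congr 1
      push_cast
      ring

theorem occ_iff {S : ℤ → ℕ} {u : List ℕ} {i : ℤ} :
    Occ S i u ↔ ∀ n (hn : n < u.length), S (i + n) = u[n] := by
  refine ⟨fun h n hn => h.apply hn, fun h => ?_⟩
  induction u generalizing i with
  | nil => trivial
  | cons a u ih =>
    refine ⟨?_, ih fun n hn => ?_⟩
    · have := h 0 (by simp)
      rwa [Nat.cast_zero, add_zero] at this
    · have := h (n + 1) (by simpa using hn)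
      simp only [List.getElem_cons_succ] at this
      rw [← this]
      congr 1
      push_cast
      ring

theorem Occ.seq_eq {S : ℤ → ℕ} {u : List ℕ} {i : ℤ} (h : Occ S i u) :
    (fun n : ℕ => S (i + n)) = prepend u (fun n : ℕ => S (i + u.length + n)) := by
  induction u generalizing i with
  | nil => simp
  | cons a u ih =>
    funext n
    cases n with
    | zero => simpa using h.1
    | succ n =>
      rw [prepend_cons_succ]
      have := congrFun (ih h.2) n
      rw [show i + ((n + 1 : ℕ) : ℤ) = i + 1 + n by push_cast; ring, this]
      congr 1
      funext k
      congr 1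
      simp only [List.length_cons]
      push_cast
      ring

theorem OccL.seq_eq {S : ℤ → ℕ} {u : List ℕ} {i : ℤ} (h : OccL S i u) :
    (fun n : ℕ => S (i - n)) = prepend u (fun n : ℕ => S (i - u.length - n)) := by
  have h' : Occ (rev S) (-i) u := occ_rev.2 (by rwa [neg_neg])
  have := h'.seq_eq
  simp only [rev] at this
  convert this using 2
  · congr 1; ring
  · funext n; congr 1; ring

/-! ### Rational bounds -/

/-- Numerator and denominator of the upper (`true`) or lower (`false`) bound of a continued
fraction with a tail in `[0, 1]`. The bound and the choice of the endpoint alternate. -/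
def cfB : Bool → List ℕ → ℕ × ℕ
  | b, [] => (if b then 1 else 0, 1)
  | b, a :: l => ((cfB (!b) l).2, a * (cfB (!b) l).2 + (cfB (!b) l).1)

theorem cfB_snd_pos (b : Bool) (l : List ℕ) (hl : ∀ a ∈ l, 1 ≤ a) : 0 < (cfB b l).2 := by
  induction l generalizing b with
  | nil => simp [cfB]
  | cons a l ih =>
    have ha := hl a (by simp)
    have := ih (!b) fun c hc => hl c (by simp [hc])
    simp only [cfB]
    positivity

theorem cfB_bound (l : List ℕ) (hl : ∀ a ∈ l, 1 ≤ a) {z : ℝ} (hz : 0 ≤ z) (hz1 : z ≤ 1) :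
    ((cfB false l).1 : ℝ) / (cfB false l).2 ≤ cfT l z ∧
      cfT l z ≤ ((cfB true l).1 : ℝ) / (cfB true l).2 := by
  induction l with
  | nil => simp [cfB, cfT, hz, hz1]
  | cons a l ih =>
    have ha : (1 : ℝ) ≤ a := by exact_mod_cast hl a (by simp)
    have hl' : ∀ c ∈ l, 1 ≤ c := fun c hc => hl c (by simp [hc])
    obtain ⟨h1, h2⟩ := ih hl'
    have e (b : Bool) : ((cfB b (a :: l)).1 : ℝ) / (cfB b (a :: l)).2
        = 1 / (a + (cfB (!b) l).1 / (cfB (!b) l).2) := by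
      have : (0 : ℝ) < (cfB (!b) l).2 := by exact_mod_cast cfB_snd_pos _ l hl'
      have h3 : (0 : ℝ) ≤ (cfB (!b) l).1 := by positivity
      simp only [cfB]
      push_cast
      have : (a : ℝ) * (cfB (!b) l).2 + (cfB (!b) l).1 ≠ 0 := by positivity
      field_simp
    rw [e, e]
    simp only [cfT, Bool.not_false, Bool.not_true]
    have := cfT_nonneg l hz
    constructor
    · exact one_div_le_one_div_of_le (by linarith) (by linarith)
    · exact one_div_le_one_div_of_le (by positivity) (by linarith)

/-- Numerator and denominator of the bound of `λ` in terms of the letter in position `0` and the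
words to the left (read to the left) and to the right of it. -/
def lamB (b : Bool) (l : List ℕ) (c : ℕ) (r : List ℕ) : ℕ × ℕ :=
  (c * ((cfB b l).2 * (cfB b r).2) + (cfB b l).1 * (cfB b r).2 + (cfB b r).1 * (cfB b l).2,
    (cfB b l).2 * (cfB b r).2)

theorem cfInf_occ_eq {S : ℤ → ℕ} (hS : ∀ i, 1 ≤ S i) {i : ℤ} {r : List ℕ} (h : Occ S i r) :
    cfInf (fun n => S (i + n)) = cfT r (cfInf fun n => S (i + r.length + n)) := by
  rw [h.seq_eq, cfInf_prepend _ _ _ fun _ => hS _]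
  intro a ha
  obtain ⟨n, hn, rfl⟩ := List.mem_iff_getElem.1 ha
  rw [← h.apply hn]
  exact hS _

theorem cfInf_occL_eq {S : ℤ → ℕ} (hS : ∀ i, 1 ≤ S i) {i : ℤ} {r : List ℕ} (h : OccL S i r) :
    cfInf (fun n => S (i - n)) = cfT r (cfInf fun n => S (i - r.length - n)) := by
  have h' : Occ (rev S) (-i) r := occ_rev.2 (by rwa [neg_neg])
  have := cfInf_occ_eq (S := rev S) (fun i => hS (-i)) h'
  simp only [rev] at this
  convert this using 3
  · congr 1; ring
  · funext n; congr 1; ring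

theorem Occ.pos {S : ℤ → ℕ} (hS : ∀ i, 1 ≤ S i) {i : ℤ} {r : List ℕ} (h : Occ S i r) :
    ∀ a ∈ r, 1 ≤ a := by
  intro a ha
  obtain ⟨n, hn, rfl⟩ := List.mem_iff_getElem.1 ha
  rw [← h.apply hn]
  exact hS _

theorem OccL.pos {S : ℤ → ℕ} (hS : ∀ i, 1 ≤ S i) {i : ℤ} {r : List ℕ} (h : OccL S i r) :
    ∀ a ∈ r, 1 ≤ a :=
  Occ.pos (S := rev S) (fun i => hS (-i)) (i := -i) (occ_rev.2 (by rwa [neg_neg]))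

theorem lam_bound {S : ℤ → ℕ} (hS : ∀ i, 1 ≤ S i) {i : ℤ} {l r : List ℕ} {c : ℕ}
    (hl : OccL S (i - 1) l) (hr : Occ S i (c :: r)) :
    ((lamB false l c r).1 : ℝ) / (lamB false l c r).2 ≤ lam S i ∧
      lam S i ≤ ((lamB true l c r).1 : ℝ) / (lamB true l c r).2 := by
  have pl := hl.pos hS
  have pr := hr.2.pos hS
  have e (b : Bool) : ((lamB b l c r).1 : ℝ) / (lamB b l c r).2
      = c + (cfB b r).1 / (cfB b r).2 + (cfB b l).1 / (cfB b l).2 := by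
    have h1 : (0 : ℝ) < (cfB b l).2 := by exact_mod_cast cfB_snd_pos _ l pl
    have h2 : (0 : ℝ) < (cfB b r).2 := by exact_mod_cast cfB_snd_pos _ r pr
    simp only [lamB]
    push_cast
    field_simp
    ring
  rw [e, e, lam_eq, cfInf_occ_eq hS hr.2, cfInf_occL_eq hS hl, hr.1]
  have b1 := cfB_bound l pl (cfInf_nonneg (fun n => S (i - 1 - l.length - n)) fun _ => hS _)
    (cfInf_lt_one _ fun _ => hS _).le
  have b2 := cfB_bound r pr (cfInf_nonneg (fun n => S (i + 1 + r.length + n)) fun _ => hS _)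
    (cfInf_lt_one _ fun _ => hS _).le
  constructor <;> linarith [b1.1, b1.2, b2.1, b2.2]

/-- The rational number with numerator `t.1` and denominator `t.2`. -/
noncomputable def ratio (t : ℕ × ℕ) : ℝ := (t.1 : ℝ) / t.2

/-- Comparison of two fractions by cross multiplication. -/
def fracLe (s t : ℕ × ℕ) : Bool := Nat.ble (s.1 * t.2) (t.1 * s.2)

theorem fracLe_iff {s t : ℕ × ℕ} (hs : 0 < s.2) (ht : 0 < t.2) :
    fracLe s t = true ↔ ratio s ≤ ratio t := by
  have h1 : (0 : ℝ) < s.2 := by exact_mod_cast hs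
  have h2 : (0 : ℝ) < t.2 := by exact_mod_cast ht
  simp only [fracLe, ratio, Nat.ble_eq]
  rw [div_le_div_iff₀ h1 h2]
  exact_mod_cast Iff.rfl

/-! ### Exhaustive search -/

/-- The word `f` is a prefix of the second word. -/
def isPre : List ℕ → List ℕ → Bool
  | [], _ => true
  | _ :: _, [] => false
  | a :: f, b :: u => Nat.beq a b && isPre f u

/-- The word `f` is a block of the second word. -/
def isBlock (f : List ℕ) : List ℕ → Bool
  | [] => isPre f []
  | a :: u => isPre f (a :: u) || isBlock f u

/-- One of the given words is a block of `u`. -/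
def hasBlock (forb : List (List ℕ)) (u : List ℕ) : Bool :=
  forb.any fun f => isBlock f u

/-- Some letter `3` of the word has `λ ≥ t`, whatever the word is extended to. -/
def hasLarge (t : ℕ × ℕ) : List ℕ → List ℕ → Bool
  | _, [] => false
  | l, c :: r => (Nat.beq c 3 && fracLe t (lamB false l c r)) || hasLarge t (c :: l) r

/-- Extend the word, alternately to the right and to the left, until it is closed. -/
def search (closed : List ℕ → List ℕ → Bool) : ℕ → Bool → List ℕ → List ℕ → Bool
  | 0, _, l, r => closed l r
  | n + 1, true, l, r => closed l r || (search closed n false l (r ++ [1]) &&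
      search closed n false l (r ++ [2]) && search closed n false l (r ++ [3]))
  | n + 1, false, l, r => closed l r || (search closed n true (l ++ [1]) r &&
      search closed n true (l ++ [2]) r && search closed n true (l ++ [3]) r)

theorem isPre_sound {f u : List ℕ} (h : isPre f u = true) : f <+: u := by
  induction f generalizing u with
  | nil => simp
  | cons a f ih =>
    cases u with
    | nil => simp [isPre] at h
    | cons b u =>
      simp only [isPre, Bool.and_eq_true, Nat.beq_eq] at h
      obtain ⟨rfl, h⟩ := h
      simpa using ih h

theorem Occ.prefix {S : ℤ → ℕ} {f u : List ℕ} {i : ℤ} (h : Occ S i u) (hf : f <+: u) :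
    Occ S i f := by
  obtain ⟨v, rfl⟩ := hf
  exact (occ_append.1 h).1

theorem OccL.prefix {S : ℤ → ℕ} {f u : List ℕ} {i : ℤ} (h : OccL S i u) (hf : f <+: u) :
    OccL S i f := by
  obtain ⟨v, rfl⟩ := hf
  exact (occL_append.1 h).1

theorem isBlock_sound {f u : List ℕ} (h : isBlock f u = true) : f <:+: u := by
  induction u with
  | nil => exact (isPre_sound h).isInfix
  | cons a u ih =>
    simp only [isBlock, Bool.or_eq_true] at h
    rcases h with h | h
    · exact (isPre_sound h).isInfix
    · exact (ih h).trans (List.suffix_cons a u).isInfix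

theorem Occ.infix {S : ℤ → ℕ} {f u : List ℕ} {i : ℤ} (h : Occ S i u) (hf : f <:+: u) :
    ∃ k : ℕ, k + f.length ≤ u.length ∧ Occ S (i + k) f := by
  obtain ⟨s, t, rfl⟩ := hf
  rw [List.append_assoc, occ_append, occ_append] at h
  exact ⟨s.length, by simp, h.2.1⟩

/-- No word of the list occurs in `S` between the positions `a` and `b`. -/
def AvoidOn (S : ℤ → ℕ) (forb : List (List ℕ)) (a b : ℤ) : Prop :=
  ∀ f ∈ forb, ∀ k, a ≤ k → k + f.length ≤ b + 1 → ¬ Occ S k f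

theorem hasBlock_sound {S : ℤ → ℕ} {forb : List (List ℕ)} {u : List ℕ} {i a b : ℤ}
    (ha : AvoidOn S forb a b) (h : Occ S i u) (hi : a ≤ i) (hb : i + u.length ≤ b + 1) :
    ¬ hasBlock forb u = true := by
  intro hu
  simp only [hasBlock, List.any_eq_true] at hu
  obtain ⟨f, hf, hfu⟩ := hu
  obtain ⟨k, hk, ho⟩ := h.infix (isBlock_sound hfu)
  exact ha f hf _ (by omega) (by omega) ho

theorem hasLarge_sound {S : ℤ → ℕ} (hS : ∀ i, 1 ≤ S i) {t : ℕ × ℕ} (ht : 0 < t.2)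
    {l r : List ℕ} {i : ℤ} (hl : OccL S (i - 1) l) (hr : Occ S i r)
    (h : ∀ k, i ≤ k → k < i + r.length → lam S k < ratio t) : ¬ hasLarge t l r = true := by
  induction r generalizing l i with
  | nil => simp [hasLarge]
  | cons c r ih =>
    simp only [hasLarge, Bool.or_eq_true, Bool.and_eq_true]
    rintro (⟨-, h1⟩ | h1)
    · have h2 := lam_bound hS hl hr
      have hp : 0 < (lamB false l c r).2 :=
        Nat.mul_pos (cfB_snd_pos _ _ (hl.pos hS)) (cfB_snd_pos _ _ (hr.2.pos hS))
      rw [fracLe_iff ht hp] at h1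
      have h3 := h i le_rfl (by simp)
      simp only [ratio] at h1 h3
      linarith [h2.1]
    · refine ih (l := c :: l) (i := i + 1) ?_ hr.2 (fun k hk hk' => h k (by omega) ?_) h1
      · rw [add_sub_cancel_right]
        exact ⟨hr.1, hl⟩
      · simp only [List.length_cons]; push_cast; omega

/-- The letters of `S` next to the word select one branch of the search tree, and a successful
search closes that branch. The flag says which side grows first; the length bounds keep the closed
word inside a known window. -/
theorem search_sound {S : ℤ → ℕ} (closed : List ℕ → List ℕ → Bool) (n : ℕ) :
    ∀ (b : Bool) (l r : List ℕ) (i : ℤ), search closed n b l r = true →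
    (∀ k, i - l.length - n ≤ k → k < i + r.length + n → S k = 1 ∨ S k = 2 ∨ S k = 3) →
    OccL S (i - 1) l → Occ S i r →
    ∃ l' r', closed l' r' = true ∧ OccL S (i - 1) l' ∧ Occ S i r' ∧
      l'.length ≤ l.length + (if b then n / 2 else (n + 1) / 2) ∧
      r'.length ≤ r.length + (if b then (n + 1) / 2 else n / 2) := by
  induction n with
  | zero =>
    intro b l r i h _ hl hr
    exact ⟨l, r, by simpa [search] using h, hl, hr, by omega, by omega⟩
  | succ n ih =>
    intro b l r i h hS hl hr
    by_cases hc : closed l r = true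
    · exact ⟨l, r, hc, hl, hr, by omega, by omega⟩
    · cases b with
      | true =>
        simp only [search, Bool.or_eq_true, hc, false_or, Bool.and_eq_true, Bool.false_eq_true]
          at h
        have step (a : ℕ) (ha : S (i + r.length) = a)
            (hs : search closed n false l (r ++ [a]) = true) : ∃ l' r', closed l' r' = true ∧
              OccL S (i - 1) l' ∧ Occ S i r' ∧
              l'.length ≤ l.length + (n + 1) / 2 ∧ r'.length ≤ r.length + (n + 1 + 1) / 2 := by
          obtain ⟨l', r', h1, h2, h3, h4, h5⟩ := ih false l (r ++ [a]) i hs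
            (fun k hk hk' => hS k (by push_cast; omega)
              (by simp only [List.length_append, List.length_singleton] at hk'
                  push_cast at hk' ⊢; omega)) hl (occ_append.2 ⟨hr, ha, trivial⟩)
          simp only [List.length_append, List.length_singleton, Bool.false_eq_true, if_false]
            at h4 h5
          exact ⟨l', r', h1, h2, h3, by omega, by omega⟩
        simp only [if_true]
        rcases hS (i + r.length) (by push_cast; omega) (by push_cast; omega) with ha | ha | ha
        · exact step 1 ha h.1.1
        · exact step 2 ha h.1.2
        · exact step 3 ha h.2
      | false =>
        simp only [search, Bool.or_eq_true, hc, false_or, Bool.and_eq_true, Bool.false_eq_true]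
          at h
        have step (a : ℕ) (ha : S (i - 1 - l.length) = a)
            (hs : search closed n true (l ++ [a]) r = true) : ∃ l' r', closed l' r' = true ∧
              OccL S (i - 1) l' ∧ Occ S i r' ∧
              l'.length ≤ l.length + (n + 1 + 1) / 2 ∧ r'.length ≤ r.length + (n + 1) / 2 := by
          obtain ⟨l', r', h1, h2, h3, h4, h5⟩ := ih true (l ++ [a]) r i hs
            (fun k hk hk' => hS k
              (by simp only [List.length_append, List.length_singleton] at hk
                  push_cast at hk ⊢; omega) (by push_cast; omega))
            (occL_append.2 ⟨hl, ha, trivial⟩) hr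
          simp only [List.length_append, List.length_singleton, if_true] at h4 h5
          exact ⟨l', r', h1, h2, h3, by omega, by omega⟩
        simp only [Bool.false_eq_true, if_false]
        rcases hS (i - 1 - l.length) (by push_cast; omega) (by push_cast; omega) with ha | ha | ha
        · exact step 1 ha h.1.1
        · exact step 2 ha h.1.2
        · exact step 3 ha h.2

/-! ### Normalized forms with roots `ξ` and `-η` -/

/-- The absolute value of the form `(X - ξ Y) (X + η Y)`, divided by the square root of its
discriminant. -/
noncomputable def gform (ξ η X Y : ℝ) : ℝ := |(X - ξ * Y) * (X + η * Y)| / (ξ + η)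

theorem gform_neg (ξ η X Y : ℝ) : gform ξ η (-X) (-Y) = gform ξ η X Y := by
  simp only [gform]
  congr 2
  ring

theorem gform_one_zero {ξ η : ℝ} : gform ξ η 1 0 = 1 / (ξ + η) := by
  simp [gform]

/-- The unimodular substitution (X, Y) ↦ (Y, X - a Y) of the Euclidean algorithm carries one reduced
form to the next, up to sign; dividing by the root of the discriminant makes the values invariant.
-/
theorem gform_step {a ξ η ξ' η' : ℝ} (hξ' : 0 < ξ') (hη : 0 < a + η) (h : ξ = a + 1 / ξ')
    (h' : η' = 1 / (a + η)) (X Y : ℝ) : gform ξ η X Y = gform ξ' η' Y (X - a * Y) := by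
  have hη' : 0 < η' := by rw [h']; positivity
  have hs : 0 < ξ + η := by
    have : 0 < 1 / ξ' := by positivity
    linarith
  have e1 : (X - ξ * Y) * (X + η * Y) * (ξ' + η')
      = -((Y - ξ' * (X - a * Y)) * (Y + η' * (X - a * Y)) * (ξ + η)) := by
    subst h h'
    field_simp
    ring
  simp only [gform]
  rw [div_eq_div_iff hs.ne' (by positivity), ← abs_of_pos (show 0 < ξ' + η' by positivity),
    ← abs_mul, e1, abs_neg, abs_mul, abs_of_pos hs]

/-- A quadratic form that is concave in `X` is bounded below between two values of `X`. -/
theorem concave_bound {a ξ η m X Y : ℝ} (hξ : a < ξ) (hη : 0 ≤ η) (h0 : m ≤ ξ * η)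
    (h1 : m ≤ (ξ - a) * (a + η)) (hX : 0 ≤ X) (hXY : X ≤ a * Y) (hY : 0 < Y) :
    m * Y ^ 2 ≤ |(X - ξ * Y) * (X + η * Y)| := by
  have e : |(X - ξ * Y) * (X + η * Y)| = (ξ * Y - X) * (X + η * Y) := by
    rw [abs_mul, abs_of_nonpos (by nlinarith), abs_of_nonneg (by positivity)]
    ring
  rw [e]
  rcases hX.eq_or_lt with rfl | hX0
  · nlinarith [sq_nonneg Y]
  · have haY : 0 < a * Y := by linarith
    have k1 : 0 ≤ (a * Y - X) * (Y ^ 2 * (ξ * η - m)) := by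
      apply mul_nonneg (by linarith); apply mul_nonneg (by positivity); linarith
    have k2 : 0 ≤ X * (Y ^ 2 * ((ξ - a) * (a + η) - m)) := by
      apply mul_nonneg hX; apply mul_nonneg (by positivity); linarith
    have k3 : 0 ≤ X * (a * Y - X) := mul_nonneg hX (by linarith)
    -- Multiplied by a Y, the excess over m Y² is the linear interpolation of its values at X = 0
    -- and X = a Y plus a concavity term.
    have k4 : 0 ≤ (a * Y) * ((ξ * Y - X) * (X + η * Y) - m * Y ^ 2) := by
      have : (a * Y) * ((ξ * Y - X) * (X + η * Y) - m * Y ^ 2)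
        = (a * Y - X) * (Y ^ 2 * (ξ * η - m)) + X * (Y ^ 2 * ((ξ - a) * (a + η) - m))
          + (a * Y) * (X * (a * Y - X)) := by ring
      rw [this]
      have := mul_nonneg haY.le k3
      linarith
    linarith [nonneg_of_mul_nonneg_right k4 haY]

/-! ### The roots attached to the positions of a bi-infinite sequence -/

/-- The continued fraction `[S i; S (i + 1), …]`. -/
noncomputable def xi (S : ℤ → ℕ) (i : ℤ) : ℝ := S i + cfInf (fun n => S (i + 1 + n))

/-- The continued fraction `[0; S (i - 1), S (i - 2), …]`. -/
noncomputable def eta (S : ℤ → ℕ) (i : ℤ) : ℝ := cfInf (fun n => S (i - 1 - n))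

theorem lam_eq_xi_add_eta (S : ℤ → ℕ) (i : ℤ) : lam S i = xi S i + eta S i := lam_eq S i

theorem xi_succ {S : ℤ → ℕ} (hS : ∀ i, 1 ≤ S i) (i : ℤ) :
    xi S i = S i + 1 / xi S (i + 1) := by
  rw [xi, cfInf_succ _ fun _ => hS _, xi]
  congr 4
  · simp
  · funext n
    congr 1
    push_cast
    ring

theorem eta_succ {S : ℤ → ℕ} (hS : ∀ i, 1 ≤ S i) (i : ℤ) :
    eta S (i + 1) = 1 / (S i + eta S i) := by
  rw [eta, cfInf_succ _ fun _ => hS _, eta]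
  congr 3
  · simp
  · funext n
    congr 1
    push_cast
    ring

theorem lt_xi {S : ℤ → ℕ} (hS : ∀ i, 1 ≤ S i) (i : ℤ) : (S i : ℝ) < xi S i := by
  have := cfInf_pos (fun n => S (i + 1 + n)) fun _ => hS _
  simp only [xi]
  linarith

theorem one_lt_xi {S : ℤ → ℕ} (hS : ∀ i, 1 ≤ S i) (i : ℤ) : 1 < xi S i := by
  have h1 : (1 : ℝ) ≤ S i := by exact_mod_cast hS i
  have := lt_xi hS i
  linarith

theorem eta_pos {S : ℤ → ℕ} (hS : ∀ i, 1 ≤ S i) (i : ℤ) : 0 < eta S i :=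
  cfInf_pos _ fun _ => hS _

theorem gform_succ {S : ℤ → ℕ} (hS : ∀ i, 1 ≤ S i) (i : ℤ) (X Y : ℝ) :
    gform (xi S i) (eta S i) X Y = gform (xi S (i + 1)) (eta S (i + 1)) Y (X - S i * Y) := by
  have h1 := one_lt_xi hS (i + 1)
  have h2 := eta_pos hS i
  exact gform_step (by linarith) (by positivity) (xi_succ hS i) (eta_succ hS i) X Y

/-- If all `λ` are at most `x`, then the forms attached to the sequence are at least `1 / x` on
integer vectors. -/
theorem le_gform_of_lam_le {S : ℤ → ℕ} (hS : ∀ i, 1 ≤ S i) {x : ℝ} (hx : 0 < x)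
    (h : ∀ i, lam S i ≤ x) : ∀ (N : ℕ) (X Y : ℤ) (i : ℤ), X.natAbs + Y.natAbs ≤ N →
    (X ≠ 0 ∨ Y ≠ 0) → 1 / x ≤ gform (xi S i) (eta S i) X Y := by
  have hone (i : ℤ) : 1 / x ≤ 1 / (xi S i + eta S i) := by
    have h1 := one_lt_xi hS i
    have h2 := eta_pos hS i
    have := h i
    rw [lam_eq_xi_add_eta] at this
    exact one_div_le_one_div_of_le (by linarith) this
  -- The values at (0, 1) and (S i, 1) are those of the forms at i - 1 and i + 1 at the vector (1,
  -- 0), that is, the reciprocals of `lam` there.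
  have hconc (i : ℤ) (X Y : ℝ) (hX : 0 ≤ X) (hXY : X ≤ S i * Y) (hY : 1 ≤ Y) :
      1 / x ≤ gform (xi S i) (eta S i) X Y := by
    have h1 := one_lt_xi hS i
    have h2 := eta_pos hS i
    have h3 := lt_xi hS i
    have hs : 0 < xi S i + eta S i := by linarith
    have e0 : 1 / x ≤ gform (xi S i) (eta S i) 0 1 := by
      have := gform_succ hS (i - 1) 1 0
      rw [sub_add_cancel] at this
      simp only [mul_zero, sub_zero] at this
      rw [← this, gform_one_zero]
      exact hone _
    have e1 : 1 / x ≤ gform (xi S i) (eta S i) (S i) 1 := by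
      rw [gform_succ hS i, mul_one, sub_self, gform_one_zero]
      exact hone _
    simp only [gform] at e0 e1
    rw [le_div_iff₀ hs] at e0 e1
    have a0 : |(0 - xi S i * 1) * (0 + eta S i * 1)| = xi S i * eta S i := by
      rw [abs_mul, abs_of_nonpos (by linarith), abs_of_nonneg (by linarith)]
      ring
    have a1 : |(S i - xi S i * 1) * (S i + eta S i * 1)| = (xi S i - S i) * (S i + eta S i) := by
      rw [abs_mul, abs_of_nonpos (by linarith), abs_of_nonneg (by positivity)]
      ring
    rw [a0] at e0
    rw [a1] at e1
    have := concave_bound h3 h2.le e0 e1 hX hXY (by linarith)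
    simp only [gform]
    rw [le_div_iff₀ hs]
    have hm : 0 < 1 / x * (xi S i + eta S i) := by positivity
    exact (le_mul_of_one_le_right hm.le (one_le_pow₀ hY)).trans this
  intro N
  induction N with
  | zero => intro X Y i h0 h1; omega
  | succ N ih =>
    -- Euclidean descent on |X| + |Y|, after a change of sign: a vector with X > S i * Y is moved to
    -- the position i + 1, one with X < 0 to i - 1, until it falls in the range of concavity or Y
    -- vanishes.
    have key (X Y : ℤ) (i : ℤ) (hN : X.natAbs + Y.natAbs ≤ N + 1) (hne : X ≠ 0 ∨ Y ≠ 0)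
        (hY : 0 ≤ Y) : 1 / x ≤ gform (xi S i) (eta S i) X Y := by
      rcases hY.eq_or_lt with rfl | hY
      · have hX : X ≠ 0 := by tauto
        have h1 : (1 : ℝ) ≤ (X : ℝ) ^ 2 := by
          have : 1 ≤ X ^ 2 := by
            have := sq_pos_of_ne_zero hX
            omega
          exact_mod_cast this
        have h2 := one_lt_xi hS i
        have h3 := eta_pos hS i
        have h4 := hone i
        simp only [gform, Int.cast_zero, mul_zero, sub_zero, add_zero]
        rw [← sq, abs_of_nonneg (by positivity)]
        exact h4.trans (div_le_div_of_nonneg_right h1 (by linarith))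
      · have hY1 : (1 : ℝ) ≤ Y := by exact_mod_cast hY
        have ha := hS i
        by_cases hX : 0 ≤ X
        · by_cases hXY : X ≤ S i * Y
          · exact hconc i X Y (by exact_mod_cast hX) (by exact_mod_cast hXY) hY1
          · rw [gform_succ hS i]
            have h1 : Y ≤ S i * Y := by nlinarith
            have := ih Y (X - S i * Y) (i + 1) (by omega) (by omega)
            push_cast at this
            exact this
        · have ha' := hS (i - 1)
          have h1 : -X ≤ S (i - 1) * (-X) := by nlinarith
          have e := gform_succ hS (i - 1) (-(S (i - 1) * X + Y)) (-X)
          rw [sub_add_cancel] at e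
          have e2 : gform (xi S i) (eta S i) X Y
              = gform (xi S (i - 1)) (eta S (i - 1)) (-(S (i - 1) * X + Y)) (-X) := by
            rw [e, ← gform_neg]
            congr 1
            ring
          rw [e2]
          by_cases hXY : Y ≤ S (i - 1) * (-X)
          · refine hconc _ _ _ ?_ ?_ ?_
            · have : (0 : ℝ) ≤ ((S (i - 1) * (-X) - Y : ℤ) : ℝ) := by exact_mod_cast sub_nonneg.2 hXY
              push_cast at this
              linarith
            · nlinarith
            · have : (1 : ℤ) ≤ -X := by omega
              exact_mod_cast this
          · have h2 : 0 < Y - S (i - 1) * (-X) := by omega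
            have := ih (-(S (i - 1) * X + Y)) (-X) (i - 1)
              (by rw [mul_neg] at *; omega) (by right; omega)
            push_cast at this
            exact this
    intro X Y i hN hne
    by_cases hY : 0 ≤ Y
    · exact key X Y i hN hne hY
    · rw [← gform_neg]
      have := key (-X) (-Y) i (by simpa using hN) (by simpa using hne) (by omega)
      push_cast at this
      exact this

/-- The maximum of `λ` along a sequence is in the Markov spectrum. -/
theorem mem_markovSpectrum {S : ℤ → ℕ} (hS : ∀ i, 1 ≤ S i) (h : ∀ i, lam S i ≤ lam S 0) :
    lam S 0 ∈ markovSpectrum := by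
  have h1 := one_lt_xi hS 0
  have h2 := eta_pos hS 0
  have e := lam_eq_xi_add_eta S 0
  have hx : 0 < lam S 0 := by linarith
  -- The form is (X - ξ Y)(X + η Y): the root of its discriminant is ξ + η, and its minimum 1 is
  -- taken at (1, 0).
  have hd : (-(xi S 0 - eta S 0)) ^ 2 - 4 * 1 * (-(xi S 0 * eta S 0)) = lam S 0 ^ 2 := by
    rw [e]; ring
  have hval (X Y : ℝ) : |1 * X ^ 2 + -(xi S 0 - eta S 0) * X * Y + -(xi S 0 * eta S 0) * Y ^ 2|
      = gform (xi S 0) (eta S 0) X Y * lam S 0 := by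
    rw [gform, e, div_mul_cancel₀ _ (by linarith)]
    congr 1
    ring
  have hinf : formInf 1 (-(xi S 0 - eta S 0)) (-(xi S 0 * eta S 0)) = 1 := by
    have lower (v : {v : ℤ × ℤ // v ≠ 0}) : 1 ≤ |1 * (v.1.1 : ℝ) ^ 2 + -(xi S 0 - eta S 0) *
        (v.1.1 : ℝ) * (v.1.2 : ℝ) + -(xi S 0 * eta S 0) * (v.1.2 : ℝ) ^ 2| := by
      obtain ⟨⟨X, Y⟩, hv⟩ := v
      rw [hval]
      have := le_gform_of_lam_le hS hx h _ X Y 0 le_rfl (by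
        by_contra hc
        push Not at hc
        exact hv (by simp [hc.1, hc.2]))
      rwa [div_le_iff₀ hx] at this
    refine le_antisymm ?_ ?_
    · refine (ciInf_le ⟨1, ?_⟩ ⟨((1 : ℤ), (0 : ℤ)), by simp⟩).trans (by simp)
      rintro _ ⟨v, rfl⟩
      exact lower v
    · have : Nonempty {v : ℤ × ℤ // v ≠ 0} := ⟨⟨((1 : ℤ), (0 : ℤ)), by simp⟩⟩
      exact le_ciInf lower
  refine ⟨1, -(xi S 0 - eta S 0), -(xi S 0 * eta S 0), ?_, ?_, ?_⟩
  · rw [hd]; positivity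
  · rw [hinf]; norm_num
  · rw [hd, hinf, Real.sqrt_sq hx.le, div_one]

/-! ### Expansion of irrational numbers -/

/-- The complete quotients of a real number. -/
noncomputable def quot (c : ℝ) : ℕ → ℝ
  | 0 => c
  | n + 1 => 1 / Int.fract (quot c n)

theorem quot_spec {c : ℝ} (hc : Irrational c) (hc1 : 1 < c) (n : ℕ) :
    Irrational (quot c n) ∧ 1 < quot c n := by
  induction n with
  | zero => exact ⟨hc, hc1⟩
  | succ n ih =>
    have h1 : Irrational (Int.fract (quot c n)) := by
      rw [Int.fract]
      exact ih.1.sub_intCast _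
    have h2 : 0 < Int.fract (quot c n) := lt_of_le_of_ne (Int.fract_nonneg _) (h1.ne_zero).symm
    refine ⟨?_, ?_⟩
    · rw [quot, one_div]; exact h1.inv
    · rw [quot, lt_div_iff₀ h2, one_mul]; exact Int.fract_lt_one _

theorem one_le_floor_quot {c : ℝ} (hc : Irrational c) (hc1 : 1 < c) (n : ℕ) :
    1 ≤ ⌊quot c n⌋₊ :=
  (Nat.one_le_floor_iff _).2 (quot_spec hc hc1 n).2.le

theorem quot_eq {c : ℝ} (hc : Irrational c) (hc1 : 1 < c) (n : ℕ) :
    quot c n = ⌊quot c n⌋₊ + 1 / quot c (n + 1) := by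
  have := (quot_spec hc hc1 n).2
  rw [quot, one_div_one_div, natCast_floor_eq_intCast_floor (by linarith), Int.floor_add_fract]

theorem cfInf_floor_quot {c : ℝ} (hc : Irrational c) (hc1 : 1 < c) (n : ℕ) :
    cfInf (fun k => ⌊quot c (n + k)⌋₊) = 1 / quot c n :=
  cfInf_of_complete_quotients _ (fun k => quot c (n + k)) (fun _ => one_le_floor_quot hc hc1 _)
    (fun _ => (quot_spec hc hc1 _).2) (fun _ => quot_eq hc hc1 _)

theorem exists_cfInf_eq {z : ℝ} (hz : Irrational z) (h0 : 0 < z) (h1 : z < 1) :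
    ∃ u : ℕ → ℕ, (∀ n, 1 ≤ u n) ∧ cfInf u = z := by
  have hc : Irrational (1 / z) := by rw [one_div]; exact hz.inv
  have hc1 : 1 < 1 / z := by rw [lt_div_iff₀ h0]; linarith
  refine ⟨fun k => ⌊quot (1 / z) (0 + k)⌋₊, fun n => one_le_floor_quot hc hc1 _, ?_⟩
  rw [cfInf_floor_quot hc hc1, quot, one_div_one_div]

/-! ### From the Markov spectrum to sequences -/

/-- Near-minimal primitive vectors of a form give a form in reduced shape. -/
theorem exists_reduced {x : ℝ} (hx : x ∈ markovSpectrum) {y : ℝ} (hy : 2 < y) (hyx : y < x) :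
    ∃ ξ η : ℝ, 1 < ξ ∧ 0 < η ∧ η < 1 ∧ y < ξ + η ∧
      ∀ X Y : ℤ, (X ≠ 0 ∨ Y ≠ 0) → 1 / x ≤ gform ξ η X Y := by
  obtain ⟨a, b, c, hD, hμ, rfl⟩ := hx
  set D := b ^ 2 - 4 * a * c with hDdef
  set μ := formInf a b c with hμdef
  have hs : 0 < √D := Real.sqrt_pos.2 hD
  have hle (X Y : ℤ) (h : X ≠ 0 ∨ Y ≠ 0) :
      μ ≤ |a * (X : ℝ) ^ 2 + b * (X : ℝ) * (Y : ℝ) + c * (Y : ℝ) ^ 2| := by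
    have hv : ((X, Y) : ℤ × ℤ) ≠ 0 := by
      intro h0
      rw [Prod.mk_eq_zero] at h0
      tauto
    exact ciInf_le (f := fun v : {v : ℤ × ℤ // v ≠ 0} =>
      |a * (v.1.1 : ℝ) ^ 2 + b * (v.1.1 : ℝ) * (v.1.2 : ℝ) + c * (v.1.2 : ℝ) ^ 2|)
      ⟨0, by rintro _ ⟨v, rfl⟩; exact abs_nonneg _⟩ ⟨(X, Y), hv⟩
  have hne : Nonempty {v : ℤ × ℤ // v ≠ 0} := ⟨⟨((1 : ℤ), (0 : ℤ)), by simp⟩⟩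
  have hlt : μ < √D / y := by
    rw [lt_div_iff₀ (by linarith)]
    rw [lt_div_iff₀ hμ] at hyx
    linarith
  obtain ⟨⟨⟨p, q⟩, hv⟩, hpq⟩ := exists_lt_of_ciInf_lt hlt
  simp only at hpq
  have hpq0 : p ≠ 0 ∨ q ≠ 0 := by
    by_contra hc
    push Not at hc
    exact hv (by simp [hc.1, hc.2])
  have hg : 0 < Int.gcd p q := Int.gcd_pos_iff.2 hpq0
  obtain ⟨p', q', hcop, hp, hq⟩ : ∃ p' q' : ℤ, IsCoprime p' q' ∧ p = p' * Int.gcd p q ∧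
      q = q' * Int.gcd p q := by
    obtain ⟨p', q', h1, h2, h3⟩ := Int.exists_gcd_one hg
    exact ⟨p', q', Int.isCoprime_iff_gcd_eq_one.2 h1, h2, h3⟩
  -- The Bézout coefficients complete (p', q') by (-t, s) to a basis of the lattice; in this basis
  -- the form has the coefficients A, B, C, and A is its near-minimal value.
  obtain ⟨s, t, hst⟩ := hcop
  have hst' : (s : ℝ) * p' + t * q' = 1 := by exact_mod_cast hst
  have hp'q' : p' ≠ 0 ∨ q' ≠ 0 := by
    by_contra hc
    push Not at hc
    simp [hc.1, hc.2] at hst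
  set A : ℝ := a * (p' : ℝ) ^ 2 + b * (p' : ℝ) * (q' : ℝ) + c * (q' : ℝ) ^ 2 with hA
  set B : ℝ := -2 * a * p' * t + b * (p' * s - t * q') + 2 * c * q' * s with hB
  set C : ℝ := a * (t : ℝ) ^ 2 - b * t * s + c * (s : ℝ) ^ 2 with hC
  have hAμ : μ ≤ |A| := hle p' q' hp'q'
  have hA0 : A ≠ 0 := by
    intro h
    rw [h, abs_zero] at hAμ
    linarith
  have hAp : 0 < |A| := abs_pos.2 hA0
  have hAlt : |A| < √D / y := by
    refine lt_of_le_of_lt ?_ hpq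
    have hp2 : (p : ℝ) = p' * (Int.gcd p q : ℝ) := by exact_mod_cast hp
    have hq2 : (q : ℝ) = q' * (Int.gcd p q : ℝ) := by exact_mod_cast hq
    rw [hp2, hq2]
    have e : a * ((p' : ℝ) * (Int.gcd p q : ℝ)) ^ 2 + b * (p' * (Int.gcd p q : ℝ)) *
        (q' * (Int.gcd p q : ℝ)) + c * (q' * (Int.gcd p q : ℝ)) ^ 2
        = A * (Int.gcd p q : ℝ) ^ 2 := by rw [hA]; ring
    rw [e, abs_mul, abs_of_nonneg (show (0 : ℝ) ≤ (Int.gcd p q : ℝ) ^ 2 by positivity)]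
    have : (1 : ℝ) ≤ (Int.gcd p q : ℝ) := by exact_mod_cast hg
    exact le_mul_of_one_le_right hAp.le (one_le_pow₀ this)
  have hBD : B ^ 2 - 4 * A * C = D := by
    have : B ^ 2 - 4 * A * C = D * (s * p' + t * q') ^ 2 := by
      rw [hA, hB, hC, hDdef]; ring
    rw [this, hst', one_pow, mul_one]
  have hle' (X Y : ℤ) (h : X ≠ 0 ∨ Y ≠ 0) :
      μ ≤ |A * (X : ℝ) ^ 2 + B * (X : ℝ) * (Y : ℝ) + C * (Y : ℝ) ^ 2| := by
    have h1 : p' * X - t * Y ≠ 0 ∨ q' * X + s * Y ≠ 0 := by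
      by_contra hc
      push Not at hc
      have e1 : X = s * (p' * X - t * Y) + t * (q' * X + s * Y) := by
        linear_combination (-X) * hst
      have e2 : Y = p' * (q' * X + s * Y) - q' * (p' * X - t * Y) := by
        linear_combination (-Y) * hst
      rw [hc.1, hc.2] at e1 e2
      simp at e1 e2
      tauto
    have h2 := hle _ _ h1
    push_cast at h2
    convert h2 using 2
    rw [hA, hB, hC]
    ring
  clear_value A B C
  set ρ₁ : ℝ := (-B / A + √D / |A|) / 2 with hρ₁
  set ρ₂ : ℝ := (-B / A - √D / |A|) / 2 with hρ₂
  have hfac (X Y : ℝ) : A * X ^ 2 + B * X * Y + C * Y ^ 2 = A * ((X - ρ₁ * Y) * (X - ρ₂ * Y)) := by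
    have h1 : ρ₁ * ρ₂ = C / A := by
      have : ρ₁ * ρ₂ = (B ^ 2 / A ^ 2 - √D ^ 2 / |A| ^ 2) / 4 := by
        rw [hρ₁, hρ₂]; ring
      rw [this, sq_abs, Real.sq_sqrt hD.le, ← hBD]
      field_simp
      ring
    have h2 : ρ₁ + ρ₂ = -B / A := by rw [hρ₁, hρ₂]; ring
    have h3 : (X - ρ₁ * Y) * (X - ρ₂ * Y) = X ^ 2 - (ρ₁ + ρ₂) * X * Y + ρ₁ * ρ₂ * Y ^ 2 := by ring
    rw [h3, h1, h2]
    field_simp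
    ring
  -- Translation by k moves the root ρ₂ into [-1, 0); the endpoint -1 is excluded since the form has
  -- no integer zero. Then η < 1, and ξ + η > y > 2 yields ξ > 1.
  set k : ℤ := ⌊ρ₂⌋ + 1 with hk
  have hk1 : ρ₂ < k := by rw [hk]; push_cast; exact Int.lt_floor_add_one _
  have hk2 : (k : ℝ) - 1 ≤ ρ₂ := by rw [hk]; push_cast; linarith [Int.floor_le ρ₂]
  have hk3 : (k : ℝ) - 1 ≠ ρ₂ := by
    intro h
    have h1 := hle' (k - 1) 1 (by right; norm_num)
    rw [hfac] at h1
    push_cast at h1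
    rw [h] at h1
    simp at h1
    linarith
  have hsum : (ρ₁ - k) + (k - ρ₂) = √D / |A| := by rw [hρ₁, hρ₂]; ring
  have hy' : y < √D / |A| := by
    rw [lt_div_iff₀ hAp]
    rw [lt_div_iff₀ (by linarith)] at hAlt
    linarith
  have hη1 : (k : ℝ) - ρ₂ < 1 := by
    have : (k : ℝ) - 1 < ρ₂ := lt_of_le_of_ne hk2 hk3
    linarith
  refine ⟨ρ₁ - k, k - ρ₂, by linarith, by linarith, hη1, by rw [hsum]; exact hy', ?_⟩
  intro X Y h
  have h1 := hle' (X + k * Y) Y (by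
    by_contra hc
    push Not at hc
    obtain ⟨h1, h2⟩ := hc
    rw [h2, mul_zero, add_zero] at h1
    exact h.elim (fun h => h h1) fun h => h h2)
  rw [hfac, abs_mul] at h1
  simp only [gform]
  rw [hsum, one_div_div, div_le_div_iff₀ hs (by positivity)]
  push_cast at h1
  have e : (X + k * Y - ρ₁ * Y) * (X + k * Y - ρ₂ * Y)
      = ((X : ℝ) - (ρ₁ - k) * Y) * (X + (k - ρ₂) * Y) := by ring
  rw [e] at h1
  have e2 : μ * (√D / |A|) = (μ / |A|) * √D := by ring
  rw [e2]
  refine mul_le_mul_of_nonneg_right ?_ hs.le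
  rwa [div_le_iff₀ hAp, mul_comm]

/-- A reduced form is the form attached to a bi-infinite sequence. -/
theorem exists_seq_of_reduced {x ξ η : ℝ} (hx : 0 < x) (hξ : 1 < ξ) (hη : 0 < η) (hη1 : η < 1)
    (h : ∀ X Y : ℤ, (X ≠ 0 ∨ Y ≠ 0) → 1 / x ≤ gform ξ η X Y) :
    ∃ S : ℤ → ℕ, (∀ i, 1 ≤ S i) ∧ (∀ i, lam S i ≤ x) ∧ lam S 0 = ξ + η := by
  have hx' : 0 < 1 / x := by positivity
  -- A rational root would make the form vanish at a nonzero integer vector.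
  have irr1 : Irrational ξ := by
    rintro ⟨r, hr⟩
    have h1 := h r.num r.den (Or.inr (by simp))
    have : (r.num : ℝ) - ξ * r.den = 0 := by
      rw [← hr, sub_eq_zero]
      exact_mod_cast (Rat.mul_den_eq_num r).symm
    simp only [gform, Int.cast_natCast, this, zero_mul, abs_zero, zero_div] at h1
    linarith
  have irr2 : Irrational η := by
    rintro ⟨r, hr⟩
    have h1 := h (-r.num) r.den (Or.inr (by simp))
    have : (-(r.num : ℝ)) + η * r.den = 0 := by
      rw [← hr, neg_add_eq_zero]
      exact_mod_cast (Rat.mul_den_eq_num r).symm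
    simp only [gform, Int.cast_natCast, Int.cast_neg, this, mul_zero, abs_zero, zero_div] at h1
    linarith
  obtain ⟨w, hw, hw'⟩ := exists_cfInf_eq (z := 1 / ξ) (by rw [one_div]; exact irr1.inv)
    (by positivity) (by rw [div_lt_one (by linarith)]; exact hξ)
  obtain ⟨u, hu, hu'⟩ := exists_cfInf_eq irr2 hη hη1
  let S : ℤ → ℕ := fun i => match i with
    | Int.ofNat n => w n
    | Int.negSucc n => u n
  have hS (i : ℤ) : 1 ≤ S i := by
    cases i with
    | ofNat n => exact hw n
    | negSucc n => exact hu n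
  have hxi : xi S 0 = ξ := by
    rw [cfInf_succ w hw, one_div, one_div, inv_inj] at hw'
    rw [← hw', xi]
    congr 2
    funext n
    rw [show (0 : ℤ) + 1 + n = Int.ofNat (n + 1) by simp [add_comm]]
  have heta : eta S 0 = η := by
    rw [← hu', eta]
    congr 1
    funext n
    rw [show (0 : ℤ) - 1 - n = Int.negSucc n by rw [Int.negSucc_eq]; ring]
  -- The lower bound passes to all positions in both directions by unimodular substitutions; at (1,
  -- 0) it says that `lam` is at most x.
  have H (i : ℤ) : ∀ X Y : ℤ, (X ≠ 0 ∨ Y ≠ 0) → 1 / x ≤ gform (xi S i) (eta S i) X Y := by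
    induction i using Int.induction_on with
    | zero => rw [hxi, heta]; exact h
    | succ i ih =>
      intro X Y hXY
      have := ih (Y + S i * X) X (by
        by_contra hc
        push Not at hc
        obtain ⟨h1, h2⟩ := hc
        rw [h2, mul_zero, add_zero] at h1
        exact hXY.elim (fun h => h h2) fun h => h h1)
      rw [gform_succ hS] at this
      push_cast at this
      rwa [add_sub_cancel_right] at this
    | pred i ih =>
      intro X Y hXY
      have := ih Y (X - S (-i - 1) * Y) (by
        by_contra hc
        push Not at hc
        obtain ⟨h1, h2⟩ := hc
        rw [h1, mul_zero, sub_zero] at h2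
        exact hXY.elim (fun h => h h2) fun h => h h1)
      rw [gform_succ hS, sub_add_cancel]
      push_cast at this
      exact this
  refine ⟨S, hS, fun i => ?_, by rw [lam_eq_xi_add_eta, hxi, heta]⟩
  have h1 := H i 1 0 (Or.inl one_ne_zero)
  push_cast at h1
  have h2 := one_lt_xi hS i
  have h3 := eta_pos hS i
  rw [gform_one_zero, one_div_le_one_div hx (by linarith)] at h1
  rwa [lam_eq_xi_add_eta]

/-! ### Continuity of `lam` and compactness -/

theorem continuousOn_cfInf : ContinuousOn cfInf {u | ∀ i, 1 ≤ u i} := by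
  intro u hu
  rw [ContinuousWithinAt, Metric.tendsto_nhds]
  intro ε hε
  obtain ⟨N, hN⟩ := exists_pow_lt_of_lt_one hε (show (1 / 4 : ℝ) < 1 by norm_num)
  have h1 : ∀ᶠ v : ℕ → ℕ in 𝓝 u, ∀ i ∈ Finset.range (2 * N), u i = v i := by
    rw [Finset.eventually_all]
    intro i _
    have : IsOpen {v : ℕ → ℕ | u i = v i} :=
      (isOpen_discrete {a | u i = a}).preimage (continuous_apply i)
    exact this.mem_nhds rfl
  filter_upwards [nhdsWithin_le_nhds h1, self_mem_nhdsWithin] with v hv hv1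
  rw [dist_comm, Real.dist_eq]
  exact (abs_cfInf_sub_le u v hu hv1 N fun i hi => hv i (Finset.mem_range.2 hi)).trans_lt hN

theorem continuousOn_lam (i : ℤ) : ContinuousOn (fun S => lam S i) {S | ∀ i, 1 ≤ S i} := by
  have h1 : ContinuousOn (fun S : ℤ → ℕ => cfInf (fun n => S (i + 1 + n))) {S | ∀ i, 1 ≤ S i} :=
    continuousOn_cfInf.comp (Continuous.continuousOn (by fun_prop)) fun S hS n => hS _
  have h2 : ContinuousOn (fun S : ℤ → ℕ => cfInf (fun n => S (i - 1 - n))) {S | ∀ i, 1 ≤ S i} :=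
    continuousOn_cfInf.comp (Continuous.continuousOn (by fun_prop)) fun S hS n => hS _
  have h3 : Continuous fun S : ℤ → ℕ => (S i : ℝ) :=
    continuous_of_discreteTopology.comp (continuous_apply i)
  simp only [lam_eq]
  exact (h3.continuousOn.add h1).add h2

/-- Points of the Markov spectrum are maxima of `λ` along bi-infinite sequences. -/
theorem exists_seq_of_mem_markovSpectrum {x : ℝ} (hx : x ∈ markovSpectrum) (hx2 : 2 < x) :
    ∃ S : ℤ → ℕ, (∀ i, 1 ≤ S i) ∧ (∀ i, lam S i ≤ x) ∧ lam S 0 = x := by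
  -- The infimum of the form need not be attained. Near-minimal vectors give sequences with `lam` at
  -- 0 as close to x as desired, all in one compact set on which every `lam` is at most x; a
  -- maximiser of `lam` at 0 then attains x.
  let P : Set (ℤ → ℕ) := Set.univ.pi fun _ => Set.Icc 1 ⌊x⌋₊
  have hP : IsCompact P := isCompact_univ_pi fun _ => (Set.finite_Icc _ _).isCompact
  have hP1 : P ⊆ {S | ∀ i, 1 ≤ S i} := fun S hS i => (hS i trivial).1
  let K : Set (ℤ → ℕ) := ⋂ i, P ∩ (fun S => lam S i) ⁻¹' Set.Iic x
  have hKc : IsClosed K := isClosed_iInter fun i =>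
    ((continuousOn_lam i).mono hP1).preimage_isClosed_of_isClosed hP.isClosed isClosed_Iic
  have hK : IsCompact K := hP.of_isClosed_subset hKc fun S hS => (Set.mem_iInter.1 hS 0).1
  have hex (y : ℝ) (hy : 2 < y) (hyx : y < x) : ∃ S ∈ K, y < lam S 0 := by
    obtain ⟨ξ, η, h1, h2, h3, h4, h5⟩ := exists_reduced hx hy hyx
    obtain ⟨S, hS, hSx, hS0⟩ := exists_seq_of_reduced (by linarith) h1 h2 h3 h5
    refine ⟨S, Set.mem_iInter.2 fun i => ⟨fun k _ => ⟨hS k, Nat.le_floor ?_⟩, hSx i⟩,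
      by rw [hS0]; exact h4⟩
    have a1 := lt_xi hS k
    have a2 := eta_pos hS k
    have a3 := hSx k
    rw [lam_eq_xi_add_eta] at a3
    linarith
  obtain ⟨y, hy, hyx⟩ := exists_between hx2
  obtain ⟨S0, hS0, -⟩ := hex y hy hyx
  have hc0 : ContinuousOn (fun S => lam S 0) K :=
    (continuousOn_lam 0).mono fun S hS => hP1 (Set.mem_iInter.1 hS 0).1
  obtain ⟨S, hS, hmax⟩ := hK.exists_isMaxOn ⟨S0, hS0⟩ hc0
  have hSi (i : ℤ) := Set.mem_iInter.1 hS i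
  refine ⟨S, hP1 (hSi 0).1, fun i => (hSi i).2, le_antisymm (hSi 0).2 ?_⟩
  by_contra hlt
  push Not at hlt
  obtain ⟨z, hz, hzx⟩ := exists_between (max_lt hlt hx2)
  obtain ⟨T, hT, hzT⟩ := hex z ((le_max_right _ _).trans_lt hz) hzx
  have h1 : lam T 0 ≤ lam S 0 := hmax hT
  have := (le_max_left (lam S 0) 2).trans_lt hz
  linarith

/-! ### From the Lagrange spectrum to sequences -/

/-- The word `⌊quot c (n - 1)⌋, …, ⌊quot c 0⌋`. -/
noncomputable def pastWord (c : ℝ) : ℕ → List ℕ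
  | 0 => []
  | n + 1 => ⌊quot c n⌋₊ :: pastWord c n

/-- The finite continued fraction of the past of a complete quotient. -/
noncomputable def past (c : ℝ) (n : ℕ) : ℝ := cfT (pastWord c n) 0

theorem length_pastWord (c : ℝ) (n : ℕ) : (pastWord c n).length = n := by
  induction n with
  | zero => rfl
  | succ n ih => simp [pastWord, ih]

theorem past_nonneg (c : ℝ) (n : ℕ) : 0 ≤ past c n := cfT_nonneg _ le_rfl

theorem past_succ (c : ℝ) (n : ℕ) : past c (n + 1) = 1 / (⌊quot c n⌋₊ + past c n) := rfl

/-- The form attached to the `n`-th complete quotient of `c`. -/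
noncomputable def qform (c : ℝ) (n : ℕ) (X Y : ℝ) : ℝ := gform (quot c n) (past c n) X Y

theorem floor_lt_quot {c : ℝ} (hc : Irrational c) (hc1 : 1 < c) (n : ℕ) :
    (⌊quot c n⌋₊ : ℝ) < quot c n := by
  have h1 := quot_eq hc hc1 n
  have h2 := (quot_spec hc hc1 (n + 1)).2
  have h3 : 0 < 1 / quot c (n + 1) := by positivity
  linarith

theorem qform_succ {c : ℝ} (hc : Irrational c) (hc1 : 1 < c) (n : ℕ) (X Y : ℝ) :
    qform c n X Y = qform c (n + 1) Y (X - ⌊quot c n⌋₊ * Y) := by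
  have h1 : (1 : ℝ) ≤ ⌊quot c n⌋₊ := by exact_mod_cast one_le_floor_quot hc hc1 n
  have h2 := past_nonneg c n
  have h3 := (quot_spec hc hc1 (n + 1)).2
  exact gform_step (by linarith) (by linarith) (quot_eq hc hc1 n) (past_succ c n) X Y

theorem quot_add_past_pos {c : ℝ} (hc : Irrational c) (hc1 : 1 < c) (n : ℕ) :
    0 < quot c n + past c n := by
  have := (quot_spec hc hc1 n).2
  have := past_nonneg c n
  linarith

theorem qform_one_zero (c : ℝ) (n : ℕ) : qform c n 1 0 = 1 / (quot c n + past c n) :=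
  gform_one_zero

/-- Vectors of a late form come from large vectors of the first form. -/
theorem exists_pullback {c : ℝ} (hc : Irrational c) (hc1 : 1 < c) (n : ℕ) :
    ∀ X' Y' : ℤ, 1 ≤ X' → 0 ≤ Y' → Y' ≤ X' → ∃ X Y : ℤ, 1 ≤ X ∧ Y ≤ X ∧ n + X' + Y' ≤ X + Y ∧
      qform c 0 X Y = qform c n X' Y' := by
  induction n with
  | zero => intro X' Y' h1 h2 h3; exact ⟨X', Y', h1, h3, by simp, rfl⟩
  | succ n ih =>
    intro X' Y' h1 h2 _
    have ha : (1 : ℤ) ≤ ⌊quot c n⌋₊ := by exact_mod_cast one_le_floor_quot hc hc1 n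
    have h3 : X' ≤ ⌊quot c n⌋₊ * X' := by nlinarith
    obtain ⟨X, Y, e1, e2, e3, e4⟩ := ih (⌊quot c n⌋₊ * X' + Y') X' (by omega) (by omega) (by omega)
    refine ⟨X, Y, e1, e2, by push_cast; omega, ?_⟩
    rw [e4, qform_succ hc hc1]
    push_cast
    congr 1
    ring

/-- By concavity the value is at least the smaller of the two endpoint values, which are the values
at (1, 0) of the forms n and n + 2; m is the one with the larger sum. -/
theorem qform_concave {c : ℝ} (hc : Irrational c) (hc1 : 1 < c) (n : ℕ) {X Y : ℝ}
    (hX : 0 ≤ X) (hXY : X ≤ ⌊quot c (n + 1)⌋₊ * Y) (hY : 1 ≤ Y) :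
    ∃ m ≥ n, 1 / (quot c m + past c m) ≤ qform c (n + 1) X Y := by
  have hs := quot_add_past_pos hc hc1
  have h1 := (quot_spec hc hc1 (n + 1)).2
  have h2 := past_nonneg c (n + 1)
  have h3 := floor_lt_quot hc hc1 (n + 1)
  have a0 : |(0 - quot c (n + 1) * 1) * (0 + past c (n + 1) * 1)|
      = quot c (n + 1) * past c (n + 1) := by
    rw [abs_mul, abs_of_nonpos (by linarith), abs_of_nonneg (by linarith)]
    ring
  have a1 : |(⌊quot c (n + 1)⌋₊ - quot c (n + 1) * 1) * (⌊quot c (n + 1)⌋₊ + past c (n + 1) * 1)|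
      = (quot c (n + 1) - ⌊quot c (n + 1)⌋₊) * (⌊quot c (n + 1)⌋₊ + past c (n + 1)) := by
    rw [abs_mul, abs_of_nonpos (by linarith), abs_of_nonneg (by positivity)]
    ring
  have e0 : qform c (n + 1) 0 1 = 1 / (quot c n + past c n) := by
    have := qform_succ hc hc1 n 1 0
    rw [mul_zero, sub_zero, qform_one_zero] at this
    exact this.symm
  have e1 : qform c (n + 1) ⌊quot c (n + 1)⌋₊ 1
      = 1 / (quot c (n + 2) + past c (n + 2)) := by
    rw [qform_succ hc hc1, mul_one, sub_self, qform_one_zero]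
  simp only [qform, gform] at e0 e1
  rw [a0, div_eq_iff (hs _).ne'] at e0
  rw [a1, div_eq_iff (hs _).ne'] at e1
  have main (m : ℕ) (hm0 : quot c n + past c n ≤ quot c m + past c m)
      (hm1 : quot c (n + 2) + past c (n + 2) ≤ quot c m + past c m) :
      1 / (quot c m + past c m) ≤ qform c (n + 1) X Y := by
    have b0 := mul_le_mul_of_nonneg_right (one_div_le_one_div_of_le (hs n) hm0) (hs (n + 1)).le
    have b1 := mul_le_mul_of_nonneg_right (one_div_le_one_div_of_le (hs (n + 2)) hm1)
      (hs (n + 1)).le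
    have := concave_bound h3 h2 (b0.trans_eq e0.symm) (b1.trans_eq e1.symm) hX hXY (by linarith)
    simp only [qform, gform]
    rw [le_div_iff₀ (hs (n + 1))]
    have hm := hs m
    have hm' := hs (n + 1)
    exact (le_mul_of_one_le_right (by positivity) (one_le_pow₀ hY)).trans this
  rcases le_total (quot c n + past c n) (quot c (n + 2) + past c (n + 2)) with h | h
  · exact ⟨n + 2, by omega, main _ h le_rfl⟩
  · exact ⟨n, le_rfl, main _ le_rfl h⟩

/-- Euclidean steps to the right lower |X| + |Y| until the vector is in the range of concavity or on
the axis. Thus a small value of |q (q α - p)| is explained by a large sum at a late index. -/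
theorem exists_le_qform {c : ℝ} (hc : Irrational c) (hc1 : 1 < c) (N : ℕ) :
    ∀ (X Y : ℤ) (n : ℕ), X.natAbs + Y.natAbs ≤ N → 1 ≤ X → 0 ≤ Y →
    ∃ m ≥ n, 1 / (quot c m + past c m) ≤ qform c (n + 1) X Y := by
  induction N with
  | zero => intro X Y n h0 h1; omega
  | succ N ih =>
    intro X Y n hN hX hY
    rcases hY.eq_or_lt with rfl | hY
    · have h1 : (1 : ℝ) ≤ (X : ℝ) ^ 2 := one_le_pow₀ (by exact_mod_cast hX)
      have hs := quot_add_past_pos hc hc1 (n + 1)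
      refine ⟨n + 1, by omega, ?_⟩
      simp only [qform, gform, Int.cast_zero, mul_zero, sub_zero, add_zero]
      rw [← sq, abs_of_nonneg (by positivity)]
      exact div_le_div_of_nonneg_right h1 hs.le
    · by_cases hXY : X ≤ ⌊quot c (n + 1)⌋₊ * Y
      · exact qform_concave hc hc1 n (by exact_mod_cast (by omega : 0 ≤ X))
          (by exact_mod_cast hXY) (by exact_mod_cast hY)
      · have ha : (1 : ℤ) ≤ ⌊quot c (n + 1)⌋₊ := by
          exact_mod_cast one_le_floor_quot hc hc1 (n + 1)
        have h1 : Y ≤ ⌊quot c (n + 1)⌋₊ * Y := by nlinarith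
        obtain ⟨m, hm, hm'⟩ := ih Y (X - ⌊quot c (n + 1)⌋₊ * Y) (n + 1) (by omega) (by omega)
          (by omega)
        refine ⟨m, by omega, ?_⟩
        rw [qform_succ hc hc1]
        push_cast at hm'
        exact hm'

/-- Large vectors of the first form with a small value are large vectors of a late form. -/
theorem exists_pushforward {c : ℝ} (hc : Irrational c) (hc1 : 1 < c) (n : ℕ) :
    ∀ K : ℝ, ∃ Q : ℤ, ∀ X Y : ℤ, Q ≤ X → qform c 0 X Y < 1 / 3 →
      ∃ X' Y' : ℤ, 1 ≤ X' ∧ 0 ≤ Y' ∧ K ≤ X' + Y' ∧ qform c 0 X Y = qform c n X' Y' := by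
  induction n with
  | zero =>
    intro K
    refine ⟨max 1 ⌈K⌉, fun X Y hX hlt => ⟨X, Y, (le_max_left _ _).trans hX, ?_, ?_, rfl⟩⟩
    all_goals
      have hX1 : 1 ≤ X := (le_max_left _ _).trans hX
      -- For Y < 0 both X - c Y ≥ c and X ≥ 1, so the normalized value is at least 1.
      have hY : 0 ≤ Y := by
        by_contra hY
        have h1 : (1 : ℝ) ≤ X := by exact_mod_cast hX1
        have h2 : (1 : ℝ) ≤ -Y := by
          have : 1 ≤ -Y := by omega
          exact_mod_cast this
        simp only [qform, gform, past, pastWord, cfT, quot, zero_mul, add_zero] at hlt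
        have h3 : c ≤ X - c * Y := by nlinarith
        have h4 : c * 1 ≤ (X - c * Y) * X := mul_le_mul h3 h1 zero_le_one (by linarith)
        rw [div_lt_iff₀ (by linarith), abs_of_nonneg (by linarith)] at hlt
        linarith
    · exact hY
    · have h1 : (K : ℝ) ≤ ⌈K⌉ := Int.le_ceil K
      have h2 : ((⌈K⌉ : ℤ) : ℝ) ≤ X := by exact_mod_cast (le_max_right _ _).trans hX
      have h3 : (0 : ℝ) ≤ Y := by exact_mod_cast hY
      linarith
  | succ n ih =>
    intro K
    have hs := quot_add_past_pos hc hc1 n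
    have hfl := floor_lt_quot hc hc1 n
    have hp := past_nonneg c n
    set a := ⌊quot c n⌋₊ with ha
    have ha1 : (1 : ℝ) ≤ a := by exact_mod_cast one_le_floor_quot hc hc1 n
    set s := quot c n + past c n with hsdef
    set d := quot c n - a with hd
    have hd0 : 0 < d := by rw [hd]; linarith
    -- The three bounds ensure, in turn: the next vector still has size K, as X' + Y' ≤ (a + 1)(Y' +
    -- (X' - a Y')); the case Y' = 0 has a large value; and so has the case X' < a Y', where one
    -- factor is at least s and the other at least 1.
    obtain ⟨Q, hQ⟩ := ih (max ((a + 1) * max K 0) (max (s + 1) ((a + 1) * (s / d))))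
    refine ⟨Q, fun X Y hX hlt => ?_⟩
    obtain ⟨X', Y', h1, h2, h3, h4⟩ := hQ X Y hX hlt
    have hX' : (1 : ℝ) ≤ X' := by exact_mod_cast h1
    have hY' : (0 : ℝ) ≤ Y' := by exact_mod_cast h2
    rw [h4] at hlt
    have hlt' := hlt
    simp only [qform, gform] at hlt'
    rw [div_lt_iff₀ hs] at hlt'
    rcases h2.eq_or_lt with h0 | hY
    · exfalso
      subst h0
      have : s + 1 ≤ X' := by
        have := (le_max_left _ _).trans ((le_max_right _ _).trans h3)
        simpa using this
      simp only [Int.cast_zero, mul_zero, sub_zero, add_zero] at hlt'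
      rw [abs_of_nonneg (by positivity)] at hlt'
      nlinarith
    · have hY1 : (1 : ℝ) ≤ Y' := by exact_mod_cast hY
      by_cases hXY : (X' : ℤ) < a * Y'
      · exfalso
        have hXY' : (X' : ℝ) < a * Y' := by exact_mod_cast hXY
        have h5 : (a + 1) * (s / d) ≤ X' + Y' :=
          (le_max_right _ _).trans ((le_max_right _ _).trans h3)
        have h6 : (a + 1) * (s / d) ≤ (a + 1) * Y' := by nlinarith
        have h7 : s / d ≤ Y' := le_of_mul_le_mul_left h6 (by linarith)
        rw [div_le_iff₀ hd0] at h7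
        have h8 : d * Y' ≤ quot c n * Y' - X' := by rw [hd]; nlinarith
        rw [abs_mul, abs_of_nonpos (by nlinarith), abs_of_nonneg (by positivity)] at hlt'
        have h9 : (1 : ℝ) ≤ X' + past c n * Y' := by nlinarith
        have h10 : s ≤ -(X' - quot c n * Y') := by linarith
        have h11 : s * 1 ≤ -(X' - quot c n * Y') * (X' + past c n * Y') :=
          mul_le_mul h10 h9 (by norm_num) (by linarith)
        linarith
      · push Not at hXY
        refine ⟨Y', X' - a * Y', by omega, by omega, ?_, ?_⟩
        · have h5 : (a + 1) * max K 0 ≤ X' + Y' := (le_max_left _ _).trans h3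
          have h6 : (a * Y' : ℝ) ≤ X' := by exact_mod_cast hXY
          have h7 : (X' : ℝ) + Y' ≤ (a + 1) * (Y' + (X' - a * Y')) := by nlinarith
          have h8 := le_of_mul_le_mul_left (h5.trans h7) (by linarith)
          push_cast
          exact (le_max_left _ _).trans h8
        · rw [h4, qform_succ hc hc1]
          push_cast
          rfl

/-- The finite past is a truncation of the left half of `S`, so the letters of `S` at negative
positions do not matter in the limit. -/
theorem abs_past_sub_eta_le {c : ℝ} {S : ℤ → ℕ}
    (hS : ∀ i, 1 ≤ S i) (h : ∀ n : ℕ, S n = ⌊quot c n⌋₊) (N n : ℕ) (hn : 2 * N ≤ n) :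
    |past c n - eta S n| ≤ (1 / 4 : ℝ) ^ N := by
  have hocc (n : ℕ) : OccL S (n - 1) (pastWord c n) := by
    induction n with
    | zero => trivial
    | succ n ih =>
      refine ⟨by simpa using h n, ?_⟩
      simpa using ih
  have h1 := cfInf_occL_eq hS (hocc n)
  rw [eta, h1, past]
  exact abs_cfT_sub_le N _ ((hocc n).pos hS) (by rwa [length_pastWord]) _ _ le_rfl zero_le_one
    (cfInf_nonneg _ fun _ => hS _) (cfInf_lt_one _ fun _ => hS _).le

/-- Points of the Lagrange spectrum are upper limits of `λ` along sequences. -/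
theorem exists_seq_of_mem_lagrangeSpectrum {x : ℝ} (hx : x ∈ lagrangeSpectrum) (hx3 : 3 < x) :
    ∃ S : ℤ → ℕ, (∀ i, 1 ≤ S i) ∧ (∀ ε > 0, ∃ N : ℕ, ∀ n ≥ N, lam S n < x + ε) ∧
      ∀ ε > 0, ∀ N : ℕ, ∃ n ≥ N, x - ε < lam S n := by
  obtain ⟨α, hα, hlim⟩ := hx
  have hfr : Irrational (Int.fract α) := by
    rw [Int.fract]
    exact hα.sub_intCast _
  have hf0 : 0 < Int.fract α := lt_of_le_of_ne (Int.fract_nonneg _) hfr.ne_zero.symm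
  obtain ⟨c, hcdef⟩ : ∃ c, c = 1 / Int.fract α := ⟨_, rfl⟩
  have hc : Irrational c := by rw [hcdef, one_div]; exact hfr.inv
  have hc1 : 1 < c := by
    rw [hcdef, lt_div_iff₀ hf0, one_mul]
    exact Int.fract_lt_one _
  have hval (p q : ℤ) : |(q : ℝ) * (q * α - p)| = qform c 0 q (p - ⌊α⌋ * q : ℤ) := by
    have e : α = ⌊α⌋ + 1 / c := by rw [hcdef, one_div_one_div]; exact (Int.floor_add_fract α).symm
    have hc0 : 0 < c := by linarith
    simp only [qform, gform, past, pastWord, cfT, quot, zero_mul, add_zero]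
    rw [← abs_of_pos hc0, ← abs_div, abs_of_pos hc0]
    congr 1
    conv_lhs => rw [e]
    push_cast
    field_simp
    ring
  -- The letter 1 on the left is an arbitrary filler.
  let S : ℤ → ℕ := fun i => match i with
    | Int.ofNat n => ⌊quot c n⌋₊
    | Int.negSucc _ => 1
  have hS (i : ℤ) : 1 ≤ S i := by
    cases i with
    | ofNat n => exact one_le_floor_quot hc hc1 n
    | negSucc n => exact le_rfl
  have hSn (n : ℕ) : S n = ⌊quot c n⌋₊ := rfl
  have hxi (n : ℕ) : xi S n = quot c n := by
    rw [quot_eq hc hc1, ← cfInf_floor_quot hc hc1, xi, hSn]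
    congr 2
  have hclose (ε : ℝ) (hε : 0 < ε) : ∃ N : ℕ, ∀ n ≥ N,
      |lam S n - (quot c n + past c n)| < ε := by
    obtain ⟨N, hN⟩ := exists_pow_lt_of_lt_one hε (show (1 / 4 : ℝ) < 1 by norm_num)
    refine ⟨2 * N, fun n hn => ?_⟩
    rw [lam_eq_xi_add_eta, hxi, add_sub_add_left_eq_sub, abs_sub_comm]
    exact (abs_past_sub_eta_le hS hSn N n hn).trans_lt hN
  have hfilter {P : ℤ × ℤ → Prop} (h : ∀ᶠ v in comap (fun v : ℤ × ℤ => |v.2|) atTop, P v) :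
      ∃ Q : ℤ, ∀ p q : ℤ, Q ≤ q → P (p, q) := by
    rw [Filter.eventually_comap] at h
    obtain ⟨Q, hQ⟩ := eventually_atTop.1 h
    refine ⟨max Q 0, fun p q hq => hQ |q| ?_ _ rfl⟩
    exact (le_max_left _ _).trans (hq.trans (le_abs_self q))
  refine ⟨S, hS, ?_, ?_⟩
  · intro ε hε
    have h1 : limsup (fun v : ℤ × ℤ => ((1 / |(v.2 : ℝ) * ((v.2 : ℝ) * α - (v.1 : ℝ))| : ℝ) : EReal))
      (comap (fun v : ℤ × ℤ => |v.2|) atTop) < ((x + ε / 2 : ℝ) : EReal) := by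
      rw [hlim]
      exact EReal.coe_lt_coe_iff.2 (by linarith)
    obtain ⟨Q, hQ⟩ := hfilter (eventually_lt_of_limsup_lt h1)
    obtain ⟨N, hN⟩ := hclose (ε / 2) (by linarith)
    refine ⟨max N (2 * Q.toNat), fun n hn => ?_⟩
    obtain ⟨X, Y, e1, e2, e3, e4⟩ := exists_pullback hc hc1 n 1 0 le_rfl le_rfl zero_le_one
    have hn1 : N ≤ n := (le_max_left _ _).trans hn
    have hn2 : 2 * Q.toNat ≤ n := (le_max_right _ _).trans hn
    have h2 := hQ (Y + ⌊α⌋ * X) X (by omega)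
    simp only at h2
    rw [hval, add_sub_cancel_right, e4, EReal.coe_lt_coe_iff, Int.cast_one, Int.cast_zero,
      qform_one_zero, one_div_one_div] at h2
    have := (abs_lt.1 (hN n hn1)).2
    linarith
  · intro ε hε N
    obtain ⟨N', hN'⟩ := hclose (ε / 2) (by linarith)
    obtain ⟨Q, hQ⟩ := exists_pushforward hc hc1 (max N N' + 1) 0
    -- The bound 3 supplies the hypothesis that the value is below 1/3 in `exists_pushforward`.
    have h1 : ((max 3 (x - ε / 2) : ℝ) : EReal) < limsup (fun v : ℤ × ℤ =>
        ((1 / |(v.2 : ℝ) * ((v.2 : ℝ) * α - (v.1 : ℝ))| : ℝ) : EReal))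
      (comap (fun v : ℤ × ℤ => |v.2|) atTop) := by
      rw [hlim]
      exact EReal.coe_lt_coe_iff.2 (max_lt hx3 (by linarith))
    have h2 := frequently_lt_of_lt_limsup (by isBoundedDefault) h1
    have h3 : ∀ᶠ v : ℤ × ℤ in comap (fun v : ℤ × ℤ => |v.2|) atTop, Q ≤ |v.2| :=
      (tendsto_comap (f := fun v : ℤ × ℤ => |v.2|) (x := atTop)).eventually
        (eventually_ge_atTop Q)
    obtain ⟨⟨p, q⟩, h4, h5⟩ := (h2.and_eventually h3).exists
    simp only at h4 h5
    rw [EReal.coe_lt_coe_iff, hval] at h4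
    have key (X Y : ℤ) (hX : Q ≤ X) (h : max 3 (x - ε / 2) < 1 / qform c 0 X Y) :
        ∃ n ≥ N, x - ε < lam S n := by
      have hpos : 0 < qform c 0 X Y := by
        by_contra hneg
        push Not at hneg
        have h6 : 1 / qform c 0 X Y ≤ 0 := one_div_nonpos.2 hneg
        have := (le_max_left 3 (x - ε / 2)).trans_lt h
        linarith
      have h6 : qform c 0 X Y < 1 / 3 := by
        rw [lt_one_div hpos (by norm_num)]
        exact (le_max_left _ _).trans_lt h
      obtain ⟨X', Y', e1, e2, -, e3⟩ := hQ X Y hX h6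
      obtain ⟨m, hm, hm'⟩ := exists_le_qform hc hc1 _ X' Y' (max N N') le_rfl e1 e2
      rw [← e3, one_div_le (quot_add_past_pos hc hc1 m) hpos] at hm'
      refine ⟨m, (le_max_left _ _).trans hm, ?_⟩
      have h7 := (abs_lt.1 (hN' m ((le_max_right _ _).trans hm))).1
      have h8 := (le_max_right 3 (x - ε / 2)).trans_lt h
      linarith
    rcases le_total 0 q with hq | hq
    · exact key q _ (by rwa [abs_of_nonneg hq] at h5) h4
    · refine key (-q) (-(p - ⌊α⌋ * q)) (by rwa [abs_of_nonpos hq] at h5) ?_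
      rw [qform, Int.cast_neg, Int.cast_neg, gform_neg]
      exact h4

/-! ### Numerical bounds for the constants -/

/-- A rational upper bound of `jMax`. -/
def jUp : ℕ × ℕ := (369117830155827169851, 100000000000000000000)

/-- A rational lower bound of `jZero`. -/
def jLow : ℕ × ℕ := (369117830149942873393, 100000000000000000000)

/-- The letters of `S` in the positions `i`, …, `i + n - 1`. -/
def window (S : ℤ → ℕ) (i : ℤ) : ℕ → List ℕ
  | 0 => []
  | n + 1 => S i :: window S (i + 1) n

/-- The letters of `S` in the positions `i`, …, `i - n + 1`. -/
def windowL (S : ℤ → ℕ) (i : ℤ) : ℕ → List ℕ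
  | 0 => []
  | n + 1 => S i :: windowL S (i - 1) n

theorem occ_window (S : ℤ → ℕ) (i : ℤ) (n : ℕ) : Occ S i (window S i n) := by
  induction n generalizing i with
  | zero => trivial
  | succ n ih => exact ⟨rfl, ih _⟩

theorem occL_windowL (S : ℤ → ℕ) (i : ℤ) (n : ℕ) : OccL S i (windowL S i n) := by
  induction n generalizing i with
  | zero => trivial
  | succ n ih => exact ⟨rfl, ih _⟩

/-- The bounds of `λ₀` obtained from the letters at distance at most `n`. -/
def winB (b : Bool) (S : ℤ → ℕ) (n : ℕ) : ℕ × ℕ :=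
  lamB b (windowL S (-1) n) (S 0) (window S 1 n)

theorem lamB_snd_pos {S : ℤ → ℕ} (hS : ∀ i, 1 ≤ S i) {i j : ℤ} {l r : List ℕ} (b : Bool) (c : ℕ)
    (hl : OccL S i l) (hr : Occ S j r) : 0 < (lamB b l c r).2 :=
  Nat.mul_pos (cfB_snd_pos _ _ (hl.pos hS)) (cfB_snd_pos _ _ (hr.pos hS))

theorem winB_snd_pos {S : ℤ → ℕ} (hS : ∀ i, 1 ≤ S i) (b : Bool) (n : ℕ) : 0 < (winB b S n).2 :=
  lamB_snd_pos hS b _ (occL_windowL S _ n) (occ_window S _ n)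

theorem winB_bound {S : ℤ → ℕ} (hS : ∀ i, 1 ≤ S i) (n : ℕ) :
    ratio (winB false S n) ≤ lambda0 S ∧ lambda0 S ≤ ratio (winB true S n) := by
  rw [← lam_zero]
  exact lam_bound hS (l := windowL S (-1) n) (by simpa using occL_windowL S (-1) n)
    ⟨rfl, occ_window S _ n⟩

/-- Strict comparison of two fractions by cross multiplication. -/
def fracLt (s t : ℕ × ℕ) : Bool := Nat.blt (s.1 * t.2) (t.1 * s.2)

theorem fracLt_iff {s t : ℕ × ℕ} (hs : 0 < s.2) (ht : 0 < t.2) :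
    fracLt s t = true ↔ ratio s < ratio t := by
  have h1 : (0 : ℝ) < s.2 := by exact_mod_cast hs
  have h2 : (0 : ℝ) < t.2 := by exact_mod_cast ht
  simp only [fracLt, ratio, Nat.blt_eq]
  rw [div_lt_div_iff₀ h1 h2]
  exact_mod_cast Iff.rfl

theorem lambda0_lt_of_winB {S T : ℤ → ℕ} (hS : ∀ i, 1 ≤ S i) (hT : ∀ i, 1 ≤ T i) (n : ℕ)
    (h : fracLt (winB true S n) (winB false T n) = true) : lambda0 S < lambda0 T :=
  ((winB_bound hS n).2.trans_lt
    ((fracLt_iff (winB_snd_pos hS _ n) (winB_snd_pos hT _ n)).1 h)).trans_le (winB_bound hT n).1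

theorem starSeq_forall {p : ℕ → Prop} {l r : ℕ → ℕ} {u v : List ℕ} (hp : p 1 ∧ p 2 ∧ p 3)
    (hl : ∀ n, p (l n)) (hr : ∀ n, p (r n)) (hu : ∀ a ∈ u, p a) (hv : ∀ a ∈ v, p a) (i : ℤ) :
    p (starSeq l u v r i) := by
  obtain ⟨h1, h2, h3⟩ := hp
  cases i with
  | ofNat n =>
    refine prepend_forall (fun a ha => ?_) hr n
    rcases List.mem_append.1 ha with ha | ha
    · simp only [List.mem_cons, List.not_mem_nil, or_false] at ha
      rcases ha with rfl | rfl | rfl | rfl | rfl <;> assumption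
    · exact hv a ha
  | negSucc n =>
    refine prepend_forall (fun a ha => ?_) hl n
    rw [List.mem_reverse] at ha
    rcases List.mem_append.1 ha with ha | ha
    · exact hu a ha
    · simp only [List.mem_cons, List.not_mem_nil, or_false] at ha
      rcases ha with rfl | rfl | rfl | rfl <;> assumption

theorem periodicRight_forall {p : ℕ → Prop} {w : List ℕ} (hw : ∀ a ∈ w, p a) (h : w ≠ [])
    (n : ℕ) : p (periodicRight w n) := by
  have hn : n % w.length < w.length := Nat.mod_lt _ (List.length_pos_iff.2 h)
  simp only [periodicRight, List.getD_eq_getElem?_getD, List.getElem?_eq_getElem hn,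
    Option.getD_some]
  exact hw _ (List.getElem_mem hn)

theorem periodicLeft_forall {p : ℕ → Prop} {w : List ℕ} (hw : ∀ a ∈ w, p a) (h : w ≠ [])
    (n : ℕ) : p (periodicLeft w n) :=
  periodicRight_forall (fun a ha => hw a (List.mem_reverse.1 ha)) (by simpa using h) n

/-- The sequence of `jZero`. -/
def seqZero : ℤ → ℕ := starSeq (periodicLeft omega) [] [] (periodicRight omega)

/-- The sequence of `jMin`. -/
def seqMin : ℤ → ℕ :=
  starSeq (periodicLeft [2, 1]) ([1, 1, 1, 2] ++ omega) [] (periodicRight omega)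

/-- The sequence of `jPrime`. -/
def seqPrime : ℤ → ℕ := starSeq (periodicLeft [2, 1])
    ([1, 2, 3, 3, 2, 1, 2, 1] ++ [1, 2, 3, 3, 3, 2, 1, 2] ++ omega) [] (periodicRight omega)

/-- The sequence of `jMax`. -/
def seqMax : ℤ → ℕ := starSeq (periodicLeft [1, 2]) (omega ++ omega) (omega ++ [1, 1])
    (periodicRight [1, 2])

theorem one_le_seqs : (∀ i, 1 ≤ seqZero i) ∧ (∀ i, 1 ≤ seqMin i) ∧ (∀ i, 1 ≤ seqPrime i) ∧
    ∀ i, 1 ≤ seqMax i := by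
  have hp : 1 ≤ 1 ∧ 1 ≤ 2 ∧ 1 ≤ 3 := by decide
  refine ⟨?_, ?_, ?_, ?_⟩ <;>
  · intro i
    refine starSeq_forall (p := fun a => 1 ≤ a) hp
      (periodicLeft_forall (p := fun a => 1 ≤ a) (by decide) (by decide))
      (periodicRight_forall (p := fun a => 1 ≤ a) (by decide) (by decide)) (by decide)
      (by decide) i

-- Forty letters on either side separate the constants by exact rational bounds.
set_option maxRecDepth 10000 in
theorem constants_lt : jZero < jMin ∧ jMin < jPrime ∧ jPrime < jMax := by
  obtain ⟨h0, h1, h2, h3⟩ := one_le_seqs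
  exact ⟨lambda0_lt_of_winB h0 h1 40 (by decide +kernel),
    lambda0_lt_of_winB h1 h2 40 (by decide +kernel),
    lambda0_lt_of_winB h2 h3 40 (by decide +kernel)⟩

set_option maxRecDepth 10000 in
theorem jMax_le_jUp : jMax ≤ ratio jUp :=
  (winB_bound one_le_seqs.2.2.2 40).2.trans ((fracLe_iff (winB_snd_pos one_le_seqs.2.2.2 _ _)
    (by decide)).1 (by decide +kernel))

set_option maxRecDepth 10000 in
theorem jLow_le_jZero : ratio jLow ≤ jZero :=
  le_trans ((fracLe_iff (by decide) (winB_snd_pos one_le_seqs.1 _ _)).1 (by decide +kernel))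
    (winB_bound one_le_seqs.1 40).1

/-! ### Extremal tails -/

/-- The number `[0; 1, 2, 1, 2, …]`. -/
noncomputable def tau : ℝ := cfInf (periodicRight [1, 2])

theorem one_le_periodic12 (i : ℕ) : 1 ≤ periodicRight [1, 2] i :=
  periodicRight_forall (p := fun a => 1 ≤ a) (by decide) (by decide) i

theorem periodic12_succ_succ (n : ℕ) :
    periodicRight [1, 2] (n + 1 + 1) = periodicRight [1, 2] n := by
  simp only [periodicRight, List.length_cons, List.length_nil]
  congr 1
  omega

theorem cfInf_periodic21 : cfInf (periodicRight [2, 1]) = 1 / (2 + tau) := by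
  rw [cfInf_succ _ (periodicRight_forall (p := fun a => 1 ≤ a) (by decide) (by decide)), tau]
  congr 3
  funext n
  simp only [periodicRight, List.length_cons, List.length_nil]
  rcases Nat.mod_two_eq_zero_or_one n with h | h
  · have : (n + 1) % 2 = 1 := by omega
    simp [h, this]
  · have : (n + 1) % 2 = 0 := by omega
    simp [h, this]

theorem tau_eq : tau = 1 / (1 + 1 / (2 + tau)) := by
  have h := one_le_periodic12
  conv_lhs => rw [tau, cfInf_succ _ h, cfInf_succ _ fun i => h (i + 1)]
  simp only [periodic12_succ_succ]
  rw [show periodicRight [1, 2] 0 = 1 from rfl, show periodicRight [1, 2] (0 + 1) = 2 from rfl,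
    ← tau]
  norm_num

theorem tau_pos : 0 < tau := cfInf_pos _ one_le_periodic12

theorem tau_lt_one : tau < 1 := cfInf_lt_one _ one_le_periodic12

/-- The word `1 3` does not occur, and the letters are at most `3`. -/
theorem cfInf_le_tau_add (N : ℕ) : ∀ u : ℕ → ℕ, (∀ i, 1 ≤ u i ∧ u i ≤ 3) →
    (∀ i, u i = 1 → u (i + 1) ≠ 3) → cfInf u ≤ tau + (1 / 4) ^ N := by
  have hτ := tau_pos
  have hτ1 := tau_lt_one
  -- This settles the sequences with first letter at least 2. After a first letter 1, the value
  -- grows with the second letter and with the tail after it, and the second letter is at most 2.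
  have hhalf : 1 / 2 ≤ tau := by
    rw [tau_eq, div_le_div_iff₀ (by norm_num) (by positivity)]
    have : 1 / (2 + tau) ≤ 1 := by rw [div_le_one (by linarith)]; linarith
    linarith
  induction N with
  | zero =>
    intro u hu _
    have := cfInf_lt_one u fun i => (hu i).1
    rw [pow_zero]
    linarith
  | succ N ih =>
    intro u hu h13
    have h1 := cfInf_nonneg (fun n => u (n + 1)) fun i => (hu _).1
    have h2 := cfInf_nonneg (fun n => u (n + 1 + 1)) fun i => (hu _).1
    by_cases h0 : u 0 = 1
    · have ha : u 1 = 1 ∨ u 1 = 2 := by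
        have := hu 1
        have : u 1 ≠ 3 := h13 0 h0
        omega
      have ha2 : (u 1 : ℝ) ≤ 2 := by
        rcases ha with ha | ha <;> rw [ha] <;> norm_num
      have ha1 : (1 : ℝ) ≤ u 1 := by exact_mod_cast (hu 1).1
      have key := ih (fun n => u (n + 1 + 1)) (fun i => hu _) fun i => h13 _
      rw [cfInf_succ u fun i => (hu _).1, cfInf_succ (fun n => u (n + 1)) fun i => (hu _).1, h0]
      set z := cfInf fun n => u (n + 1 + 1) with hz
      simp only [zero_add, Nat.cast_one]
      have e1 : 1 / (1 + 1 / ((u 1 : ℝ) + z)) ≤ 1 / (1 + 1 / (2 + (tau + (1 / 4) ^ N))) := by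
        have : (0 : ℝ) < (1 / 4) ^ N := by positivity
        apply one_div_le_one_div_of_le (by positivity)
        have := one_div_le_one_div_of_le (show 0 < (u 1 : ℝ) + z by linarith)
          (show (u 1 : ℝ) + z ≤ 2 + (tau + (1 / 4) ^ N) by linarith)
        linarith
      have e2 := abs_cfT_pair_sub_le (a := 1) (b := 2) le_rfl (by norm_num)
        (show 0 ≤ tau + (1 / 4) ^ N by positivity) hτ.le
      rw [← tau_eq, add_sub_cancel_left, abs_of_nonneg (show (0 : ℝ) ≤ (1 / 4) ^ N by positivity)]
        at e2
      have e3 := (abs_le.1 e2).2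
      rw [pow_succ]
      linarith
    · have hu2 : (2 : ℝ) ≤ u 0 := by
        have := hu 0
        exact_mod_cast (by omega : 2 ≤ u 0)
      have : cfInf u ≤ 1 / 2 := by
        rw [cfInf_succ u fun i => (hu _).1]
        exact one_div_le_one_div_of_le (by norm_num) (by linarith)
      have : (0 : ℝ) < (1 / 4) ^ (N + 1) := by positivity
      linarith

theorem cfInf_le_tau {u : ℕ → ℕ} (hu : ∀ i, 1 ≤ u i ∧ u i ≤ 3)
    (h13 : ∀ i, u i = 1 → u (i + 1) ≠ 3) : cfInf u ≤ tau := by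
  have hl : Tendsto (fun N : ℕ => tau + (1 / 4 : ℝ) ^ N) atTop (𝓝 (tau + 0)) :=
    tendsto_const_nhds.add
      (tendsto_pow_atTop_nhds_zero_of_lt_one (by norm_num) (by norm_num))
  rw [add_zero] at hl
  exact ge_of_tendsto' hl fun N => cfInf_le_tau_add N u hu h13

/-- The smallest value has the largest admissible first letter 2, followed by the largest tail
`tau`. -/
theorem le_cfInf {u : ℕ → ℕ} (hu : ∀ i, 1 ≤ u i ∧ u i ≤ 3)
    (h13 : ∀ i, u i = 1 → u (i + 1) ≠ 3) (h0 : u 0 ≠ 3) : 1 / (2 + tau) ≤ cfInf u := by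
  have h1 := cfInf_le_tau (u := fun n => u (n + 1)) (fun i => hu _) fun i => h13 _
  have h2 := cfInf_nonneg (fun n => u (n + 1)) fun i => (hu _).1
  have h3 : (u 0 : ℝ) ≤ 2 := by
    have := hu 0
    exact_mod_cast (by omega : u 0 ≤ 2)
  have h4 : (1 : ℝ) ≤ u 0 := by exact_mod_cast (hu 0).1
  rw [cfInf_succ u fun i => (hu _).1]
  exact one_div_le_one_div_of_le (by linarith) (by linarith)

/-! ### Words excluded by an upper bound on `λ` -/

/-- The letters of `S` are `1`, `2`, `3`, and `λ < ratio jUp`, at all positions from `a` to `b`. -/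
def Low (S : ℤ → ℕ) (a b : ℤ) : Prop :=
  ∀ k, a ≤ k → k ≤ b → (S k = 1 ∨ S k = 2 ∨ S k = 3) ∧ lam S k < ratio jUp

theorem Low.rev {S : ℤ → ℕ} {a b : ℤ} (h : Low S a b) : Low (rev S) (-b) (-a) := by
  intro k h1 h2
  rw [lam_rev]
  exact h (-k) (by omega) (by omega)

/-- The words of `F` other than `2112 ω 12`. -/
def baseWords : List (List ℕ) :=
  [[1, 3], [2, 3, 2], [3, 2, 2], [3, 2, 3],
    [1] ++ omega ++ [1, 2],
    [2, 2] ++ omega ++ [1, 2],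
    [3, 2] ++ omega ++ [1, 2],
    omega ++ [1, 2, 1],
    omega ++ [1, 2, 2]]

/-- The words of `baseWords` and their transposes. -/
def sideWords : List (List ℕ) := baseWords ++ baseWords.map List.reverse

/-- The word `2112 ω 12`. -/
def blockWord : List ℕ := [2, 1, 1, 2] ++ omega ++ [1, 2]

theorem forbiddenWords_eq : forbiddenWords = baseWords ++ [blockWord] := rfl

/-- A word with a forbidden block, or with a letter `3` whose `λ` is too large. -/
def closedLow (forb : List (List ℕ)) (l r : List ℕ) : Bool :=
  hasBlock forb (l.reverse ++ r) || hasLarge jUp [] (l.reverse ++ r)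

theorem closedLow_sound {S : ℤ → ℕ} (hS : ∀ i, 1 ≤ S i) {a b i : ℤ} (h : Low S a b)
    {forb : List (List ℕ)} (hf : AvoidOn S forb a b) {l r : List ℕ} (hl : OccL S (i - 1) l)
    (hr : Occ S i r) (ha : a ≤ i - l.length) (hb : i + r.length ≤ b + 1) :
    ¬ closedLow forb l r = true := by
  have ho := occ_zipper hl hr
  have hlen : (((l.reverse ++ r).length : ℕ) : ℤ) = l.length + r.length := by simp
  simp only [closedLow, Bool.or_eq_true, not_or]
  refine ⟨hasBlock_sound hf ho ha (by omega), hasLarge_sound hS (by decide) trivial ho ?_⟩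
  intro k hk hk'
  exact (h k (by omega) (by omega)).2

/-- Each extension of such a word by at most six letters on either side, taken alternately, reaches
a word with a letter 3 at which the lower bound for `lam` is already `jUp`. -/
theorem baseWords_closed :
    (baseWords.all fun f => search (closedLow []) 12 true [] f) = true := by decide +kernel

theorem not_occ_baseWords {S : ℤ → ℕ} (hS : ∀ i, 1 ≤ S i) {a b : ℤ} (h : Low S a b)
    {f : List ℕ} (hf : f ∈ baseWords) {k : ℤ} (hk : a + 12 ≤ k) (hk' : k + f.length + 12 ≤ b + 1) :
    ¬ Occ S k f := by
  intro ho
  obtain ⟨l, r, h1, h2, h3, h4, h5⟩ := search_sound (S := S) _ _ _ _ _ k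
    (List.all_eq_true.1 baseWords_closed f hf)
    (fun j hj hj' => (h j (by simp at hj; omega) (by push_cast at hj'; omega)).1) trivial ho
  simp only [if_true, List.length_nil] at h4 h5
  exact closedLow_sound hS h (forb := []) (fun f hf => by simp at hf) h2 h3 (by omega) (by omega) h1

theorem occ_reverse_iff {S : ℤ → ℕ} {k : ℤ} {f : List ℕ} :
    Occ S k f.reverse ↔ Occ (rev S) (-(k + f.length - 1)) f := by
  rw [occ_rev, occL_iff]
  congr! 1
  ring

/-- The margin of 12 is the depth of the search, which needs known letters that far on both sides.
Transposes are handled by reversing the sequence. -/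
theorem avoidOn_sideWords {S : ℤ → ℕ} (hS : ∀ i, 1 ≤ S i) {a b : ℤ} (h : Low S a b) :
    AvoidOn S sideWords (a + 12) (b - 12) := by
  intro f hf k hk hk'
  rcases List.mem_append.1 hf with hf | hf
  · exact not_occ_baseWords hS h hf hk (by omega)
  · obtain ⟨g, hg, rfl⟩ := List.mem_map.1 hf
    rw [occ_reverse_iff]
    rw [List.length_reverse] at hk'
    exact not_occ_baseWords (fun i => hS (-i)) h.rev hg (by omega) (by omega)

/-! ### Replication -/

/-- The third `3` of the block `ω` in an occurrence of `2112 ω 12` is at the position `p`. -/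
def IsStar (S : ℤ → ℕ) (p : ℤ) : Prop := Occ S (p - 8) blockWord

theorem IsStar.occ {S : ℤ → ℕ} {p : ℤ} (h : IsStar S p) :
    OccL S (p - 1) [3, 3, 2, 1, 2, 1, 1, 2] ∧ Occ S p [3, 2, 1, 1, 2, 1, 2] := by
  have h' : Occ S (p - 8) ([3, 3, 2, 1, 2, 1, 1, 2].reverse ++ [3, 2, 1, 1, 2, 1, 2]) := h
  rw [occ_append] at h'
  refine ⟨?_, ?_⟩
  · rw [occL_iff]
    convert h'.1 using 1
    simp only [List.length_cons, List.length_nil]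
    push_cast
    ring
  · convert h'.2 using 1
    simp

theorem isStar_add_nine {S : ℤ → ℕ} {p : ℤ} (h : Occ S p (3 :: blockWord)) : IsStar S (p + 9) := by
  rw [IsStar, show p + 9 - 8 = p + 1 by ring]
  exact h.2

/-- The word `21 ωᵀ 1233`, read away from the position of the star: `3321 ωᵀ 21`. -/
def leftWord : List ℕ := [3, 3, 2, 1] ++ omegaT ++ [2, 1]

/-- The critical word to the left of the star. -/
def critL : List ℕ := [3, 3, 2, 1] ++ omegaT ++ omegaT

/-- The critical word from the star to the right. -/
def critR : List ℕ := [3, 2, 1, 1, 2] ++ omega ++ [1, 1]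

/-- In each context of a star, up to twenty more letters per side lead to `leftWord` or to a
contradiction. -/
theorem search_left : search (fun l r => isPre leftWord l || closedLow sideWords l r) 40 true
    [3, 3, 2, 1, 2, 1, 1, 2] [3, 2, 1, 1, 2, 1, 2] = true := by decide +kernel

/-- The next block is a star again, except in one pattern that rational bounds cannot exclude:
`critL` to the left and `critR` to the right, where `lam` may come arbitrarily close to J. -/
theorem search_right : search (fun l r => isPre (3 :: blockWord) r ||
    (isPre critL l && isPre critR r) || closedLow sideWords l r) 40 true
    [3, 3, 2, 1, 2, 1, 1, 2] [3, 2, 1, 1, 2, 1, 2] = true := by decide +kernel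

theorem IsStar.left {S : ℤ → ℕ} (hS : ∀ i, 1 ≤ S i) {p : ℤ} (h : Low S (p - 60) (p + 60))
    (hp : IsStar S p) : OccL S (p - 1) leftWord := by
  obtain ⟨l, r, h1, h2, h3, h4, h5⟩ := search_sound (S := S) _ _ _ _ _ p search_left
    (fun j hj hj' => (h j (by simp at hj; omega) (by simp at hj'; omega)).1) hp.occ.1 hp.occ.2
  simp only [if_true, List.length_cons, List.length_nil] at h4 h5
  rw [Bool.or_eq_true] at h1
  rcases h1 with h1 | h1
  · exact h2.prefix (isPre_sound h1)
  -- Twelve of the 60 known places are used up in excluding side words; the closed words reach at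
  -- most 28 places from the star.
  · refine absurd h1 (closedLow_sound hS (a := p - 48) (b := p + 48)
      (fun k hk hk' => h k (by omega) (by omega)) ?_ h2 h3 (by omega) (by omega))
    have := avoidOn_sideWords hS h
    rwa [show p - 60 + 12 = p - 48 by ring, show p + 60 - 12 = p + 48 by ring] at this

/-! ### Tame sequences and the critical pattern -/

/-- The letters are `1`, `2`, `3`, and the words `13` and `31` do not occur. -/
structure Tame (S : ℤ → ℕ) : Prop where
  letters : ∀ i, S i = 1 ∨ S i = 2 ∨ S i = 3
  no13 : ∀ i, S i = 1 → S (i + 1) ≠ 3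
  no31 : ∀ i, S i = 3 → S (i + 1) ≠ 1

theorem Tame.rev {S : ℤ → ℕ} (h : Tame S) : Tame (rev S) := by
  refine ⟨fun i => h.letters _, fun i h1 h3 => ?_, fun i h3 h1 => ?_⟩
  · have := h.no31 (-(i + 1)) h3
    rw [show -(i + 1) + 1 = -i by ring] at this
    exact this h1
  · have := h.no13 (-(i + 1)) h1
    rw [show -(i + 1) + 1 = -i by ring] at this
    exact this h3

theorem Tame.one_le {S : ℤ → ℕ} (h : Tame S) (i : ℤ) : 1 ≤ S i := by
  rcases h.letters i with h | h | h <;> omega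

theorem Tame.le_three {S : ℤ → ℕ} (h : Tame S) (i : ℤ) : S i ≤ 3 := by
  rcases h.letters i with h | h | h <;> omega

theorem Tame.right_le_tau {S : ℤ → ℕ} (h : Tame S) (i : ℤ) :
    cfInf (fun n => S (i + n)) ≤ tau := by
  refine cfInf_le_tau (fun n => ⟨h.one_le _, h.le_three _⟩) fun n h1 => ?_
  have := h.no13 (i + n) h1
  rwa [add_assoc] at this

theorem Tame.left_le_tau {S : ℤ → ℕ} (h : Tame S) (i : ℤ) :
    cfInf (fun n => S (i - n)) ≤ tau := by
  have := h.rev.right_le_tau (-i)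
  simp only [MarkovLagrange.rev] at this
  convert this using 3
  congr 1
  ring

theorem Tame.le_left {S : ℤ → ℕ} (h : Tame S) (i : ℤ) (hi : S i ≠ 3) :
    1 / (2 + tau) ≤ cfInf (fun n => S (i - n)) := by
  refine le_cfInf (fun n => ⟨h.one_le _, h.le_three _⟩) (fun n h1 => ?_) (by simpa using hi)
  have := h.rev.no13 (-i + n)
  simp only [MarkovLagrange.rev] at this
  rw [show -(-i + (n : ℤ)) = i - n by ring, show -(-i + (n : ℤ) + 1) = i - (n + 1 : ℕ) by
    push_cast; ring] at this
  exact this h1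

theorem jMax_eq : jMax = 3 + cfT ([2, 1, 1, 2] ++ omega ++ [1, 1]) tau
    + cfT critL (1 / (2 + tau)) := by
  rw [jMax, ← lam_zero, lam_eq]
  have hS := one_le_seqs.2.2.2
  change ((seqMax 0 : ℕ) : ℝ) + cfInf (fun n => seqMax (0 + 1 + n)) +
    cfInf (fun n => seqMax (0 - 1 - n)) = _
  have hr : (fun n : ℕ => seqMax (0 + 1 + n))
      = prepend ([2, 1, 1, 2] ++ omega ++ [1, 1]) (periodicRight [1, 2]) := by
    funext n
    rw [show (0 : ℤ) + 1 + n = Int.ofNat (n + 1) by simp [add_comm]]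
    exact prepend_cons_succ 3 _ _ n
  have hl : (fun n : ℕ => seqMax (0 - 1 - n)) = prepend critL (periodicRight [2, 1]) := by
    funext n
    rw [show (0 : ℤ) - 1 - n = Int.negSucc n by rw [Int.negSucc_eq]; ring]
    rfl
  rw [hr, hl, cfInf_prepend _ _ (by decide) one_le_periodic12, cfInf_prepend _ _ (by decide)
    (periodicRight_forall (p := fun a => 1 ≤ a) (by decide) (by decide)), cfInf_periodic21]
  rfl

/-- J is the exact minimum of `lam` in the critical pattern. The word after the star has odd length
15, so the largest tail `tau` is worst. `critL` has even length 22 and ends with 1, so the next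
letter is not 3 and the smallest tail is 1 / (2 + `tau`). -/
theorem Tame.jMax_le {S : ℤ → ℕ} (h : Tame S) {p : ℤ} (hl : OccL S (p - 1) critL)
    (hr : Occ S p critR) : jMax ≤ lam S p := by
  have hτ := tau_pos
  have hr' : Occ S (p + 1) ([2, 1, 1, 2] ++ omega ++ [1, 1]) := hr.2
  rw [lam_eq, cfInf_occ_eq h.one_le hr', cfInf_occL_eq h.one_le hl, jMax_eq, hr.1]
  have e1 := (cfT_le_iff ([2, 1, 1, 2] ++ omega ++ [1, 1]) (by decide) hτ.le (cfInf_nonneg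
    (fun n : ℕ => S (p + 1 + ([2, 1, 1, 2] ++ omega ++ [1, 1]).length + n))
    fun _ => h.one_le _)).2 (by
      rw [if_neg (by decide)]
      exact h.right_le_tau _)
  have hne : S (p - 1 - critL.length) ≠ 3 := by
    intro h3
    have h1 := h.no31 _ h3
    have h2 : OccL S (p - 1) (([3, 3, 2, 1] ++ omegaT ++ [2, 1, 1, 2, 3, 3, 3, 2]) ++ [1]) := hl
    rw [occL_append] at h2
    apply h1
    have h3 := h2.2.1
    convert h3 using 2
    simp [critL, omegaT, omega]
    ring
  have e2 := (cfT_le_iff critL (by decide) (show 0 ≤ 1 / (2 + tau) by positivity) (cfInf_nonneg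
    (fun n : ℕ => S (p - 1 - critL.length - n)) fun _ => h.one_le _)).2 (by
      rw [if_pos (by decide)]
      exact h.le_left _ hne)
  push_cast
  linarith

/-- This is the only place where the sharp bound J is needed instead of its rational approximation
`jUp`. -/
theorem IsStar.right {S : ℤ → ℕ} (hT : Tame S) {p : ℤ} (h : Low S (p - 60) (p + 60))
    (hJ : lam S p < jMax) (hp : IsStar S p) : IsStar S (p + 9) := by
  obtain ⟨l, r, h1, h2, h3, h4, h5⟩ := search_sound (S := S) _ _ _ _ _ p search_right
    (fun j hj hj' => hT.letters j) hp.occ.1 hp.occ.2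
  simp only [if_true, List.length_cons, List.length_nil] at h4 h5
  rw [Bool.or_eq_true, Bool.or_eq_true, Bool.and_eq_true] at h1
  rcases h1 with (h1 | h1) | h1
  · exact isStar_add_nine (h3.prefix (isPre_sound h1))
  · have := hT.jMax_le (h2.prefix (isPre_sound h1.1)) (h3.prefix (isPre_sound h1.2))
    linarith
  · refine absurd h1 (closedLow_sound hT.one_le (a := p - 48) (b := p + 48)
      (fun k hk hk' => h k (by omega) (by omega)) ?_ h2 h3 (by omega) (by omega))
    have := avoidOn_sideWords hT.one_le h
    rwa [show p - 60 + 12 = p - 48 by ring, show p + 60 - 12 = p + 48 by ring] at this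

/-! ### Positions with a large value of `λ` -/

/-- All words of `F` and their transposes. -/
def allWords : List (List ℕ) := sideWords ++ [blockWord, blockWord.reverse]

/-- A word with a forbidden block, or with a value of `λ` at the marked letter below `jLow`. -/
def closedHigh (l r : List ℕ) : Bool :=
  hasBlock allWords (l.reverse ++ r) || match r with
    | [] => false
    | c :: r => fracLt (lamB true l c r) jLow

theorem search_high :
    search closedHigh 18 true [] [1] = true ∧ search closedHigh 18 true [] [2] = true ∧
      search closedHigh 18 true [] [3] = true := by decide +kernel

theorem lam_lt_of_occ {S : ℤ → ℕ} (hS : ∀ i, 1 ≤ S i) {p : ℤ} {l r : List ℕ} {c : ℕ}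
    (hl : OccL S (p - 1) l) (hr : Occ S p (c :: r)) (h : fracLt (lamB true l c r) jLow = true) :
    lam S p < jZero :=
  ((lam_bound hS hl hr).2.trans_lt
    ((fracLt_iff (lamB_snd_pos hS _ _ hl hr.2) (by decide)).1 h)).trans_le jLow_le_jZero

/-- Exhaustive search over at most nine letters on either side: without the listed words the upper
bound for `lam` stays below `jLow`. -/
theorem lam_lt_of_avoidOn {S : ℤ → ℕ} (hS : ∀ i, S i = 1 ∨ S i = 2 ∨ S i = 3) {p : ℤ}
    (h : AvoidOn S allWords (p - 9) (p + 9)) : lam S p < jZero := by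
  have hS1 (i : ℤ) : 1 ≤ S i := by rcases hS i with h | h | h <;> omega
  have hs : search closedHigh 18 true [] [S p] = true := by
    rcases hS p with h | h | h <;> rw [h]
    exacts [search_high.1, search_high.2.1, search_high.2.2]
  obtain ⟨l, r, h1, h2, h3, h4, h5⟩ := search_sound (S := S) _ _ _ _ _ p hs
    (fun j _ _ => hS j) trivial ⟨rfl, trivial⟩
  simp only [if_true, List.length_cons, List.length_nil] at h4 h5
  rcases (Bool.or_eq_true _ _).mp h1 with h1 | h1
  · refine absurd h1 (hasBlock_sound h (occ_zipper h2 h3) (by omega) ?_)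
    simp only [List.length_append, List.length_reverse]
    push_cast
    omega
  · cases r with
    | nil => simp at h1
    | cons c r => exact lam_lt_of_occ hS1 h2 h3 h1

/-! ### Positions with `λ ≥ j₀` -/

/-- The sequence is as forced to the left and to the right of an occurrence of `2112 ω 12`. -/
def Forced (S : ℤ → ℕ) (p : ℤ) : Prop := IsStar S (p + 9) ∧ OccL S (p - 1) leftWord

/-- The forced letters on both sides of the star bound `lam` at its neighbours; only four offsets
have to be computed. -/
theorem lam_lt_near_star {S : ℤ → ℕ} (hS : ∀ i, 1 ≤ S i) {p q : ℤ} (hq : IsStar S q)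
    (hf : Forced S q) (h1 : p - 1 ≤ q) (h2 : q ≤ p + 3) (hne : q ≠ p) : lam S p < jZero := by
  have h3 : S q = 3 := hq.occ.2.1
  have hr : Occ S (q + 1) blockWord := by
    have := hf.1
    rwa [IsStar, show q + 9 - 8 = q + 1 by ring] at this
  obtain ⟨e1, e2, e3, hl⟩ := hf.2
  have : p = q + 1 ∨ p = q - 1 ∨ p = q - 2 ∨ p = q - 3 := by omega
  rcases this with rfl | rfl | rfl | rfl
  · exact lam_lt_of_occ hS (l := 3 :: leftWord) (c := 2) (r := blockWord.tail)
      (by rw [add_sub_cancel_right]; exact ⟨h3, hf.2⟩) hr (by decide +kernel)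
  · refine lam_lt_of_occ hS (l := leftWord.tail) (c := 3) (r := 3 :: blockWord)
      ⟨e2, e3, hl⟩ ⟨e1, ?_⟩ (by decide +kernel)
    rw [sub_add_cancel]
    exact ⟨h3, hr⟩
  · refine lam_lt_of_occ hS (l := leftWord.tail.tail) (c := 3) (r := 3 :: 3 :: blockWord)
      (by convert (show OccL S _ leftWord.tail.tail from ⟨e3, hl⟩) using 1; ring)
      ⟨by convert e2 using 2; ring, by convert e1 using 2; ring, ?_⟩ (by decide +kernel)
    rw [show q - 2 + 1 + 1 = q by ring]
    exact ⟨h3, hr⟩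
  · refine lam_lt_of_occ hS (l := leftWord.tail.tail.tail) (c := 2) (r := 3 :: 3 :: 3 :: blockWord)
      (by convert (show OccL S _ leftWord.tail.tail.tail from hl) using 1; ring)
      ⟨by convert e3 using 2; ring, by convert e2 using 2; ring, by convert e1 using 2; ring, ?_⟩
      (by decide +kernel)
    rw [show q - 3 + 1 + 1 + 1 = q by ring]
    exact ⟨h3, hr⟩

/-- By `lam_lt_of_avoidOn` some block 2112 ω 12 or its transpose lies within nine places of p. It
has 15 letters, which leaves five places for its star; the four other than p are excluded by
`lam_lt_near_star`. -/
theorem isStar_or_of_le_lam {S : ℤ → ℕ} (hS : ∀ i, S i = 1 ∨ S i = 2 ∨ S i = 3) {p : ℤ}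
    (ha : AvoidOn S sideWords (p - 9) (p + 9))
    (hf : ∀ q, p - 1 ≤ q → q ≤ p + 3 → IsStar S q → Forced S q)
    (hf' : ∀ q, -p - 1 ≤ q → q ≤ -p + 3 → IsStar (rev S) q → Forced (rev S) q)
    (h : jZero ≤ lam S p) : IsStar S p ∨ IsStar (rev S) (-p) := by
  have hS1 (i : ℤ) : 1 ≤ S i := by rcases hS i with h | h | h <;> omega
  by_contra hc
  push Not at hc
  refine absurd (lam_lt_of_avoidOn hS (p := p) ?_) (not_lt.2 h)
  intro f hf1 k hk hk' ho
  rcases List.mem_append.1 hf1 with hf1 | hf1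
  · exact ha f hf1 k hk hk' ho
  · simp only [List.mem_cons, List.not_mem_nil, or_false] at hf1
    rcases hf1 with rfl | rfl
    · have hlen : ((blockWord.length : ℕ) : ℤ) = 15 := rfl
      rw [hlen] at hk'
      have hs : IsStar S (k + 8) := by rwa [IsStar, add_sub_cancel_right]
      have hne : k + 8 ≠ p := by rintro rfl; exact hc.1 hs
      exact absurd (lam_lt_near_star hS1 hs (hf _ (by omega) (by omega) hs) (by omega) (by omega)
        hne) (not_lt.2 h)
    · rw [List.length_reverse] at hk'
      have hlen : ((blockWord.length : ℕ) : ℤ) = 15 := rfl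
      rw [occ_reverse_iff, hlen] at ho
      rw [hlen] at hk'
      have hs : IsStar (rev S) (-(k + 6)) := by
        rw [IsStar]
        convert ho using 1
        ring
      have hne : -(k + 6) ≠ -p := by intro h; rw [h] at hs; exact hc.2 hs
      have := lam_lt_near_star (S := rev S) (p := -p) (fun i => hS1 (-i)) hs
        (hf' _ (by omega) (by omega) hs) (by omega) (by omega) hne
      rw [lam_rev, neg_neg] at this
      exact absurd this (not_lt.2 h)

/-! ### The periodic sequence -/

theorem periodicRight_add_length (w : List ℕ) (n : ℕ) :
    periodicRight w (n + w.length) = periodicRight w n := by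
  simp [periodicRight]

theorem seqZero_natCast (n : ℕ) :
    seqZero n = prepend [3, 2, 1, 1, 2] (periodicRight omega) n := rfl

theorem seqZero_negSucc (n : ℕ) :
    seqZero (Int.negSucc n) = prepend [3, 3, 2, 1] (periodicRight omegaT) n := rfl

theorem seqZero_add_nine (i : ℤ) : seqZero (i + 9) = seqZero i := by
  cases i with
  | ofNat n =>
    rw [show Int.ofNat n + 9 = ((n + 9 : ℕ) : ℤ) by simp, show Int.ofNat n = (n : ℤ) from rfl,
      seqZero_natCast, seqZero_natCast]
    by_cases h : n < 5
    · interval_cases n <;> rfl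
    · obtain ⟨m, rfl⟩ := Nat.exists_eq_add_of_le (not_lt.1 h)
      rw [add_assoc]
      exact (prepend_add_length [3, 2, 1, 1, 2] _ (m + 9)).trans
        ((periodicRight_add_length omega m).trans
          (prepend_add_length [3, 2, 1, 1, 2] (periodicRight omega) m).symm)
  | negSucc n =>
    by_cases h : n < 13
    · interval_cases n <;> rfl
    · obtain ⟨m, rfl⟩ := Nat.exists_eq_add_of_le (not_lt.1 h)
      rw [show Int.negSucc (13 + m) + 9 = Int.negSucc (4 + m) by
        rw [Int.negSucc_eq, Int.negSucc_eq]; push_cast; ring, seqZero_negSucc, seqZero_negSucc]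
      rw [show 13 + m = 4 + (m + 9) by ring]
      exact ((prepend_add_length [3, 3, 2, 1] (periodicRight omegaT) (m + 9)).trans
        ((periodicRight_add_length omegaT m).trans
          (prepend_add_length [3, 3, 2, 1] (periodicRight omegaT) m).symm)).symm

theorem seqZero_add_mul (i k : ℤ) : seqZero (i + 9 * k) = seqZero i := by
  have key (n : ℕ) (i : ℤ) : seqZero (i + 9 * n) = seqZero i := by
    induction n with
    | zero => simp
    | succ n ih =>
      rw [show i + 9 * ((n + 1 : ℕ) : ℤ) = i + 9 * n + 9 by push_cast; ring, seqZero_add_nine, ih]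
  obtain ⟨n, rfl | rfl⟩ := k.eq_nat_or_neg
  · exact key n i
  · have := key n (i + 9 * (-(n : ℤ)))
    rw [← this]
    congr 1
    ring

theorem occ_congr {S T : ℤ → ℕ} {i j : ℤ} {u : List ℕ}
    (h : ∀ n : ℕ, n < u.length → S (i + n) = T (j + n)) : Occ S i u ↔ Occ T j u := by
  rw [occ_iff, occ_iff]
  exact forall₂_congr fun n hn => by rw [h n hn]

theorem occL_congr {S T : ℤ → ℕ} {i j : ℤ} {u : List ℕ}
    (h : ∀ n : ℕ, n < u.length → S (i - n) = T (j - n)) : OccL S i u ↔ OccL T j u := by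
  have e (S : ℤ → ℕ) (i : ℤ) : OccL S i u ↔ Occ (rev S) (-i) u := by rw [occ_rev, neg_neg]
  rw [e, e]
  refine occ_congr fun n hn => ?_
  have := h n hn
  simp only [rev]
  convert this using 2 <;> ring

theorem IsStar.eq_seqZero {S : ℤ → ℕ} {p : ℤ} (h : IsStar S p) {j : ℤ} (h1 : -8 ≤ j)
    (h2 : j ≤ 6) : S (p + j) = seqZero j := by
  obtain ⟨n, hn⟩ := Int.eq_ofNat_of_zero_le (show 0 ≤ j + 8 by omega)
  have hn' : n < blockWord.length := by
    have hlen : blockWord.length = 15 := rfl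
    omega
  have e1 := Occ.apply (S := seqZero) (i := -8) (u := blockWord)
    (by simp only [blockWord, omega]; repeat' constructor) hn'
  have e2 := Occ.apply h hn'
  rw [← e1, show p - 8 + n = p + j by omega, show (-8 : ℤ) + n = j by omega] at e2
  exact e2

/-- Around a star with `K` more stars on either side, `λ` is close to `j₀`. -/
theorem abs_lam_sub_jZero_le {S : ℤ → ℕ} (hS : ∀ i, 1 ≤ S i) {p : ℤ} {K : ℕ}
    (h : ∀ k : ℤ, -K ≤ k → k ≤ K → IsStar S (p + 9 * k)) :
    |lam S p - jZero| ≤ 2 * (1 / 4) ^ K := by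
  have hper (j : ℤ) (h1 : -(9 * K) ≤ j) (h2 : j ≤ 9 * K) : S (p + j) = seqZero j := by
    -- Each place is read off from its nearest star, at distance at most 4.
    have e : j = (j + 4) % 9 - 4 + 9 * ((j + 4) / 9) := by omega
    have := (h ((j + 4) / 9) (by omega) (by omega)).eq_seqZero (j := (j + 4) % 9 - 4) (by omega)
      (by omega)
    rw [e, seqZero_add_mul, ← this]
    congr 1
    ring
  have h0 : S p = seqZero 0 := by simpa using hper 0 (by omega) (by omega)
  rw [jZero, show lambda0 (starSeq (periodicLeft omega) [] [] (periodicRight omega)) = lam seqZero 0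
    from (lam_zero seqZero).symm, lam_eq, lam_eq, h0]
  have hz := one_le_seqs.1
  have e1 := abs_cfInf_sub_le (fun n => S (p + 1 + n)) (fun n => seqZero (0 + 1 + n))
    (fun _ => hS _) (fun _ => hz _) K fun i hi => by
      have := hper (0 + 1 + i) (by omega) (by omega)
      rw [← this]
      congr 1
      ring
  have e2 := abs_cfInf_sub_le (fun n => S (p - 1 - n)) (fun n => seqZero (0 - 1 - n))
    (fun _ => hS _) (fun _ => hz _) K fun i hi => by
      have := hper (0 - 1 - i) (by omega) (by omega)
      rw [← this]
      congr 1
      ring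
  rw [abs_le] at e1 e2 ⊢
  constructor <;> linarith [e1.1, e1.2, e2.1, e2.2]

/-- In a part of the sequence that is periodic, the stars are at the distance of a multiple of
the period, and there is no transposed star. -/
theorem periodic_stars {S : ℤ → ℕ} {p q : ℤ} (h : ∀ j, q - p - 8 ≤ j → j ≤ q - p + 8 →
    S (p + j) = seqZero j) : (IsStar S q → 9 ∣ q - p) ∧ ¬ IsStar (rev S) (-q) := by
  have hlen : blockWord.length = 15 := rfl
  set e := (q - p) % 9 with he
  have h' (j : ℤ) (h1 : -8 ≤ j) (h2 : j ≤ 8) : S (q + j) = seqZero (e + j) := by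
    have := h (q - p + j) (by omega) (by omega)
    rw [show p + (q - p + j) = q + j by ring] at this
    rw [this, ← seqZero_add_mul (e + j) ((q - p) / 9)]
    congr 1
    omega
  have he0 : 0 ≤ e := by omega
  have he9 : e < 9 := by omega
  constructor
  · intro hq
    have h1 : Occ seqZero (e - 8) blockWord := by
      refine (occ_congr (S := S) (i := q - 8) fun n hn => ?_).1 hq
      have := h' (-8 + n) (by omega) (by omega)
      convert this using 2 <;> ring
    by_contra hd
    have he1 : e ≠ 0 := by omega
    clear_value e
    -- Only the residues modulo 9 remain; each nonzero one contradicts a letter of the block.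
    interval_cases e
    · exact he1 rfl
    all_goals
      simp only [blockWord, omega, Occ, List.cons_append, List.nil_append] at h1
      revert h1
      decide +kernel
  · intro hq
    have h1 : OccL seqZero (e + 8) blockWord := by
      refine (occL_congr (S := S) (i := q + 8) fun n hn => ?_).1 ?_
      · have := h' (8 - n) (by omega) (by omega)
        convert this using 2 <;> ring
      · have : Occ (rev S) (-q - 8) blockWord := hq
        rw [occ_rev] at this
        convert this using 1
        ring
    clear_value e
    interval_cases e
    all_goals
      simp only [blockWord, omega, OccL, List.cons_append, List.nil_append] at h1
      revert h1
      decide +kernel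

/-! ### Sequences in which the block replicates -/

/-- All occurrences of `2112 ω 12` are forced to replicate to the right. -/
def Half (S : ℤ → ℕ) : Prop := ∀ p, IsStar S p → Forced S p

/-- The letters are `1`, `2`, `3`, the words of `F` other than `2112 ω 12` and their transposes do
not occur, and the occurrences of `2112 ω 12` and of its transpose replicate. -/
structure Reg (S : ℤ → ℕ) : Prop where
  letters : ∀ i, S i = 1 ∨ S i = 2 ∨ S i = 3
  avoid : ∀ f ∈ sideWords, ∀ k, ¬ Occ S k f
  half : Half S
  halfT : Half (rev S)

theorem sideWords_reverse : ∀ f ∈ sideWords, f.reverse ∈ sideWords := by decide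

theorem Reg.rev {S : ℤ → ℕ} (h : Reg S) : Reg (rev S) := by
  refine ⟨fun i => h.letters _, fun f hf k ho => ?_, h.halfT, by rw [rev_rev]; exact h.half⟩
  rw [← List.reverse_reverse f, occ_reverse_iff, rev_rev] at ho
  exact h.avoid _ (sideWords_reverse f hf) _ ho

theorem Reg.one_le {S : ℤ → ℕ} (h : Reg S) (i : ℤ) : 1 ≤ S i := by
  rcases h.letters i with h | h | h <;> omega

theorem Reg.tame {S : ℤ → ℕ} (h : Reg S) : Tame S :=
  ⟨h.letters, fun i h1 h3 => h.avoid [1, 3] (by decide) i ⟨h1, h3, trivial⟩,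
    fun i h3 h1 => h.avoid [3, 1] (by decide) i ⟨h3, h1, trivial⟩⟩

theorem Reg.isStar_or {S : ℤ → ℕ} (h : Reg S) {p : ℤ} (hp : jZero ≤ lam S p) :
    IsStar S p ∨ IsStar (MarkovLagrange.rev S) (-p) :=
  isStar_or_of_le_lam h.letters (fun f hf k _ _ => h.avoid f hf k) (fun q _ _ => h.half q)
    (fun q _ _ => h.halfT q) hp

theorem Half.isStar_add {S : ℤ → ℕ} (h : Half S) {p : ℤ} (hp : IsStar S p) (n : ℕ) :
    IsStar S (p + 9 * n) := by
  induction n with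
  | zero => simpa using hp
  | succ n ih =>
    have := (h _ ih).1
    convert this using 1
    push_cast
    ring

theorem OccL.eq_of_occL {S T : ℤ → ℕ} {i j : ℤ} {u : List ℕ} (h : OccL S i u) (h' : OccL T j u)
    {n : ℕ} (hn : n < u.length) : S (i - n) = T (j - n) := by
  have e1 := congrFun h.seq_eq n
  have e2 := congrFun h'.seq_eq n
  simp only [prepend_of_lt _ _ hn] at e1 e2
  rw [e1, e2]

theorem occL_seqZero : OccL seqZero (-1) leftWord := by
  simp only [leftWord, omegaT, omega]
  repeat' constructor

/-- To the right of a forced star, and on the preceding block, the sequence is periodic. -/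
theorem Half.eq_seqZero {S : ℤ → ℕ} (h : Half S) {p : ℤ} (hp : IsStar S p) {j : ℤ}
    (hj : -15 ≤ j) : S (p + j) = seqZero j := by
  by_cases h8 : -8 ≤ j
  · have hst := h.isStar_add hp ((j + 4) / 9).toNat
    have h1 : (((j + 4) / 9).toNat : ℤ) = (j + 4) / 9 ∨
        (j + 4) / 9 = -1 ∧ (((j + 4) / 9).toNat : ℤ) = 0 := by omega
    rcases h1 with h1 | ⟨h1, h2⟩
    · have := hst.eq_seqZero (j := j - 9 * ((j + 4) / 9)) (by omega) (by omega)
      rw [h1] at this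
      rw [← seqZero_add_mul j (-((j + 4) / 9))]
      convert this using 2 <;> ring
    · exact hp.eq_seqZero h8 (by omega)
  -- The places from -15 to -9 are not covered by the block of the star, but by the forced word to
  -- its left.
  · have h1 := (h p hp).2
    obtain ⟨n, hn⟩ := Int.eq_ofNat_of_zero_le (show 0 ≤ -1 - j by omega)
    have := OccL.eq_of_occL h1 occL_seqZero (n := n) (by
      have : leftWord.length = 15 := rfl
      omega)
    convert this using 2 <;> omega

/-- The value `[0; 2112 ω ω …]`. -/
noncomputable def rho : ℝ := cfInf (fun n => seqZero (0 + 1 + n))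

theorem lam_of_right {S : ℤ → ℕ} {p : ℤ} (h : ∀ j, 0 ≤ j → S (p + j) = seqZero j) :
    lam S p = 3 + rho + cfInf (fun n => S (p - 1 - n)) := by
  have h0 : S p = 3 := by
    have := h 0 le_rfl
    rw [add_zero] at this
    rw [this]
    rfl
  rw [lam_eq, h0, rho]
  congr 3
  funext n
  rw [← h _ (by omega)]
  congr 1
  ring

/-- The word to the left of a star that is preceded by a star. -/
def innerWord : List ℕ := [3, 3, 2, 1, 2, 1, 1, 2, 3] ++ leftWord

theorem occL_innerWord {S : ℤ → ℕ} {p : ℤ} (hp : IsStar S p) (hp' : IsStar S (p - 9))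
    (hf : Forced S (p - 9)) : OccL S (p - 1) innerWord := by
  have h1 : OccL S (p - 1) ([3, 3, 2, 1, 2, 1, 1, 2] ++ ([3] ++ leftWord)) := by
    rw [occL_append, occL_append]
    refine ⟨hp.occ.1, ⟨?_, trivial⟩, ?_⟩
    · convert hp'.occ.2.1 using 2
      simp only [List.length_cons, List.length_nil]
      push_cast
      ring
    · convert hf.2 using 1
      simp only [List.length_cons, List.length_nil]
      push_cast
      ring
  exact h1

/-- The two possible words to the left of a star that is not preceded by a star. -/
def Outer (S : ℤ → ℕ) (p : ℤ) : Prop :=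
  OccL S (p - 1) (leftWord ++ [2]) ∨ OccL S (p - 1) (leftWord ++ [1, 1])

/-- The forced word begins with the letter 1 at p - 15. Before it, 3 is excluded since 31 does not
occur, and the letters 21 would complete the block of a star at p - 9; so 2 or 11 remains. -/
theorem outer_of_not_isStar {S : ℤ → ℕ} (hT : Tame S) {p : ℤ} (hf : Forced S p)
    (hp : ¬ IsStar S (p - 9)) : Outer S p := by
  have hlen : ((leftWord.length : ℕ) : ℤ) = 15 := rfl
  have h15 : S (p - 15) = 1 := by
    have h := hf.2
    have h1 : OccL S (p - 1) (([3, 3, 2, 1] ++ omegaT ++ [2]) ++ [1]) := h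
    rw [occL_append] at h1
    convert h1.2.1 using 2
    simp [omegaT, omega]
    ring
  have key (x : ℕ) : OccL S (p - 1) (leftWord ++ [x]) ↔ S (p - 16) = x := by
    rw [occL_append, hlen, show p - 1 - 15 = p - 16 by ring]
    exact ⟨fun h => h.2.1, fun h => ⟨hf.2, h, trivial⟩⟩
  have key2 (x y : ℕ) : OccL S (p - 1) (leftWord ++ [x, y]) ↔ S (p - 16) = x ∧ S (p - 17) = y := by
    rw [occL_append, hlen, show p - 1 - 15 = p - 16 by ring]
    simp only [OccL, and_true]
    rw [show p - 16 - 1 = p - 17 by ring]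
    exact ⟨fun h => h.2, fun h => ⟨hf.2, h⟩⟩
  rcases hT.letters (p - 16) with h | h | h
  · rcases hT.letters (p - 17) with h' | h' | h'
    · exact Or.inr ((key2 1 1).2 ⟨h, h'⟩)
    · exfalso
      apply hp
      have h2 := (key2 1 2).2 ⟨h, h'⟩
      rw [occL_iff] at h2
      have h3 : Occ S (p - 9 - 8) (blockWord ++ [3, 3]) := by
        convert h2 using 1
        · simp only [List.length_append, List.length_cons, List.length_nil]
          push_cast
          rw [hlen]
          ring
        · rfl
      exact (occ_append.1 h3).1
    · exfalso
      refine hT.no31 _ h' ?_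
      rw [show p - 17 + 1 = p - 16 by ring]
      exact h
  · exact Or.inl ((key 2).2 h)
  · exfalso
    refine hT.no31 _ h ?_
    rw [show p - 16 + 1 = p - 15 by ring]
    exact h15

theorem cfInf_lt_of_occL {S T : ℤ → ℕ} (hS : ∀ i, 1 ≤ S i) (hT : ∀ i, 1 ≤ T i) {i j : ℤ}
    {l m : List ℕ} (hl : OccL S i l) (hm : OccL T j m)
    (h : fracLt (cfB true l) (cfB false m) = true) :
    cfInf (fun n => S (i - n)) < cfInf (fun n => T (j - n)) := by
  rw [cfInf_occL_eq hS hl, cfInf_occL_eq hT hm]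
  have pl := hl.pos hS
  have pm := hm.pos hT
  have h1 := cfB_bound l pl (cfInf_nonneg (fun n => S (i - l.length - n)) fun _ => hS _)
    (cfInf_lt_one _ fun _ => hS _).le
  have h2 := cfB_bound m pm (cfInf_nonneg (fun n => T (j - m.length - n)) fun _ => hT _)
    (cfInf_lt_one _ fun _ => hT _).le
  rw [fracLt_iff (cfB_snd_pos _ _ pl) (cfB_snd_pos _ _ pm)] at h
  exact (h1.2.trans_lt h).trans_le h2.1

/-- An inner star has a smaller value of `λ` than an outer one. -/
theorem cfInf_inner_lt_outer {S T : ℤ → ℕ} (hS : ∀ i, 1 ≤ S i) (hT : ∀ i, 1 ≤ T i) {p q : ℤ}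
    (hp : OccL S (p - 1) innerWord) (hq : Outer T q) :
    cfInf (fun n => S (p - 1 - n)) < cfInf (fun n => T (q - 1 - n)) := by
  rcases hq with hq | hq
  · exact cfInf_lt_of_occL hS hT hp hq (by decide +kernel)
  · exact cfInf_lt_of_occL hS hT hp hq (by decide +kernel)

theorem cfInf_seqMin : cfInf (fun n => seqMin (0 - 1 - n)) = cfT (leftWord ++ [1, 1]) tau := by
  have h : (fun n : ℕ => seqMin (0 - 1 - n))
      = prepend (leftWord ++ [1, 1]) (periodicRight [1, 2]) := by
    funext n
    rw [show (0 : ℤ) - 1 - n = Int.negSucc n by rw [Int.negSucc_eq]; ring]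
    rfl
  rw [h, cfInf_prepend _ _ (by decide) one_le_periodic12]
  rfl

theorem jMin_eq : jMin = 3 + rho + cfInf (fun n => seqMin (0 - 1 - n)) := by
  rw [← lam_of_right (S := seqMin), lam_zero]
  · rfl
  · intro j hj
    obtain ⟨n, rfl⟩ := Int.eq_ofNat_of_zero_le hj
    rw [zero_add]
    rfl

/-- With the right half fixed, only the left half matters. After `leftWord` the letters 11 give the
smaller values, and since the word then has odd length 17 the minimum has the tail `tau`: this is
the sequence of `jMin`. -/
theorem jMin_le_of_outer {S : ℤ → ℕ} (hT : Tame S) {p : ℤ} (hp : Outer S p)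
    (h : ∀ j, 0 ≤ j → S (p + j) = seqZero j) : jMin ≤ lam S p := by
  rw [lam_of_right h, jMin_eq]
  rcases hp with hp | hp
  · have hm : OccL seqMin (0 - 1) (leftWord ++ [1, 1, 1, 2]) := by
      simp only [leftWord, omegaT, omega]
      repeat' constructor
    have := cfInf_lt_of_occL one_le_seqs.2.1 hT.one_le hm hp (by decide +kernel)
    linarith
  · have e := (cfT_le_iff (leftWord ++ [1, 1]) (by decide) tau_pos.le (cfInf_nonneg
      (fun n : ℕ => S (p - 1 - (leftWord ++ [1, 1]).length - n)) fun _ => hT.one_le _)).2 (by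
        rw [if_neg (by decide)]
        exact hT.left_le_tau _)
    rw [cfInf_seqMin, cfInf_occL_eq hT.one_le hp]
    linarith

-- Both shapes of the left word, with twenty periodic letters on the right, give an upper bound
-- below J. Hence every sharp sequence stays inside the interval.
set_option maxRecDepth 10000 in
theorem lt_jMax_of_outer {S : ℤ → ℕ} (hT : Tame S) {p : ℤ} (hp : Outer S p)
    (h : ∀ j, 0 ≤ j → S (p + j) = seqZero j) : lam S p < jMax := by
  have hr : Occ S p (3 :: window seqZero 1 20) := by
    have h1 : Occ seqZero 0 (3 :: window seqZero 1 20) := ⟨rfl, occ_window _ _ _⟩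
    refine (occ_congr fun n hn => ?_).1 h1
    rw [zero_add, h _ (by omega)]
  have hmax := (winB_bound one_le_seqs.2.2.2 40).1
  have key (l : List ℕ) (hl : OccL S (p - 1) l)
      (hc : fracLt (lamB true l 3 (window seqZero 1 20)) (winB false seqMax 40) = true) :
      lam S p < jMax :=
    ((lam_bound hT.one_le hl hr).2.trans_lt ((fracLt_iff (lamB_snd_pos hT.one_le _ _ hl hr.2)
      (winB_snd_pos one_le_seqs.2.2.2 _ _)).1 hc)).trans_le hmax
  rcases hp with hp | hp
  · exact key _ hp (by decide +kernel)
  · exact key _ hp (by decide +kernel)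

/-! ### Sequences attaining their maximum at an outer star -/

/-- A regular sequence with a star at `0` that is not preceded by a star, and with its maximum
of `λ` at `0`. -/
structure Sharp (S : ℤ → ℕ) : Prop where
  reg : Reg S
  star : IsStar S 0
  first : ¬ IsStar S (-9)
  max : ∀ i, lam S i ≤ lam S 0

theorem Reg.outer {S : ℤ → ℕ} (h : Reg S) {p : ℤ} (hp : IsStar S p) (hp' : ¬ IsStar S (p - 9)) :
    Outer S p :=
  outer_of_not_isStar h.tame (h.half p hp) hp'

theorem Reg.lam_bounds {S : ℤ → ℕ} (h : Reg S) {p : ℤ} (hp : IsStar S p)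
    (hp' : ¬ IsStar S (p - 9)) : jMin ≤ lam S p ∧ lam S p < jMax :=
  ⟨jMin_le_of_outer h.tame (h.outer hp hp') fun _ hj => h.half.eq_seqZero hp (by omega),
    lt_jMax_of_outer h.tame (h.outer hp hp') fun _ hj => h.half.eq_seqZero hp (by omega)⟩

theorem Reg.lam_lt {S : ℤ → ℕ} (h : Reg S) {p q : ℤ} (hp : IsStar S p)
    (hp' : IsStar S (p - 9)) (hq : IsStar S q) (hq' : ¬ IsStar S (q - 9)) :
    lam S p < lam S q := by
  rw [lam_of_right fun _ hj => h.half.eq_seqZero hp (by omega),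
    lam_of_right fun _ hj => h.half.eq_seqZero hq (by omega)]
  have := cfInf_inner_lt_outer h.one_le h.one_le (occL_innerWord hp hp' (h.half _ hp'))
    (h.outer hq hq')
  linarith

theorem Reg.dvd_of_isStar {S : ℤ → ℕ} (h : Reg S) {p q : ℤ} (hp : IsStar S p) (hq : IsStar S q) :
    9 ∣ q - p := by
  rcases le_total p q with hpq | hpq
  · exact (periodic_stars fun j hj _ => h.half.eq_seqZero hp (by omega)).1 hq
  · have := (periodic_stars (p := q) fun j hj _ => h.half.eq_seqZero hq (by omega)).1 hp
    omega

/-- From p - 15 on the sequence is periodic, and the periodic sequence contains no transposed star: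
all transposed stars lie to the left of all stars. -/
theorem Reg.lt_of_isStar_rev {S : ℤ → ℕ} (h : Reg S) {p q : ℤ} (hp : IsStar S p)
    (hq : IsStar (MarkovLagrange.rev S) (-q)) : q < p - 7 := by
  by_contra hlt
  exact (periodic_stars (p := p) fun j hj _ => h.half.eq_seqZero hp (by omega)).2 hq

/-- An earlier star is at a distance divisible by 9 and would replicate up to p - 9. -/
theorem Reg.not_isStar_of_lt {S : ℤ → ℕ} (h : Reg S) {p : ℤ} (hp : IsStar S p)
    (hp' : ¬ IsStar S (p - 9)) {q : ℤ} (hq : q < p) : ¬ IsStar S q := by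
  intro hs
  obtain ⟨k, hk⟩ := h.dvd_of_isStar hs hp
  have := h.half.isStar_add hs (k - 1).toNat
  apply hp'
  convert this using 1
  omega

theorem letters_of_lam_lt {S : ℤ → ℕ} (hS : ∀ i, 1 ≤ S i) {i : ℤ} (h : lam S i < jMax) :
    S i = 1 ∨ S i = 2 ∨ S i = 3 := by
  have h1 : lam S i < ratio jUp := h.trans_le jMax_le_jUp
  have h2 := lt_xi hS i
  have h3 := eta_pos hS i
  have h4 := hS i
  have h5 : ratio jUp < 4 := by
    simp only [ratio, jUp]
    norm_num
  rw [lam_eq_xi_add_eta] at h1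
  have h6 : (S i : ℝ) < 4 := by linarith
  have h7 : S i < 4 := by exact_mod_cast h6
  omega

theorem low_of_lam_lt {S : ℤ → ℕ} (hS : ∀ i, 1 ≤ S i) {N : ℤ} (h : ∀ i, N ≤ i → lam S i < jMax)
    {a b : ℤ} (ha : N ≤ a) : Low S a b := fun k hk _ =>
  ⟨letters_of_lam_lt hS (h k (by omega)), (h k (by omega)).trans_le jMax_le_jUp⟩

/-- The bound on `lam` is invariant under reversal, so the local results apply to the sequence and
to its reversal, at every position. -/
theorem reg_of_low {S : ℤ → ℕ} (hS : ∀ i, 1 ≤ S i) (h : ∀ i, lam S i < jMax) : Reg S := by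
  have hlow (T : ℤ → ℕ) (hT1 : ∀ i, 1 ≤ T i) (hT : ∀ i, lam T i < jMax) (a b : ℤ) : Low T a b :=
    low_of_lam_lt hT1 (fun i _ => hT i) le_rfl
  have hav (T : ℤ → ℕ) (hT1 : ∀ i, 1 ≤ T i) (hT : ∀ i, lam T i < jMax) :
      ∀ f ∈ sideWords, ∀ k, ¬ Occ T k f := fun f hf k =>
    avoidOn_sideWords hT1 (hlow T hT1 hT (k - 12) (k + f.length + 12)) f hf k (by omega) (by omega)
  have hhalf (T : ℤ → ℕ) (hT1 : ∀ i, 1 ≤ T i) (hT : ∀ i, lam T i < jMax) : Half T := by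
    intro p hp
    have hl := hlow T hT1 hT (p - 60) (p + 60)
    have ht : Tame T := ⟨fun i => (hlow T hT1 hT i i i le_rfl le_rfl).1,
      fun i h1 h3 => hav T hT1 hT [1, 3] (by decide) i ⟨h1, h3, trivial⟩,
      fun i h3 h1 => hav T hT1 hT [3, 1] (by decide) i ⟨h3, h1, trivial⟩⟩
    exact ⟨hp.right ht hl (hT p), hp.left hT1 hl⟩
  exact ⟨fun i => (hlow S hS h i i i le_rfl le_rfl).1, hav S hS h, hhalf S hS h,
    hhalf _ (fun i => hS (-i)) fun i => by rw [lam_rev]; exact h (-i)⟩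

theorem three_lt_jZero : (3 : ℝ) < jZero := by
  have := jLow_le_jZero
  have h5 : (3 : ℝ) < ratio jLow := by
    simp only [ratio, jLow]
    norm_num
  linarith

/-- Points of the Markov spectrum between `j₀` and `J` come from sharp sequences. -/
theorem exists_sharp {x : ℝ} (hx : x ∈ markovSpectrum) (h0 : jZero < x) (h1 : x < jMax) :
    ∃ S, Sharp S ∧ lam S 0 = x := by
  have hj := three_lt_jZero
  obtain ⟨S, hS, hSx, hS0⟩ := exists_seq_of_mem_markovSpectrum hx (by linarith)
  have main (T : ℤ → ℕ) (hT : Reg T) (hTx : ∀ i, lam T i ≤ x) (hT0 : lam T 0 = x)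
      (hst : IsStar T 0) : Sharp T := by
    refine ⟨hT, hst, fun h9 => ?_, fun i => by rw [hT0]; exact hTx i⟩
    -- If the run of stars never ends to the left, `lam` at 0 is j₀. Otherwise its first star has a
    -- larger `lam` than the star at 0, against maximality.
    by_cases hall : ∀ k : ℕ, IsStar T (-9 * k)
    · have hle (K : ℕ) : x - jZero ≤ 2 * (1 / 4) ^ K := by
        have := abs_lam_sub_jZero_le hT.one_le (p := 0) (K := K) fun k _ _ => by
          have := hT.half.isStar_add (hall k.natAbs) (k.natAbs + k).toNat
          convert this using 1
          omega
        rw [hT0] at this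
        exact (abs_le.1 this).2
      have hl : Tendsto (fun K : ℕ => 2 * (1 / 4 : ℝ) ^ K) atTop (𝓝 (2 * 0)) :=
        (tendsto_pow_atTop_nhds_zero_of_lt_one (by norm_num) (by norm_num)).const_mul 2
      have := ge_of_tendsto' hl hle
      linarith
    · push Not at hall
      classical
      have hk := Nat.find_spec hall
      have hmin := fun m => Nat.find_min hall (m := m)
      set k := Nat.find hall
      have hk0 : k ≠ 0 := by
        intro h
        rw [h] at hk
        simp only [Nat.cast_zero, mul_zero] at hk
        exact hk hst
      obtain ⟨m, hm⟩ := Nat.exists_eq_succ_of_ne_zero hk0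
      have hms : IsStar T (-9 * m) := by
        have := hmin m (by omega)
        push Not at this
        exact this
      have hms' : ¬ IsStar T (-9 * m - 9) := by
        rw [hm] at hk
        convert hk using 2
        push_cast
        ring
      have := hT.lam_lt hst (by simpa using h9) hms hms'
      have := hTx (-9 * m)
      linarith
  have hreg := reg_of_low hS fun i => (hSx i).trans_lt h1
  rcases hreg.isStar_or (p := 0) (by rw [hS0]; exact h0.le) with h | h
  · exact ⟨S, main S hreg hSx hS0 h, hS0⟩
  · have e0 : lam (rev S) 0 = x := by rw [lam_rev, neg_zero, hS0]
    exact ⟨rev S, main _ hreg.rev (fun i => by rw [lam_rev]; exact hSx _) e0 (by simpa using h), e0⟩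

/-! ### Sequences that are periodic to the right -/

/-- The sequence `l u ω ω* ω ω …`. -/
def tailSeq (l : ℕ → ℕ) (u : List ℕ) : ℤ → ℕ := starSeq l (u ++ omega) [] (periodicRight omega)

theorem seqZero_sub_thirteen (n : ℕ) : seqZero (n - 13) = periodicRight omega n := by
  rw [← seqZero_add_mul _ 2, show (n : ℤ) - 13 + 9 * 2 = ((5 + n : ℕ) : ℤ) by push_cast; ring,
    seqZero_natCast]
  exact prepend_add_length [3, 2, 1, 1, 2] _ n

theorem tailSeq_negSucc (l : ℕ → ℕ) (u : List ℕ) (n : ℕ) : tailSeq l u (Int.negSucc n)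
    = prepend ([3, 3, 2, 1] ++ omegaT) (prepend u.reverse l) n := by
  rw [← prepend_append]
  simp [tailSeq, starSeq, omegaT]

theorem tailSeq_right (l : ℕ → ℕ) (u : List ℕ) {j : ℤ} (hj : -13 ≤ j) :
    tailSeq l u j = seqZero j := by
  cases j with
  | ofNat n => rfl
  | negSucc n =>
    have hn : n < 13 := by omega
    rw [tailSeq_negSucc, seqZero_negSucc, prepend_of_lt _ _ (by exact hn)]
    interval_cases n <;> rfl

theorem tailSeq_left (l : ℕ → ℕ) (u : List ℕ) (n : ℕ) :
    tailSeq l u (-14 - u.length - n) = l n := by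
  have h := tailSeq_negSucc l u (([3, 3, 2, 1] ++ omegaT).length + (u.reverse.length + n))
  rw [prepend_add_length, prepend_add_length] at h
  rw [← h]
  congr 1
  simp [omegaT, omega, Int.negSucc_eq]
  ring

theorem OccL.of_seq {S : ℤ → ℕ} {u : List ℕ} {i : ℤ}
    (h : ∀ n (hn : n < u.length), S (i - n) = u[n]) : OccL S i u := by
  have : Occ (rev S) (-i) u := by
    rw [occ_iff]
    intro n hn
    rw [← h n hn]
    simp only [rev]
    congr 1
    ring
  rwa [occ_rev, neg_neg] at this

theorem OccL.apply {S : ℤ → ℕ} {u : List ℕ} {i : ℤ} (h : OccL S i u) {n : ℕ}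
    (hn : n < u.length) : S (i - n) = u[n] := by
  have : Occ (rev S) (-i) u := by rwa [occ_rev, neg_neg]
  rw [← this.apply hn]
  simp only [rev]
  congr 1
  ring

theorem tailSeq_occL (l : ℕ → ℕ) (u : List ℕ) : OccL (tailSeq l u) (-14) u.reverse := by
  refine OccL.of_seq fun n hn => ?_
  have h := tailSeq_negSucc l u (([3, 3, 2, 1] ++ omegaT).length + n)
  rw [prepend_add_length, prepend_of_lt _ _ hn, List.getD_eq_getElem _ _ hn] at h
  rw [← h]
  congr 1
  simp [omegaT, omega, Int.negSucc_eq]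
  ring

/-- A sequence is `l u ω ω* ω ω …` when it has the corresponding parts. -/
theorem eq_tailSeq {S : ℤ → ℕ} {l : ℕ → ℕ} {u : List ℕ} (hr : ∀ j, -13 ≤ j → S j = seqZero j)
    (hu : OccL S (-14) u.reverse) (hl : ∀ n : ℕ, S (-14 - u.length - n) = l n) :
    S = tailSeq l u := by
  funext j
  by_cases h1 : -13 ≤ j
  · rw [hr j h1, tailSeq_right l u h1]
  · obtain ⟨n, hn⟩ := Int.eq_ofNat_of_zero_le (show 0 ≤ -14 - j by omega)
    obtain rfl : j = -14 - n := by omega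
    by_cases h2 : n < u.reverse.length
    · rw [hu.apply h2, (tailSeq_occL l u).apply h2]
    · rw [List.length_reverse] at h2
      obtain ⟨m, rfl⟩ := Nat.exists_eq_add_of_le (not_lt.1 h2)
      rw [show (-14 : ℤ) - ((u.length + m : ℕ) : ℤ) = -14 - u.length - m by push_cast; ring, hl,
        tailSeq_left]

/-- The sequence `… ωᵀ ωᵀ u ω ω* ω …`. -/
def twoSeq (u : List ℕ) : ℤ → ℕ := tailSeq (periodicRight omega) u

theorem twoSeq_left (u : List ℕ) {j : ℤ} (hj : -13 ≤ j) :
    twoSeq u (-(u.length + 27) - j) = seqZero j := by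
  obtain ⟨n, hn⟩ := Int.eq_ofNat_of_zero_le (show 0 ≤ j + 13 by omega)
  obtain rfl : j = n - 13 := by omega
  rw [seqZero_sub_thirteen, ← tailSeq_left (periodicRight omega) u n, twoSeq]
  congr 1
  ring

theorem eq_twoSeq {S : ℤ → ℕ} {u : List ℕ} (hr : ∀ j, -13 ≤ j → S j = seqZero j)
    (hu : OccL S (-14) u.reverse)
    (hl : ∀ j, -13 ≤ j → S (-(u.length + 27) - j) = seqZero j) : S = twoSeq u := by
  refine eq_tailSeq hr hu fun n => ?_
  rw [← seqZero_sub_thirteen, ← hl _ (by omega)]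
  congr 1
  ring

/-- The reversal of `… ωᵀ ωᵀ u ω ω …`. -/
theorem twoSeq_reverse (u : List ℕ) :
    (fun i => twoSeq u (-(u.length + 27) - i)) = twoSeq u.reverse := by
  refine eq_twoSeq (fun j hj => twoSeq_left u hj) ?_ fun j hj => ?_
  · rw [List.reverse_reverse]
    refine OccL.of_seq fun n hn => ?_
    have h := (tailSeq_occL (periodicRight omega) u).apply (n := u.length - 1 - n)
      (by rw [List.length_reverse]; omega)
    rw [List.getElem_reverse] at h
    simp only [show u.length - 1 - (u.length - 1 - n) = n by omega] at h
    rw [← h, twoSeq]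
    congr 1
    omega
  · rw [List.length_reverse, sub_sub_cancel]
    exact tailSeq_right _ u hj

theorem letters_omega (n : ℕ) : periodicRight omega n = 1 ∨ periodicRight omega n = 2 ∨
    periodicRight omega n = 3 :=
  periodicRight_forall (p := fun a => a = 1 ∨ a = 2 ∨ a = 3) (by decide) (by decide) n

theorem letters_tailSeq {l : ℕ → ℕ} {u : List ℕ} (hl : ∀ n, l n = 1 ∨ l n = 2 ∨ l n = 3)
    (hu : ∀ a ∈ u, a = 1 ∨ a = 2 ∨ a = 3) (j : ℤ) :
    tailSeq l u j = 1 ∨ tailSeq l u j = 2 ∨ tailSeq l u j = 3 := by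
  refine starSeq_forall (p := fun a => a = 1 ∨ a = 2 ∨ a = 3) (by decide) hl
    letters_omega ?_ (by decide) j
  intro a ha
  rcases List.mem_append.1 ha with ha | ha
  · exact hu a ha
  · exact (by decide : ∀ a ∈ omega, a = 1 ∨ a = 2 ∨ a = 3) a ha

/-! ### Sequences without side words -/

theorem not_occ_seqZero_aux : ∀ f ∈ sideWords, ∀ r < 9,
    ¬ ∀ n < f.length, seqZero ((r : ℕ) + (n : ℕ)) = f.getD n 0 := by decide +kernel

theorem not_occ_seqZero {f : List ℕ} (hf : f ∈ sideWords) (k : ℤ) : ¬ Occ seqZero k f := by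
  intro h
  obtain ⟨r, hr⟩ := Int.eq_ofNat_of_zero_le (Int.emod_nonneg k (by norm_num : (9 : ℤ) ≠ 0))
  refine not_occ_seqZero_aux f hf r (by omega) fun n hn => ?_
  rw [List.getD_eq_getElem _ _ hn, ← h.apply hn, ← seqZero_add_mul (r + n) (k / 9)]
  congr 1
  omega

theorem length_le_of_mem_sideWords : ∀ f ∈ sideWords, f.length ≤ 15 := by decide

/-- The sequence is periodic to the right, and a side word or a block can only occur there. -/
structure Clean (S : ℤ → ℕ) : Prop where
  letters : ∀ i, S i = 1 ∨ S i = 2 ∨ S i = 3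
  right : ∀ j, -15 ≤ j → S j = seqZero j
  side : ∀ f ∈ sideWords, ∀ k : ℤ, k + f.length ≤ 6 → ¬ Occ S k f
  block : ∀ k : ℤ, k ≤ -9 → ¬ Occ S k blockWord

/-- A side word has at most 15 letters, so one that is not excluded by assumption lies entirely in
the periodic part. -/
theorem Clean.not_occ {S : ℤ → ℕ} (h : Clean S) {f : List ℕ} (hf : f ∈ sideWords) (k : ℤ) :
    ¬ Occ S k f := by
  by_cases hk : k + f.length ≤ 6
  · exact h.side f hf k hk
  · have := length_le_of_mem_sideWords f hf
    rw [occ_congr (T := seqZero) (j := k) fun n _ => h.right _ (by omega)]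
    exact not_occ_seqZero hf k

theorem isStar_seqZero : IsStar seqZero 0 := by
  simp only [IsStar, blockWord, omega]
  repeat' constructor

theorem Clean.isStar {S : ℤ → ℕ} (h : Clean S) (k : ℕ) : IsStar S (9 * k) := by
  refine (occ_congr fun n hn => ?_).1 isStar_seqZero
  rw [h.right _ (by omega), ← seqZero_add_mul (0 - 8 + n) k]
  congr 1
  ring

/-- A star to the left of 0 would come from an excluded block; to the right periodicity leaves the
multiples of 9. -/
theorem Clean.exists_eq {S : ℤ → ℕ} (h : Clean S) {q : ℤ} (hq : IsStar S q) :
    ∃ k : ℕ, q = 9 * k := by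
  have h0 : 0 ≤ q := by
    by_contra hlt
    exact h.block (q - 8) (by omega) hq
  have h9 := (periodic_stars (S := S) (p := 0) (q := q) fun j hj _ => by
    rw [zero_add]
    exact h.right j (by omega)).1 hq
  exact ⟨(q / 9).toNat, by omega⟩

theorem Clean.not_isStar_rev {S : ℤ → ℕ} (h : Clean S) {q : ℤ} (hq : -7 ≤ q) :
    ¬ IsStar (rev S) (-q) :=
  (periodic_stars (S := S) (p := 0) (q := q) fun j hj _ => by
    rw [zero_add]
    exact h.right j (by omega)).2

theorem Clean.half {S : ℤ → ℕ} (h : Clean S) : Half S := by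
  intro p hp
  obtain ⟨k, rfl⟩ := h.exists_eq hp
  refine ⟨?_, ?_⟩
  · have := h.isStar (k + 1)
    convert this using 1
    push_cast
    ring
  · refine (occL_congr fun n hn => ?_).1 occL_seqZero
    have : leftWord.length = 15 := rfl
    rw [h.right _ (by omega), ← seqZero_add_mul (-1 - n) k]
    congr 1
    ring

theorem isStar_shift {S : ℤ → ℕ} {c p : ℤ} : IsStar (fun i => S (i + c)) p ↔ IsStar S (p + c) :=
  occ_congr fun n _ => by
    congr 1
    ring

theorem Half.shift {S : ℤ → ℕ} (h : Half S) (c : ℤ) : Half fun i => S (i + c) := by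
  intro p hp
  rw [isStar_shift] at hp
  obtain ⟨h1, h2⟩ := h _ hp
  refine ⟨?_, ?_⟩
  · rw [isStar_shift]
    convert h1 using 1
    ring
  · refine (occL_congr fun n _ => ?_).1 h2
    congr 1
    ring

/-- Only the outer stars have to be compared with the star at `0`. -/
theorem sharp_of_reg {S : ℤ → ℕ} (h : Reg S) (hs : IsStar S 0) (hf : ¬ IsStar S (-9))
    (hm : ∀ p, IsStar (rev S) p → ¬ IsStar (rev S) (p - 9) → lam (rev S) p ≤ lam S 0) :
    Sharp S := by
  refine ⟨h, hs, hf, fun i => ?_⟩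
  have hf' : ¬ IsStar S (0 - 9) := by simpa using hf
  -- Below j₀ there is nothing to compare. Otherwise i is a star or a transposed star; inner ones
  -- are smaller than the outer star at 0, and 0 is the only outer star of `S` itself.
  by_cases hi : jZero ≤ lam S i
  · rcases h.isStar_or hi with hi | hi
    · by_cases hi' : IsStar S (i - 9)
      · exact (h.lam_lt hi hi' hs hf').le
      · have h1 := h.not_isStar_of_lt hs hf' (q := i)
        have h2 := h.not_isStar_of_lt hi hi' (q := 0)
        rcases lt_trichotomy i 0 with h3 | rfl | h3
        · exact absurd hi (h1 h3)
        · exact le_rfl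
        · exact absurd hs (h2 h3)
    · rw [← neg_neg i, ← lam_rev]
      by_cases hi' : IsStar (rev S) (-i - 9)
      · rw [lam_of_right fun _ hj => h.rev.half.eq_seqZero hi (by omega),
          lam_of_right fun _ hj => h.half.eq_seqZero hs (by omega)]
        have := cfInf_inner_lt_outer h.rev.one_le h.one_le
          (occL_innerWord hi hi' (h.rev.half _ hi')) (h.outer hs hf')
        linarith
      · exact hm _ hi hi'
  · have := (h.lam_bounds hs hf').1
    have := constants_lt.1
    linarith

/-! ### Blocks of words -/

theorem Occ.isInfix {S : ℤ → ℕ} {a k : ℤ} {w f : List ℕ} (hw : Occ S a w) (hf : Occ S k f)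
    (h1 : a ≤ k) (h2 : k + f.length ≤ a + w.length) : f <:+: w := by
  obtain ⟨n, hn⟩ := Int.eq_ofNat_of_zero_le (show 0 ≤ k - a by omega)
  obtain rfl : k = a + n := by omega
  have e : f = (w.drop n).take f.length := by
    refine List.ext_getElem (by simp; omega) fun i h3 h4 => ?_
    rw [List.getElem_take, List.getElem_drop, ← hf.apply h3, ← hw.apply (by omega)]
    congr 1
    push_cast
    ring
  rw [e]
  exact (List.take_prefix _ _).isInfix.trans (List.drop_suffix _ _).isInfix

theorem Avoids.not_isInfix {w : List ℕ} (h : Avoids w) {f : List ℕ} (hf : f ∈ sideWords) :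
    ¬ f <:+: w := by
  rcases List.mem_append.1 hf with hf | hf
  · exact (h f (by rw [forbiddenWords_eq]; simp [hf])).1
  · obtain ⟨g, hg, rfl⟩ := List.mem_map.1 hf
    exact (h g (by rw [forbiddenWords_eq]; simp [hg])).2

theorem Avoids.not_blockWord {w : List ℕ} (h : Avoids w) :
    ¬ blockWord <:+: w ∧ ¬ blockWord.reverse <:+: w :=
  h _ (by rw [forbiddenWords_eq]; simp)

theorem Avoids.reverse {w : List ℕ} (h : Avoids w) : Avoids w.reverse := by
  intro f hf
  have e (g : List ℕ) : g <:+: w.reverse ↔ g.reverse <:+: w := by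
    rw [← List.reverse_infix, List.reverse_reverse]
  rw [e, e, List.reverse_reverse]
  exact (h f hf).symm

/-- The words around the outer star of a sharp sequence contain no forbidden word. -/
theorem Sharp.avoids {S : ℤ → ℕ} (h : Sharp S) {a : ℤ} {w : List ℕ} (hw : Occ S a w)
    (ha : a + w.length ≤ 6) (hT : ∀ q, a + 6 ≤ q → ¬ IsStar (rev S) (-q)) : Avoids w := by
  have side (f : List ℕ) (hf : f ∈ sideWords) : ¬ f <:+: w := fun hi => by
    obtain ⟨k, _, ho⟩ := hw.infix hi
    exact h.reg.avoid f hf _ ho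
  intro f hf
  rw [forbiddenWords_eq, List.mem_append, List.mem_singleton] at hf
  rcases hf with hf | rfl
  · exact ⟨side f (by simp [sideWords, hf]), side _ (by simp [sideWords, hf])⟩
  · have hlen : blockWord.length = 15 := rfl
    refine ⟨fun hi => ?_, fun hi => ?_⟩
    · obtain ⟨k, hk, ho⟩ := hw.infix hi
      refine h.reg.not_isStar_of_lt h.star (by simpa using h.first) (q := a + k + 8) (by omega) ?_
      rwa [IsStar, add_sub_cancel_right]
    · obtain ⟨k, hk, ho⟩ := hw.infix hi
      refine hT (a + k + 6) (by omega) ?_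
      rw [occ_reverse_iff, hlen] at ho
      rw [IsStar]
      convert ho using 1
      push_cast
      ring

theorem tailSeq_occ (l : ℕ → ℕ) (u : List ℕ) (m : ℕ) : Occ (tailSeq l u) (-13 - u.length - m)
    (((List.range m).map l).reverse ++ (u ++ omega ++ omega ++ [1])) := by
  have h1 : OccL (tailSeq l u) (-14 - u.length) ((List.range m).map l) :=
    OccL.of_seq fun n hn => by simpa using tailSeq_left l u n
  have h2 := tailSeq_occL l u
  have h3 : Occ (tailSeq l u) (-13) (omega ++ (omega ++ [1])) := by
    refine (occ_congr (S := seqZero) (i := -13) fun n _ => ?_).1 ?_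
    · exact (tailSeq_right l u (by omega)).symm
    · simp only [omega]
      repeat' constructor
  rw [occL_iff] at h1 h2
  rw [occ_append, List.append_assoc, List.append_assoc, occ_append]
  rw [List.reverse_reverse] at h2
  simp only [List.length_reverse, List.length_map, List.length_range] at h1 h2 ⊢
  refine ⟨?_, ?_, ?_⟩
  · convert h1 using 1
    ring
  · convert h2 using 1
    ring
  · convert h3 using 1
    ring

/-- The words end at position 5, one letter short of the end of the block starred at 0. So their
avoidance excludes every earlier block, but not that one; this is why the words in C and D end with
ω ω 1 and not with ω ω 12. -/
theorem clean_of_avoids {S : ℤ → ℕ} (hS : ∀ i, S i = 1 ∨ S i = 2 ∨ S i = 3)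
    (hr : ∀ j, -15 ≤ j → S j = seqZero j)
    (h : ∀ f k, f ∈ sideWords ∨ f = blockWord → Occ S k f →
      ∃ a w, a ≤ k ∧ a + w.length = (6 : ℤ) ∧ Occ S a w ∧ Avoids w) : Clean S := by
  refine ⟨hS, hr, fun f hf k hk ho => ?_, fun k hk ho => ?_⟩
  · obtain ⟨a, w, h1, h2, h3, h4⟩ := h f k (Or.inl hf) ho
    exact h4.not_isInfix hf (h3.isInfix ho h1 (by omega))
  · obtain ⟨a, w, h1, h2, h3, h4⟩ := h _ k (Or.inr rfl) ho
    have hlen : blockWord.length = 15 := rfl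
    exact h4.not_blockWord.1 (h3.isInfix ho h1 (by omega))

/-! ### The sequences of `C`, `D` and `X` are sharp -/

theorem right_of_eq {S : ℤ → ℕ} (hr : ∀ j, -13 ≤ j → S j = seqZero j)
    (h : OccL S (-14) [2, 1]) : ∀ j, -15 ≤ j → S j = seqZero j := by
  intro j hj
  by_cases h1 : -13 ≤ j
  · exact hr j h1
  · obtain rfl | rfl : j = -14 ∨ j = -15 := by omega
    · exact h.1
    · exact h.2.1

theorem isStar_rev_iff {S : ℤ → ℕ} {p : ℤ} :
    IsStar (rev S) p ↔ Occ S (-p - 6) blockWord.reverse := by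
  rw [occ_reverse_iff, IsStar]
  have hlen : blockWord.length = 15 := rfl
  rw [hlen]
  congr! 1
  push_cast
  ring

/-- The avoided words extend arbitrarily far to the left, so they exclude transposed stars there,
and the periodic right half has none; no other outer star competes with the one at 0. -/
theorem sharp_tailSeq {l : ℕ → ℕ} {t : List ℕ} (hl : ∀ n, l n = 1 ∨ l n = 2 ∨ l n = 3)
    (ht : t = [2] ∨ t = [1, 1]) (h : LeftAvoids l (t ++ [1, 2] ++ omega ++ omega ++ [1])) :
    Sharp (tailSeq l (t ++ [1, 2])) := by
  have hcov (k : ℤ) : ∃ a w, a ≤ k ∧ a + w.length = (6 : ℤ) ∧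
      Occ (tailSeq l (t ++ [1, 2])) a w ∧ Avoids w := by
    refine ⟨_, _, ?_, ?_, tailSeq_occ l (t ++ [1, 2]) (-k).toNat, h _⟩
    · omega
    · simp [omega]
      ring
  have hc : Clean (tailSeq l (t ++ [1, 2])) := by
    refine clean_of_avoids (letters_tailSeq hl ?_) (right_of_eq (fun j => tailSeq_right l _) ?_)
      fun f k _ _ => hcov k
    · rcases ht with rfl | rfl <;> decide
    · have := tailSeq_occL l (t ++ [1, 2])
      rw [List.reverse_append] at this
      exact (occL_append.1 this).1
  have hT (p : ℤ) : ¬ IsStar (rev (tailSeq l (t ++ [1, 2]))) p := by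
    intro hp
    by_cases h7 : -7 ≤ -p
    · exact hc.not_isStar_rev h7 (by rwa [neg_neg])
    · rw [isStar_rev_iff] at hp
      obtain ⟨a, w, h1, h2, h3, h4⟩ := hcov (-p - 6)
      have hlen : blockWord.reverse.length = 15 := rfl
      exact h4.not_blockWord.2 (h3.isInfix hp h1 (by omega))
  refine sharp_of_reg ⟨hc.letters, fun f hf => hc.not_occ hf, hc.half,
    fun p hp => absurd hp (hT p)⟩ (hc.isStar 0) (hc.block _ (by norm_num)) fun p hp => absurd hp (hT p)

/-- An occurrence that starts within the avoided word is excluded by it. One that starts further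
left lies in the reversed periodic part, which contains neither side words nor the block. -/
theorem clean_twoSeq {u : List ℕ} (hu : ∀ a ∈ u, a = 1 ∨ a = 2 ∨ a = 3)
    (h2 : OccL (twoSeq u) (-14) [2, 1])
    (ha : Avoids ([1] ++ omegaT ++ omegaT ++ (u ++ omega ++ omega ++ [1]))) :
    Clean (twoSeq u) := by
  refine clean_of_avoids (letters_tailSeq letters_omega hu)
    (right_of_eq (fun j => tailSeq_right _ _) h2) fun f k hf ho => ?_
  have hlen : f.length ≤ 15 := by
    rcases hf with hf | rfl
    · exact length_le_of_mem_sideWords f hf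
    · exact le_rfl
  by_cases hk : -13 - (u.length : ℤ) - (19 : ℕ) ≤ k
  · refine ⟨_, _, hk, ?_, tailSeq_occ _ u 19, ha⟩
    simp [omega]
    ring
  · exfalso
    have hleft (n : ℕ) (hn : n < f.length) :
        twoSeq u (k + n) = seqZero (-(u.length + 27) - k - n) := by
      rw [← twoSeq_left u (j := -(u.length + 27) - k - n) (by omega)]
      congr 1
      ring
    have ho' : OccL seqZero (-(u.length + 27) - k) f :=
      OccL.of_seq fun n hn => by rw [← hleft n hn, ho.apply hn]
    rw [occL_iff] at ho'
    rcases hf with hf | rfl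
    · exact not_occ_seqZero (sideWords_reverse f hf) _ ho'
    · refine (periodic_stars (S := seqZero) (p := 0) (q := -(u.length + 27) - k - 8)
        fun j _ _ => by rw [zero_add]).2 ?_
      rw [isStar_rev_iff]
      have hlen : ((blockWord.length : ℕ) : ℤ) = 15 := rfl
      rw [hlen] at ho'
      convert ho' using 1
      ring

theorem lam_shift (S : ℤ → ℕ) (c p : ℤ) : lam (fun i => S (i + c)) p = lam S (p + c) := by
  simp only [lam]
  congr 1
  funext n
  congr 1
  ring

theorem rev_twoSeq (u : List ℕ) :
    rev (twoSeq u) = fun i => twoSeq u.reverse (i + -(u.length + 27)) := by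
  rw [← twoSeq_reverse]
  funext i
  simp only [rev]
  congr 1
  ring

/-- The reversal is the sequence of the reversed word, shifted by the distance |u| + 27 between the
two outer stars. Its only outer star is therefore at that distance, and a single comparison is left.
-/
theorem sharp_twoSeq {u : List ℕ} (h : Clean (twoSeq u)) (h' : Clean (twoSeq u.reverse))
    (hle : lam (twoSeq u.reverse) 0 ≤ lam (twoSeq u) 0) : Sharp (twoSeq u) := by
  refine sharp_of_reg ⟨h.letters, fun f hf => h.not_occ hf, h.half, ?_⟩ (h.isStar 0)
    (h.block _ (by norm_num)) fun p hp hp' => ?_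
  · rw [rev_twoSeq]
    exact h'.half.shift _
  · rw [rev_twoSeq] at hp hp' ⊢
    rw [isStar_shift] at hp hp'
    rw [lam_shift]
    obtain ⟨k, hk⟩ := h'.exists_eq hp
    rcases k with _ | k
    · rw [hk]
      simpa using hle
    · exfalso
      refine hp' ?_
      convert h'.isStar k using 1
      push_cast at hk
      linarith

theorem sharp_twoSeq_of_avoids {u : List ℕ} (hu : ∀ a ∈ u, a = 1 ∨ a = 2 ∨ a = 3)
    (h2 : OccL (twoSeq u) (-14) [2, 1]) (h2' : OccL (twoSeq u.reverse) (-14) [2, 1])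
    (ha : Avoids ([1] ++ omegaT ++ omegaT ++ (u ++ omega ++ omega ++ [1])))
    (hle : lam (twoSeq u.reverse) 0 ≤ lam (twoSeq u) 0) : Sharp (twoSeq u) := by
  refine sharp_twoSeq (clean_twoSeq hu h2 ha) (clean_twoSeq (by simpa using hu) h2' ?_) hle
  have := ha.reverse
  simpa [omega, omegaT] using this

/-! ### Comparison of the two outer stars -/

/-- The value `[0; ω ω …]`. -/
noncomputable def sigma : ℝ := cfInf (periodicRight omega)

theorem one_le_omega (n : ℕ) : 1 ≤ periodicRight omega n := by
  rcases letters_omega n with h | h | h <;> omega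

theorem sigma_nonneg : 0 ≤ sigma := cfInf_nonneg _ one_le_omega

theorem lam_tailSeq {l : ℕ → ℕ} {u : List ℕ} (hl : ∀ n, 1 ≤ l n) (hu : ∀ a ∈ u, 1 ≤ a) :
    lam (tailSeq l u) 0 = 3 + rho + cfT ([3, 3, 2, 1] ++ omegaT) (cfT u.reverse (cfInf l)) := by
  have h : (fun n : ℕ => tailSeq l u (0 - 1 - n))
      = prepend ([3, 3, 2, 1] ++ omegaT) (prepend u.reverse l) := by
    funext n
    rw [← tailSeq_negSucc]
    congr 1
    rw [Int.negSucc_eq]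
    ring
  rw [lam_of_right fun j hj => by rw [zero_add]; exact tailSeq_right l u (by omega), h,
    cfInf_prepend _ _ (by decide) (prepend_forall (by simpa using hu) hl),
    cfInf_prepend _ _ (by simpa using hu) hl]

/-- The common word 3321 ωᵀ 21 has odd length, so it reverses the order. What remains compares s and
its transpose, each followed by 12 ω ω …; as they have equal length, the common tail may be replaced
by 0. -/
theorem lam_twoSeq_le_iff {s : List ℕ} (hs : ∀ a ∈ s, 1 ≤ a) :
    lam (twoSeq ([2, 1] ++ s ++ [1, 2]).reverse) 0 ≤ lam (twoSeq ([2, 1] ++ s ++ [1, 2])) 0 ↔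
      cfFin s.reverse ≤ cfFin s := by
  have hu : ∀ a ∈ [2, 1] ++ s ++ [1, 2], 1 ≤ a := by
    intro a ha
    simp only [List.mem_append, List.mem_cons, List.not_mem_nil, or_false] at ha
    rcases ha with ((rfl | rfl) | ha) | (rfl | rfl)
    · norm_num
    · norm_num
    · exact hs a ha
    · norm_num
    · norm_num
  have hs' : ∀ a ∈ s.reverse, 1 ≤ a := by simpa using hs
  have hσ := sigma_nonneg
  have hx : 0 ≤ cfT [1, 2] sigma := cfT_nonneg _ hσ
  have hx1 : cfT [1, 2] sigma < 1 := by
    simp only [cfT]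
    rw [div_lt_one (by positivity)]
    have : 0 < 1 / (((2 : ℕ) : ℝ) + sigma) := by positivity
    push_cast at this ⊢
    linarith
  have e1 : ([2, 1] ++ s ++ [1, 2]).reverse = [2, 1] ++ (s.reverse ++ [1, 2]) := by simp
  have e2 : [2, 1] ++ s ++ [1, 2] = [2, 1] ++ (s ++ [1, 2]) := by simp
  rw [twoSeq, twoSeq, lam_tailSeq one_le_omega hu, lam_tailSeq one_le_omega (by simpa using hu),
    List.reverse_reverse, add_le_add_iff_left, ← sigma, cfT_le_iff _ (by decide)
      (cfT_nonneg _ sigma_nonneg) (cfT_nonneg _ sigma_nonneg), if_neg (by decide), e1, e2,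
    cfT_append, cfT_append [2, 1], cfT_le_iff _ (by decide) (cfT_nonneg _ sigma_nonneg)
    (cfT_nonneg _ sigma_nonneg), if_pos (by decide), cfT_append, cfT_append, ← cfT_zero,
    ← cfT_zero, ← not_lt, ← not_lt]
  exact not_congr (cfT_lt_cfT_iff_of_length_eq _ _ (by simp) hs hs' hx hx1 le_rfl zero_lt_one)

/-! ### From `C`, `D` and `X` to sharp sequences -/

theorem Sharp.mem {S : ℤ → ℕ} (h : Sharp S) :
    lam S 0 ∈ markovSpectrum ∧ jMin ≤ lam S 0 ∧ lam S 0 < jMax :=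
  ⟨mem_markovSpectrum h.reg.one_le h.max,
    h.reg.lam_bounds h.star (by simpa using h.first)⟩

theorem exists_sharp_of_mem_setC {x : ℝ} (hx : x ∈ setC) : ∃ S, Sharp S ∧ lam S 0 = x := by
  obtain ⟨l, t, hl, ht, ha, rfl⟩ := hx
  exact ⟨_, sharp_tailSeq hl ht ha, lam_zero _⟩

theorem exists_sharp_of_mem_setD {x : ℝ} (hx : x ∈ setD) :
    ∃ u, Sharp (twoSeq u) ∧ lam (twoSeq u) 0 = x := by
  obtain ⟨s, hs, _, _, hle, ha, rfl⟩ := hx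
  refine ⟨[2, 1] ++ s ++ [1, 2], ?_, lam_zero _⟩
  have h21 (v : List ℕ) : OccL (twoSeq (v ++ [1, 2])) (-14) [2, 1] := by
    have := tailSeq_occL (periodicRight omega) (v ++ [1, 2])
    rw [List.reverse_append] at this
    exact (occL_append.1 this).1
  refine sharp_twoSeq_of_avoids ?_ (h21 _) ?_ ?_ ?_
  · intro a ha
    simp only [List.mem_append, List.mem_cons, List.not_mem_nil, or_false] at ha
    rcases ha with ((rfl | rfl) | ha) | (rfl | rfl)
    · norm_num
    · norm_num
    · exact hs a ha
    · norm_num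
    · norm_num
  · have := h21 ([2, 1] ++ s.reverse)
    simpa using this
  · simpa using ha
  · refine (lam_twoSeq_le_iff fun a ha => ?_).2 hle
    rcases hs a ha with h | h | h <;> omega

theorem exists_sharp_of_mem_setX {x : ℝ} (hx : x ∈ setX) : ∃ S, Sharp S ∧ lam S 0 = x := by
  -- The three words are palindromes, so the two outer stars have equal values.
  have key (u : List ℕ) (hu : ∀ a ∈ u, a = 1 ∨ a = 2 ∨ a = 3) (hr : u.reverse = u)
      (h2 : OccL (twoSeq u) (-14) [2, 1])
      (ha : Avoids ([1] ++ omegaT ++ omegaT ++ (u ++ omega ++ omega ++ [1]))) :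
      Sharp (twoSeq u) :=
    sharp_twoSeq_of_avoids hu h2 (by rw [hr]; exact h2) ha (by rw [hr])
  rcases hx with rfl | rfl | rfl
  · refine ⟨_, key [2] (by decide) rfl ⟨rfl, rfl, trivial⟩ ?_, lam_zero _⟩
    unfold Avoids
    decide +kernel
  · refine ⟨_, key [2, 1, 2] (by decide) rfl ⟨rfl, rfl, trivial⟩ ?_, lam_zero _⟩
    unfold Avoids
    decide +kernel
  · refine ⟨_, key [2, 1, 1, 1, 2] (by decide) rfl ⟨rfl, rfl, trivial⟩ ?_, lam_zero _⟩
    unfold Avoids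
    decide +kernel

/-! ### Sharp sequences give points of `C`, `D` and `X` -/

theorem Sharp.right {S : ℤ → ℕ} (h : Sharp S) {j : ℤ} (hj : -15 ≤ j) : S j = seqZero j := by
  have := h.reg.half.eq_seqZero h.star hj
  rwa [zero_add] at this

theorem Sharp.outer {S : ℤ → ℕ} (h : Sharp S) : Outer S 0 :=
  h.reg.outer h.star (by simpa using h.first)

/-- Without transposed stars, nothing but the avoidance of words constrains the left half, and t
records which of the two outer words occurs. -/
theorem Sharp.mem_setC {S : ℤ → ℕ} (h : Sharp S) (hT : ∀ q, ¬ IsStar (rev S) (-q)) :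
    lam S 0 ∈ setC := by
  have key (t : List ℕ) (ht : t = [2] ∨ t = [1, 1]) (ho : OccL S (0 - 1) (leftWord ++ t)) :
      lam S 0 ∈ setC := by
    have ho' : OccL S (0 - 1) (([3, 3, 2, 1] ++ omegaT) ++ ([2, 1] ++ t)) := ho
    have hu : OccL S (-14) (t ++ [1, 2]).reverse := by
      have := (occL_append.1 ho').2
      rcases ht with rfl | rfl <;> exact this
    have e : S = tailSeq _ (t ++ [1, 2]) :=
      eq_tailSeq (fun j hj => h.right (by omega)) hu fun n => rfl
    refine ⟨_, t, fun n => h.reg.letters _, ht, fun m => ?_, by rw [lam_zero]; exact congrArg _ e⟩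
    have hw := tailSeq_occ (fun n : ℕ => S (-14 - (t ++ [1, 2]).length - n)) (t ++ [1, 2]) m
    rw [← e] at hw
    refine h.avoids hw ?_ fun q _ => hT q
    simp [omega]
    linarith
  rcases h.outer with ho | ho
  · exact key _ (Or.inl rfl) ho
  · exact key _ (Or.inr rfl) ho

theorem length_windowL (S : ℤ → ℕ) (i : ℤ) (n : ℕ) : (windowL S i n).length = n := by
  induction n generalizing i with
  | zero => rfl
  | succ n ih => simp [windowL, ih]

theorem OccL.isPrefix {S : ℤ → ℕ} {i : ℤ} {a b : List ℕ} (ha : OccL S i a) (hb : OccL S i b)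
    (h : a.length ≤ b.length) : a <+: b := by
  have e : a = b.take a.length := by
    refine List.ext_getElem (by simp [h]) fun n h3 h4 => ?_
    rw [List.getElem_take, ← ha.apply h3, ← hb.apply (by omega)]
  rw [e]
  exact List.take_prefix _ _

/-- The forced words of a star and of a transposed star at distance m are superposed; for m below 32
they disagree at some letter, except for m = 28 and m = 30. The smaller m are excluded elsewhere. -/
theorem overlap_aux : ∀ t ∈ [[2], [1, 1]], ∀ t' ∈ [[2], [1, 1]], ∀ m < 32, 8 ≤ m → m ≠ 28 →
    m ≠ 30 → ∃ n ≤ m, n < (3 :: (leftWord ++ t')).length ∧ m - n < (3 :: (leftWord ++ t)).length ∧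
      (3 :: (leftWord ++ t')).getD n 0 ≠ (3 :: (leftWord ++ t)).getD (m - n) 0 := by
  decide +kernel

theorem Outer.exists_word {S : ℤ → ℕ} {p : ℤ} (h : Outer S p) :
    ∃ t, (t = [2] ∨ t = [1, 1]) ∧ OccL S (p - 1) (leftWord ++ t) := by
  rcases h with h | h
  · exact ⟨_, Or.inl rfl, h⟩
  · exact ⟨_, Or.inr rfl, h⟩

/-- The distance between the outer stars of the two directions. -/
theorem Sharp.distance {S : ℤ → ℕ} (h : Sharp S) {m : ℕ} (hm : IsStar (rev S) m)
    (hm' : ¬ IsStar (rev S) (m - 9)) : m = 28 ∨ m = 30 ∨ 32 ≤ m := by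
  have h8 := h.reg.lt_of_isStar_rev h.star (q := -m) (by rwa [neg_neg])
  by_contra hcon
  obtain ⟨t, ht, ho⟩ := h.outer.exists_word
  obtain ⟨t', ht', ho'⟩ := (h.reg.rev.outer hm hm').exists_word
  have ho : OccL S 0 (3 :: (leftWord ++ t)) := ⟨h.star.occ.2.1, ho⟩
  have ho' : OccL (rev S) m (3 :: (leftWord ++ t')) := ⟨hm.occ.2.1, ho'⟩
  obtain ⟨n, h1, h2, h3, h4⟩ := overlap_aux t (by simpa using ht) t' (by simpa using ht') m
    (by omega) (by omega) (by omega) (by omega)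
  apply h4
  rw [List.getD_eq_getElem _ _ h2, List.getD_eq_getElem _ _ h3, ← ho.apply h3, ← ho'.apply h2]
  simp only [rev]
  congr 1
  omega

theorem lam_twoSeq_reverse (u : List ℕ) :
    lam (twoSeq u.reverse) 0 = lam (twoSeq u) (-(u.length + 27)) := by
  rw [← lam_rev, rev_twoSeq, lam_shift, add_neg_cancel]

/-- The rightmost transposed star, at -m, makes the sequence periodic to its left, so it is `twoSeq
u` with |u| = m - 27. The distances 28 and 30 give u = 2 and u = 212; otherwise u = 21 s 12, and s =
1 is the last point of X. -/
theorem Sharp.mem_setD_union_setX {S : ℤ → ℕ} (h : Sharp S) {m : ℕ} (hm : IsStar (rev S) m)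
    (hmax : ∀ q, -(m : ℤ) < q → ¬ IsStar (rev S) (-q)) : lam S 0 ∈ setD ∪ setX := by
  have hm' : ¬ IsStar (rev S) (m - 9) := by
    have := hmax (-(m - 9)) (by omega)
    rwa [neg_neg] at this
  have hl (j : ℤ) (hj : -15 ≤ j) : S (-m - j) = seqZero j := by
    rw [← h.reg.rev.half.eq_seqZero hm hj, rev]
    congr 1
    ring
  have two (u : List ℕ) (hu : OccL S (-14) u.reverse) (hlen : u.length + 27 = m) :
      S = twoSeq u := by
    refine eq_twoSeq (fun j hj => h.right (by omega)) hu fun j hj => ?_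
    rw [← hl j (by omega), ← hlen]
    push_cast
    rfl
  have s14 : S (-14) = 2 := h.right (by norm_num)
  have s15 : S (-15) = 1 := h.right (by norm_num)
  have l14 : S (-m - -14) = 2 := hl _ (by norm_num)
  have l15 : S (-m - -15) = 1 := hl _ (by norm_num)
  have hX (u : List ℕ) (hu : OccL S (-14) u.reverse) (hlen : u.length + 27 = m) :
      lam S 0 = lambda0 (twoSeq u) := by
    rw [lam_zero, ← two u hu hlen]
  rcases h.distance hm hm' with rfl | rfl | h32
  · exact Or.inr (Or.inl (hX [2] ⟨s14, trivial⟩ rfl))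
  · exact Or.inr (Or.inr (Or.inl (hX [2, 1, 2] ⟨s14, s15, l14, trivial⟩ rfl)))
  · set s := (windowL S (-16) (m - 31)).reverse with hs
    have hslen : s.length = m - 31 := by rw [hs, List.length_reverse, length_windowL]
    have os : OccL S (-16) s.reverse := by
      rw [hs, List.reverse_reverse]
      exact occL_windowL _ _ _
    clear_value s
    have hu : OccL S (-14) ([2, 1] ++ s ++ [1, 2]).reverse := by
      have : ([2, 1] ++ s ++ [1, 2]).reverse = [2, 1] ++ (s.reverse ++ [1, 2]) := by simp
      rw [this, occL_append, occL_append]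
      refine ⟨⟨s14, s15, trivial⟩, os, ?_, ?_, trivial⟩
      · rw [← l15]
        congr 1
        simp [hslen]
        omega
      · rw [← l14]
        congr 1
        simp [hslen]
        omega
    have hulen : ([2, 1] ++ s ++ [1, 2]).length + 27 = m := by
      simp [hslen]
      omega
    have e := two _ hu hulen
    have os' : OccL (rev S) (m - 16) s := by
      rw [occL_rev]
      rw [occL_iff, List.reverse_reverse] at os
      convert os using 1
      rw [List.length_reverse, hslen]
      omega
    obtain ⟨t, ht, ho⟩ := h.outer.exists_word
    obtain ⟨t', ht', ho'⟩ := (h.reg.rev.outer hm hm').exists_word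
    have hlw : ((leftWord.length : ℕ) : ℤ) = 15 := rfl
    have ot : OccL S (-16) t := by
      have := (occL_append.1 ho).2
      rw [hlw] at this
      exact this
    have ot' : OccL (rev S) (m - 16) t' := by
      have := (occL_append.1 ho').2
      rw [hlw] at this
      convert this using 1
      ring
    by_cases hone : s = [1]
    · exact Or.inr (Or.inr (Or.inr (by
        have := hX _ hu hulen
        rw [hone] at this
        exact this)))
    -- The outer words on the two sides determine the ends of s, provided that s is long enough. It
    -- is too short only if it is a single letter and one end reads 11, that is, if s = 1.
    · have hlt : t.length ≤ s.length ∧ t'.length ≤ s.length := by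
        by_contra hcon
        apply hone
        have hs1 : s.length = 1 := by
          rcases ht with rfl | rfl <;> rcases ht' with rfl | rfl <;>
            simp only [List.length_cons, List.length_nil] at hcon <;> omega
        obtain ⟨a, ha⟩ := List.length_eq_one_iff.1 hs1
        rw [ha] at os os' ⊢
        rcases ht with rfl | rfl
        · rcases ht' with rfl | rfl
          · rw [ha] at hcon
            simp at hcon
          · rw [← os'.1, ot'.1]
        · rw [← os.1, ot.1]
      have letters : ∀ a ∈ s, a = 1 ∨ a = 2 ∨ a = 3 := by
        intro a ha
        obtain ⟨n, hn, rfl⟩ := List.mem_iff_getElem.1 ha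
        rw [← os'.apply hn]
        exact h.reg.letters _
      refine Or.inl ⟨s, letters, ?_, ?_, ?_, ?_, hX _ hu hulen⟩
      · have := ot'.isPrefix os' hlt.2
        rcases ht' with rfl | rfl
        · exact Or.inr this
        · exact Or.inl this
      · have := ot.isPrefix os (by simpa using hlt.1)
        rw [← List.reverse_suffix, List.reverse_reverse] at this
        rcases ht with rfl | rfl
        · exact Or.inr this
        · exact Or.inl this
      · refine (lam_twoSeq_le_iff fun a ha => ?_).1 ?_
        · rcases letters a ha with h | h | h <;> omega
        -- Maximality at 0, applied at the outer star of the reversal, is the inequality between s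
        -- and its transpose.
        · rw [lam_twoSeq_reverse, ← e]
          exact h.max _
      · have hw := tailSeq_occ (periodicRight omega) ([2, 1] ++ s ++ [1, 2]) 19
        change Occ (twoSeq _) _ _ at hw
        rw [← e] at hw
        have := h.avoids hw (by simp [omega]; linarith) fun q hq => hmax q (by
          have : (([2, 1] ++ s ++ [1, 2]).length : ℤ) + 27 = m := by exact_mod_cast hulen
          push_cast at hq
          omega)
        rw [show ((List.range 19).map (periodicRight omega)).reverse = [1] ++ omegaT ++ omegaT by
          decide] at this
        simpa only [List.append_assoc] using this

theorem Sharp.mem_union {S : ℤ → ℕ} (h : Sharp S) : lam S 0 ∈ setC ∪ setD ∪ setX := by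
  by_cases hT : ∃ q, IsStar (rev S) (-q)
  · obtain ⟨q, hq, hmax⟩ := Int.exists_greatest_of_bdd (P := fun q => IsStar (rev S) (-q))
      ⟨0, fun q hq => by
        have := h.reg.lt_of_isStar_rev h.star hq
        omega⟩ hT
    have h8 := h.reg.lt_of_isStar_rev h.star hq
    obtain ⟨m, hm⟩ := Int.eq_ofNat_of_zero_le (show 0 ≤ -q by omega)
    rw [hm] at hq
    rw [Set.union_assoc]
    refine Or.inr (h.mem_setD_union_setX hq fun q' hq' hs => ?_)
    have := hmax q' hs
    omega
  · push Not at hT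
    exact Or.inl (Or.inl (h.mem_setC hT))

theorem markovSpectrum_inter_Ioo :
    markovSpectrum ∩ Set.Ioo jZero jMax = setC ∪ setD ∪ setX := by
  apply Set.Subset.antisymm
  · rintro x ⟨hx, h0, h1⟩
    obtain ⟨S, hS, rfl⟩ := exists_sharp hx h0 h1
    exact hS.mem_union
  · intro x hx
    have : ∃ S, Sharp S ∧ lam S 0 = x := by
      rcases hx with (hx | hx) | hx
      · exact exists_sharp_of_mem_setC hx
      · obtain ⟨u, h, e⟩ := exists_sharp_of_mem_setD hx
        exact ⟨_, h, e⟩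
      · exact exists_sharp_of_mem_setX hx
    obtain ⟨S, hS, rfl⟩ := this
    obtain ⟨h1, h2, h3⟩ := hS.mem
    exact ⟨h1, constants_lt.1.trans_le h2, h3⟩

theorem markovSpectrum_inter_Ioo_jMin : markovSpectrum ∩ Set.Ioo jZero jMin = ∅ := by
  ext x
  simp only [Set.mem_inter_iff, Set.mem_Ioo, Set.mem_empty_iff_false, iff_false, not_and]
  intro hx h0 h1
  obtain ⟨S, hS, rfl⟩ := exists_sharp hx h0 (h1.trans (constants_lt.2.1.trans constants_lt.2.2))
  have := hS.mem.2.1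
  linarith

/-! ### The Lagrange spectrum -/

/-- A star in the middle of a long run of stars has a value of `λ` close to `j₀`. -/
theorem near_jZero {S : ℤ → ℕ} (hS : ∀ i, 1 ≤ S i) {p q : ℤ} {R K : ℕ}
    (h : ∀ k : ℕ, k ≤ R → IsStar S (p + 9 * k)) (h1 : p + 9 * K + 9 ≤ q)
    (h2 : q + 9 * K + 9 ≤ p + 9 * R) (hq : IsStar S q ∨ IsStar (rev S) (-q)) :
    |lam S q - jZero| ≤ 2 * (1 / 4) ^ K := by
  have hper (j : ℤ) (hj1 : -8 ≤ j) (hj2 : j ≤ 9 * R) : S (p + j) = seqZero j := by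
    by_cases hj : 0 ≤ j
    · have := (h (j / 9).toNat (by omega)).eq_seqZero (j := j - 9 * (j / 9)) (by omega)
      by_cases h6 : j - 9 * (j / 9) ≤ 6
      · have := this h6
        rw [← seqZero_add_mul j (-(j / 9))]
        convert this using 2
        · rw [show (((j / 9).toNat : ℕ) : ℤ) = j / 9 by omega]
          ring
        · ring
      · have h3 : j ≠ 9 * R := by omega
        have := (h (j / 9 + 1).toNat (by omega)).eq_seqZero (j := j - 9 * (j / 9 + 1)) (by omega)
          (by omega)
        rw [← seqZero_add_mul j (-(j / 9 + 1))]
        convert this using 2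
        · rw [show (((j / 9 + 1).toNat : ℕ) : ℤ) = j / 9 + 1 by omega]
          ring
        · ring
    · have := (h 0 (by omega)).eq_seqZero (j := j) hj1 (by omega)
      simpa using this
  have hps := periodic_stars (S := S) (p := p) (q := q) fun j hj1 hj2 =>
    hper j (by omega) (by omega)
  rcases hq with hq | hq
  · obtain ⟨c, hc⟩ := hps.1 hq
    refine abs_lam_sub_jZero_le hS fun k hk1 hk2 => ?_
    have := h (c + k).toNat (by omega)
    convert this using 1
    omega
  · exact absurd hq hps.2

/-- Far to the right, `λ` cannot exceed `j₀` by a fixed amount infinitely often. -/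
theorem not_frequently_of_tame {S : ℤ → ℕ} (hT : Tame S) {N : ℤ}
    (h : ∀ i, N ≤ i → lam S i < jMax) {x : ℝ} (hx : jZero < x)
    (hf : ∀ M : ℤ, ∃ i, M ≤ i ∧ x < lam S i) : False := by
  have hS := hT.one_le
  have low (a b : ℤ) (ha : N ≤ a) : Low S a b := low_of_lam_lt hS h ha
  have right (p : ℤ) (hp : N + 60 ≤ p) (hs : IsStar S p) : Forced S p :=
    ⟨hs.right hT (low _ _ (by omega)) (h p (by omega)), hs.left hS (low _ _ (by omega))⟩
  have left (p : ℤ) (hp : N + 60 ≤ p) (hs : IsStar (rev S) (-p)) : Forced (rev S) (-p) := by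
    have hl : Low (rev S) (-p - 60) (-p + 60) := by
      have := (low (p - 60) (p + 60) (by omega)).rev
      convert this using 1 <;> ring
    exact ⟨hs.right hT.rev hl (by rw [lam_rev, neg_neg]; exact h p (by omega)),
      hs.left hT.rev.one_le hl⟩
  have star_or (p : ℤ) (hp : N + 100 ≤ p) (hl : x < lam S p) :
      IsStar S p ∨ IsStar (rev S) (-p) := by
    refine isStar_or_of_le_lam hT.letters ?_ (fun q hq _ => right q (by omega))
      (fun q _ hq hs => ?_) (hx.trans hl).le
    · have := avoidOn_sideWords hS (low (p - 9 - 12) (p + 9 + 12) (by omega))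
      convert this using 1 <;> ring
    · have := left (-q) (by omega) (by rwa [neg_neg])
      rwa [neg_neg] at this
  obtain ⟨K, hK⟩ := exists_pow_lt_of_lt_one (show 0 < (x - jZero) / 2 by linarith)
    (show (1 / 4 : ℝ) < 1 by norm_num)
  have contra {T : ℤ → ℕ} {q : ℤ} (h1 : |lam T q - jZero| ≤ 2 * (1 / 4) ^ K)
      (h2 : x < lam T q) : False := by
    have := (abs_le.1 h1).2
    linarith
  -- A star far to the right starts an infinite run, which contains every later place with `lam`
  -- above x well inside.
  by_cases hstar : ∃ n, N + 100 ≤ n ∧ IsStar S n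
  · obtain ⟨n, hn, hs⟩ := hstar
    have hall (k : ℕ) : IsStar S (n + 9 * k) := by
      induction k with
      | zero => simpa using hs
      | succ k ih =>
        have := (right _ (by omega) ih).1
        convert this using 1
        push_cast
        ring
    obtain ⟨q, hq, hl⟩ := hf (n + 9 * K + 9)
    exact contra (near_jZero hS (R := (q + 9 * K + 9 - n).toNat) (fun k _ => hall k) hq (by omega)
      (star_or q (by omega) hl)) hl
  · push Not at hstar
    have tstar (q : ℤ) (hq : N + 100 ≤ q) (hl : x < lam S q) : IsStar (rev S) (-q) :=
      (star_or q hq hl).resolve_left (hstar q hq)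
    -- Only transposed stars are left, and they replicate to the left. The run that starts at n₂
    -- passes n₁ and goes on almost to N, so n₁ is deep inside a run.
    obtain ⟨n₁, h1, hl1⟩ := hf (N + 100 + 9 * K + 30)
    obtain ⟨n₂, h2, hl2⟩ := hf (n₁ + 9 * K + 9)
    have hall (k : ℕ) (hk : 9 * (k : ℤ) ≤ n₂ - N - 90) : IsStar (rev S) (-n₂ + 9 * k) := by
      induction k with
      | zero => simpa using tstar n₂ (by omega) hl2
      | succ k ih =>
        push_cast at hk
        have := (left (n₂ - 9 * k) (by omega) (by
          convert ih (by omega) using 1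
          ring)).1
        convert this using 1
        push_cast
        ring
    refine contra (near_jZero hT.rev.one_le (p := -n₂) (q := -n₁) (K := K)
      (R := ((n₂ - N - 90) / 9).toNat) (fun k hk => hall k (by omega)) (by omega) (by omega)
      (Or.inl (tstar n₁ (by omega) hl1))) ?_
    rwa [lam_rev, neg_neg]

/-- The bound on `lam` holds only from some place on. Replacing the uncontrolled left part gives a
tame sequence whose values of `lam` far to the right are almost unchanged, hence a contradiction
with `not_frequently_of_tame`. -/
theorem lagrangeSpectrum_inter_Ioo : lagrangeSpectrum ∩ Set.Ioo jZero jMax = ∅ := by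
  ext x
  simp only [Set.mem_inter_iff, Set.mem_Ioo, Set.mem_empty_iff_false, iff_false, not_and]
  intro hx h0 h1
  obtain ⟨S, hS, hup, hfr⟩ := exists_seq_of_mem_lagrangeSpectrum hx
    (three_lt_jZero.trans h0)
  obtain ⟨ε, hε, h0', h1'⟩ : ∃ ε > 0, jZero + 3 * ε < x ∧ x + 3 * ε < jMax := by
    refine ⟨min (x - jZero) (jMax - x) / 4, ?_, ?_, ?_⟩
    · have := lt_min (sub_pos.2 h0) (sub_pos.2 h1)
      linarith
    · have := min_le_left (x - jZero) (jMax - x)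
      linarith
    · have := min_le_right (x - jZero) (jMax - x)
      linarith
  obtain ⟨N, hN⟩ := hup ε hε
  have hlam (i : ℤ) (hi : (N : ℤ) ≤ i) : lam S i < x + ε := by
    have := hN i.toNat (by omega)
    rwa [show ((i.toNat : ℕ) : ℤ) = i by omega] at this
  have hav := fun b => avoidOn_sideWords hS (low_of_lam_lt hS (a := N) (b := b)
    (fun i hi => (hlam i hi).trans (by linarith)) le_rfl)
  -- The filler 2 occurs in neither 13 nor 31, so the junction creates no such word.
  set T : ℤ → ℕ := fun i => if i < N + 12 then 2 else S i with hT
  have heq (i : ℤ) (hi : (N : ℤ) + 12 ≤ i) : T i = S i := if_neg (by omega)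
  have hlt (i : ℤ) (hi : i < (N : ℤ) + 12) : T i = 2 := if_pos hi
  have htame : Tame T := by
    have main (i : ℤ) (a b : ℕ) (ha : a ≠ 2) (hb : b ≠ 2) (hab : [a, b] ∈ sideWords)
        (h : T i = a) : T (i + 1) ≠ b := by
      intro h'
      by_cases hi : i < N + 12
      · rw [hlt i hi] at h
        exact ha h.symm
      · rw [heq _ (by omega)] at h h'
        exact hav (i + 13) _ hab i (by omega)
          (by simp only [List.length_cons, List.length_nil]; omega) ⟨h, h', trivial⟩
    refine ⟨fun i => ?_, fun i => main i 1 3 (by norm_num) (by norm_num) (by decide),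
      fun i => main i 3 1 (by norm_num) (by norm_num) (by decide)⟩
    by_cases hi : i < N + 12
    · exact Or.inr (Or.inl (hlt i hi))
    · rw [heq _ (by omega)]
      exact letters_of_lam_lt hS ((hlam i (by omega)).trans (by linarith))
  obtain ⟨K, hK⟩ := exists_pow_lt_of_lt_one hε (show (1 / 4 : ℝ) < 1 by norm_num)
  have hclose (i : ℤ) (hi : (N : ℤ) + 12 + 2 * K ≤ i) : |lam T i - lam S i| < ε := by
    refine lt_of_le_of_lt ?_ hK
    have := abs_cfInf_sub_le (fun n => T (i - 1 - n)) (fun n => S (i - 1 - n))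
      (fun _ => htame.one_le _) (fun _ => hS _) K fun n hn => heq _ (by omega)
    have e : (fun n : ℕ => T (i + 1 + n)) = fun n : ℕ => S (i + 1 + n) :=
      funext fun n => heq _ (by omega)
    rw [lam_eq, lam_eq, heq i (by omega), e, add_sub_add_left_eq_sub]
    exact this
  refine not_frequently_of_tame htame (N := N + 12 + 2 * K) (x := x - 2 * ε) (fun i hi => ?_)
    (by linarith) fun M => ?_
  · have := abs_lt.1 (hclose i hi)
    have := hlam i (by omega)
    linarith
  · obtain ⟨n, hn, hl⟩ := hfr ε hε (max M.toNat (N + 12 + 2 * K))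
    have hn1 := (le_max_left _ _).trans hn
    have hn2 := (le_max_right _ _).trans hn
    refine ⟨n, by omega, ?_⟩
    have := abs_lt.1 (hclose n (by exact_mod_cast hn2))
    linarith

/-! ### The points of `D` are isolated -/

/-- Close values of `lam` have the same letters on a window to the left that contains the transposed
outer star. Both sequences are periodic beyond it, so they coincide. -/
theorem setD_isolated {x : ℝ} (hx : x ∈ setD) : ∃ ε : ℝ, 0 < ε ∧
    (markovSpectrum \ lagrangeSpectrum) ∩ Set.Ioo (x - ε) (x + ε) = {x} := by
  obtain ⟨u, hu, rfl⟩ := exists_sharp_of_mem_setD hx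
  obtain ⟨h1, h2, h3⟩ := hu.mem
  have h2' := constants_lt.1.trans_le h2
  -- The first two bounds keep the neighbours in (j₀, J), where they come from sharp sequences. The
  -- third is the separation in `le_abs_cfInf_sub`, at a depth beyond the block of the transposed
  -- star at distance |u| + 27.
  obtain ⟨ε, hε, e1, e2, e3⟩ : ∃ ε > 0, ε ≤ lam (twoSeq u) 0 - jZero ∧
      ε ≤ jMax - lam (twoSeq u) 0 ∧ ε ≤ (1 / 64 : ℝ) * (1 / 16) ^ (u.length + 40) :=
    ⟨min (min (lam (twoSeq u) 0 - jZero) (jMax - lam (twoSeq u) 0))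
      ((1 / 64 : ℝ) * (1 / 16) ^ (u.length + 40)),
      lt_min (lt_min (sub_pos.2 h2') (sub_pos.2 h3)) (by positivity),
      (min_le_left _ _).trans (min_le_left _ _), (min_le_left _ _).trans (min_le_right _ _),
      min_le_right _ _⟩
  refine ⟨ε, hε, Set.Subset.antisymm ?_ ?_⟩
  · rintro y ⟨⟨hy, _⟩, hy1, hy2⟩
    obtain ⟨S, hS, rfl⟩ := exists_sharp hy (by linarith) (by linarith)
    have hrange {T : ℤ → ℕ} (hT : Sharp T) (i : ℤ) : 1 ≤ T i ∧ T i ≤ 3 :=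
      ⟨hT.reg.one_le i, hT.reg.tame.le_three i⟩
    have hagree (n : ℕ) (hn : n ≤ u.length + 40) : S (0 - 1 - n) = twoSeq u (0 - 1 - n) := by
      by_contra hne
      have hd := le_abs_cfInf_sub n (fun n => S (0 - 1 - n)) (fun n => twoSeq u (0 - 1 - n))
        (fun _ => hrange hS _) (fun _ => hrange hu _) hne
      have e : cfInf (fun n => S (0 - 1 - n)) - cfInf (fun n => twoSeq u (0 - 1 - n))
          = lam S 0 - lam (twoSeq u) 0 := by
        rw [lam_of_right fun j hj => by rw [zero_add]; exact hS.right (by omega),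
          lam_of_right fun j hj => by rw [zero_add]; exact hu.right (by omega)]
        ring
      rw [e] at hd
      have hlt : |lam S 0 - lam (twoSeq u) 0| < ε := abs_lt.2 ⟨by linarith, by linarith⟩
      have hp : (1 / 16 : ℝ) ^ (u.length + 40) ≤ (1 / 16) ^ n :=
        pow_le_pow_of_le_one (by norm_num) (by norm_num) hn
      linarith
    have hst : IsStar (rev (twoSeq u)) (u.length + 27) := by
      rw [rev_twoSeq, isStar_shift, add_neg_cancel]
      refine (occ_congr fun n hn => ?_).1 isStar_seqZero
      exact (tailSeq_right _ _ (by omega)).symm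
    have hst' : IsStar (rev S) (u.length + 27) := by
      refine (occ_congr fun n hn => ?_).1 hst
      have hlen : blockWord.length = 15 := rfl
      obtain ⟨k, hk⟩ := Int.eq_ofNat_of_zero_le
        (show 0 ≤ (u.length : ℤ) + 27 - 8 + n - 1 by omega)
      simp only [rev]
      rw [show -((u.length : ℤ) + 27 - 8 + n) = 0 - 1 - k by omega]
      exact (hagree k (by omega)).symm
    have e : S = twoSeq u := by
      funext j
      by_cases hj : -15 ≤ j
      · rw [hS.right hj, hu.right hj]
      · by_cases hj' : -(u.length + 40 : ℤ) ≤ j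
        · obtain ⟨k, hk⟩ := Int.eq_ofNat_of_zero_le (show 0 ≤ -j - 1 by omega)
          rw [show j = 0 - 1 - k by omega]
          exact hagree k (by omega)
        · have a1 := hS.reg.rev.half.eq_seqZero hst' (j := -j - (u.length + 27)) (by omega)
          have a2 := hu.reg.rev.half.eq_seqZero hst (j := -j - (u.length + 27)) (by omega)
          have := a1.trans a2.symm
          simp only [rev] at this
          convert this using 2 <;> ring
    rw [e]
    rfl
  · rintro y rfl
    refine ⟨⟨h1, fun hL => ?_⟩, by linarith, by linarith⟩
    have : lam (twoSeq u) 0 ∈ lagrangeSpectrum ∩ Set.Ioo jZero jMax := ⟨hL, h2', h3⟩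
    rw [lagrangeSpectrum_inter_Ioo] at this
    exact this

/-! ### A Gauss-Cantor set in `C` -/

/-- A forbidden word that meets a left part over {1, 2} would split into a piece without the letter
3 and a prefix of the fixed word; no split does this. The full-length split shows that every
forbidden word contains a 3. -/
theorem leftAvoids_aux : ∀ f ∈ forbiddenWords ++ forbiddenWords.map List.reverse,
    ¬ f <:+: [2] ++ [1, 2] ++ omega ++ omega ++ [1] ∧ ∀ n ≤ f.length,
      3 ∈ f.take n ∨ ¬ f.drop n <+: [2] ++ [1, 2] ++ omega ++ omega ++ [1] := by
  decide +kernel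

theorem leftAvoids_of_one_two {l : ℕ → ℕ} (hl : ∀ n, l n = 1 ∨ l n = 2) :
    LeftAvoids l ([2] ++ [1, 2] ++ omega ++ omega ++ [1]) := by
  intro m
  have h3 : 3 ∉ ((List.range m).map l).reverse := by
    rw [List.mem_reverse, List.mem_map]
    rintro ⟨n, _, hn⟩
    rcases hl n with h | h <;> omega
  have main (f : List ℕ) (hf : f ∈ forbiddenWords ++ forbiddenWords.map List.reverse) :
      ¬ f <:+: ((List.range m).map l).reverse ++ ([2] ++ [1, 2] ++ omega ++ omega ++ [1]) := by
    obtain ⟨a1, a2⟩ := leftAvoids_aux f hf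
    rw [List.infix_append_iff]
    rintro (h | h | ⟨t₁, t₂, rfl, h1, h2⟩)
    · rcases a2 f.length le_rfl with h' | h'
      · rw [List.take_length] at h'
        exact h3 (h.subset h')
      · rw [List.drop_length] at h'
        exact h' List.nil_prefix
    · exact a1 h
    · rcases a2 t₁.length (by simp) with h' | h'
      · rw [List.take_left] at h'
        exact h3 (h1.subset h')
      · rw [List.drop_left] at h'
        exact h' h2
  intro f hf
  exact ⟨main f (List.mem_append_left _ hf),
    main _ (List.mem_append_right _ (List.mem_map_of_mem hf))⟩

/-- With t = 2 every left half over {1, 2} is admissible, so the free letters 1 and 2 serve as the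
alphabet of the Cantor set. The right half contributes the constant 3 + `rho`. -/
theorem exists_gaussCantor_subset_setC :
    ∃ (K : Set ℝ) (c : ℝ), IsGaussCantor K ∧ ∀ y ∈ K, c + y ∈ setC := by
  refine ⟨_, 3 + rho, ⟨{[1], [2]}, [3, 3, 2, 1] ++ omegaT ++ [2, 1, 2], by decide, by decide,
    by decide, by decide, rfl⟩, ?_⟩
  rintro _ ⟨γ, v, hγ, hv, rfl⟩
  -- The word between the star and the free letters, 3321 ωᵀ 212, has 16 letters.
  have shift (f : ℕ → ℕ) (n : ℕ) :
      prepend ([3, 3, 2, 1] ++ omegaT ++ [2, 1, 2]) f (16 + n) = f n :=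
    prepend_add_length ([3, 3, 2, 1] ++ omegaT ++ [2, 1, 2]) f n
  have hl (n : ℕ) : v (16 + n) = 1 ∨ v (16 + n) = 2 := by
    obtain ⟨r, hr⟩ := hv (n + 1)
    have hγ' (i : ℕ) : ∃ a, (a = 1 ∨ a = 2) ∧ γ i = [a] := by
      have := hγ i
      simp only [Finset.mem_insert, Finset.mem_singleton] at this
      rcases this with h | h
      · exact ⟨1, Or.inl rfl, h⟩
      · exact ⟨2, Or.inr rfl, h⟩
    choose g hg hg' using hγ'
    obtain rfl : γ = fun i => [g i] := funext hg'
    have e : ((List.range (n + 1)).map fun i => [g i]).flatten = (List.range (n + 1)).map g := by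
      rw [← List.flatMap_def, ← List.map_eq_flatMap]
    rw [hr, e, prepend_append, shift, prepend_of_lt _ _ (by simp),
      List.getD_eq_getElem _ _ (by simp)]
    simpa using hg n
  have hpre : v = prepend ([3, 3, 2, 1] ++ omegaT ++ [2, 1, 2]) fun n => v (16 + n) := by
    funext n
    obtain ⟨r, hr⟩ := hv 0
    by_cases hn : n < 16
    · rw [prepend_of_lt _ _ (by exact hn)]
      rw [hr, List.range_zero, List.map_nil, List.flatten_nil, List.append_nil,
        prepend_of_lt _ _ (by exact hn)]
    · obtain ⟨m, rfl⟩ := Nat.exists_eq_add_of_le (not_lt.1 hn)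
      exact (shift (fun n => v (16 + n)) m).symm
  have hl1 (n : ℕ) : 1 ≤ v (16 + n) := by rcases hl n with h | h <;> omega
  refine ⟨fun n => v (16 + n), [2], fun n => ?_, Or.inl rfl, leftAvoids_of_one_two hl, ?_⟩
  · rcases hl n with h | h
    · exact Or.inl h
    · exact Or.inr (Or.inl h)
  · change _ = lambda0 (tailSeq (fun n => v (16 + n)) ([2] ++ [1, 2]))
    rw [← lam_zero, lam_tailSeq hl1 (by decide), ← cfT_append]
    rw [show cfInf v = cfInf (prepend ([3, 3, 2, 1] ++ omegaT ++ [2, 1, 2]) fun n => v (16 + n))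
      from congrArg _ hpre, cfInf_prepend _ _ (by decide) hl1]
    rfl

end MarkovLagrange

open MarkovLagrange in
theorem mainTheorem4 :
    (jZero < jMin ∧ jMin < jPrime ∧ jPrime < jMax) ∧
    markovSpectrum ∩ Set.Ioo jZero jMin = ∅ ∧
    lagrangeSpectrum ∩ Set.Ioo jZero jMax = ∅ ∧
    (markovSpectrum \ lagrangeSpectrum) ∩ Set.Ioo jZero jMax = setC ∪ setD ∪ setX ∧
    (∃ (K : Set ℝ) (c : ℝ), IsGaussCantor K ∧ ∀ y ∈ K, c + y ∈ setC) ∧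
    (∀ x ∈ setD, ∃ ε : ℝ, 0 < ε ∧
      (markovSpectrum \ lagrangeSpectrum) ∩ Set.Ioo (x - ε) (x + ε) = {x}) := by
  refine ⟨constants_lt, markovSpectrum_inter_Ioo_jMin, lagrangeSpectrum_inter_Ioo, ?_,
    exists_gaussCantor_subset_setC, fun x hx => setD_isolated hx⟩
  have h := lagrangeSpectrum_inter_Ioo
  rw [← Set.disjoint_iff_inter_eq_empty] at h
  rw [← markovSpectrum_inter_Ioo, Set.inter_comm, ← Set.inter_sdiff_assoc,
    sdiff_eq_left.2 (h.symm.mono_left Set.inter_subset_left), Set.inter_comm]
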